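/- **Setting.** Let $d\ge 2$ and let $\Omega\subset\mathbb R^d$ be bounded and open. Let $g(s)=\sum_{i=0}^N a_i s^{\alpha_i}$ with $N\ge1$, $0=\alpha_0<\alpha_1<\dots<\alpha_N$ real, $a_i\ge 0$, $a_0>0$, $a_N>0$. For $\xi\ge0$ let $s(\xi)\ge0$ be the unique solution of $s\,g(s)=\xi$ and put $K(\xi)=1/g(s(\xi))$. Put $a=\frac{\alpha_N}{\alpha_N+1}$, $\beta=2-a$, $\lambda=\frac{2-a}{1-a}$, and assume the degree condition $a\le \frac{4}{d+2}$. Write $\|\cdot\|$ and $(\cdot,\cdot)$ for the norm and inner product of $L^2(\Omega)$ (and of $(L^2(\Omega))^d$) and $\|\cdot\|_1$ for the norm of $H^1(\Omega)$. *Meshes.* A triangulation $\mathcal T_h$ of $\Omega$ is a finite family of pairwise disjoint nonempty open sets $T\subset\Omega$ (elements, e.g. open simplices, possibly curved along the boundary) that covers $\Omega$ up to a null set; $h$ is the largest diameter of an element. It is quasiuniform with constant $\sigma>0$ if every element contains a ball of radius $\sigma h$ and is star-shaped with respect to each point of that ball. For an integer $r\ge0$, $W_h\subset L^2(\Omega)$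 is the space of discontinuous piecewise polynomials of degree at most $r$ over $\mathcal T_h$, $\nabla$ is taken element by element on $W_h$, and $\pi:L^2(\Omega)\to W_h$ is the $L^2$-projection. *Data.* Let $\rho^0\in H^1(\Omega)$, let $\phi\in C^1([0,\infty);H^1(\Omega))$ (an extension of the boundary data), and let $f:[0,\infty)\to L^2(\Omega)$ be such that $\tilde f=f-\phi_t\in C^1([0,\infty);L^2(\Omega))$. Put $\phi^0=\phi(0)$, $\tilde\rho^0=\rho^0-\phi^0$, and $$\mathfrak g(t)=\|\tilde f(t)\|^{\lambda}+\|\phi(t)\|_1^2 .$$ $Env\,\mathfrak g$ denotes any continuous nondecreasing function on $[0,\infty)$ with $Env\,\mathfrak g(t)\ge \mathfrak g(t)$ for all $t\ge0$. *Semidiscrete problem.* $\tilde\rho_h:[0,\infty)\to W_h$ solves the semidiscrete problem if it is continuous on $[0,\infty)$, differentiable on $(0,\infty)$, $\tilde\rho_h(0)=\pi\tilde\rho^0$ and, with $\rho_h=\tilde\rho_h+\pi\phi$, $$(\tilde\rho_{h,t},w_h)+\big(K(|\nabla\rho_h|)\nabla\rho_h,\nabla w_h\big)=(\tilde f,w_h)\qquad\text{for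 all } w_h\in W_h,\ t>0 .$$ **Theorem.** There is a constant $C>0$, depending only on $g,d,\Omega,r,\sigma$ (thus independent of the mesh and of $h$, of the data, of $t_0$ and of $t$), such that for every triangulation of $\Omega$ that is quasiuniform with constant $\sigma$, all data as above and every solution $\tilde\rho_h$ of the semidiscrete problem: 1. for all $0<t_0<1$, all $t\ge t_0$ and every envelope $Env\,\mathfrak g$, $$\|\tilde\rho_{h,t}(t)\|^2\le C\,\mathcal B(t),$$ where $$\begin{aligned}\mathcal B(t)={}&t_0^{-1}e^{-\frac14(t-t_0)}\Big\{1+\|\rho^0\|_1^2+\|\phi^0\|^2+\int_0^{t_0}\big(\|\phi_t(s)\|_1^2+(Env\,\mathfrak g(s))^{\frac2\beta}\big)ds\Big\}\\&+\int_0^t e^{-\frac14(t-s)}\Big(1+\|\tilde\rho^0\|^2+\|\phi_t(s)\|_1^2+\|\tilde f_t(s)\|^2+(Env\,\mathfrak g(s))^{\frac2\beta}\Big)ds;\end{aligned}$$ 2. in $[0,\infty]$, $$\limsup_{t\to\infty}\|\tilde\rho_{h,t}(t)\|^2\le C\Big(1+\big(\limsup_{t\to\infty}\mathfrak g(t)\big)^{\frac2\beta}+\limsup_{t\to\infty}\|\phi_t(t)\|_1^2+\limsup_{t\to\infty}\|\tilde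 f_t(t)\|^2\Big).$$ -/

import Mathlib

open MeasureTheory Set Filter Topology
open scoped ENNReal NNReal ContDiff RealInnerProductSpace

noncomputable section

namespace ForchheimerFlow

/-! ### The Forchheimer law -/

/-- A generalized polynomial `g(s) = a₀ s^{α₀} + ⋯ + a_N s^{α_N}` with `N ≥ 1`,
`0 = α₀ < α₁ < ⋯ < α_N`, `a_i ≥ 0`, `a₀ > 0` and `a_N > 0`. -/
structure Law where
  N : ℕ
  one_le_N : 1 ≤ N
  /-- the exponents `α_i` -/
  α : Fin (N + 1) → ℝ
  /-- the coefficients `a_i` -/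
  coeff : Fin (N + 1) → ℝ
  α_zero : α 0 = 0
  α_strictMono : StrictMono α
  coeff_nonneg : ∀ i, 0 ≤ coeff i
  coeff_zero_pos : 0 < coeff 0
  coeff_last_pos : 0 < coeff (Fin.last N)

namespace Law

variable (g : Law)

/-- `g(s)`, for `s ≥ 0`. -/
def eval (s : ℝ) : ℝ := ∑ i, g.coeff i * s ^ g.α i

/-- `deg g = α_N`. -/
def deg : ℝ := g.α (Fin.last g.N)

/-- For `ξ ≥ 0`, the unique solution `s ≥ 0` of `s g(s) = ξ`. -/
def root (ξ : ℝ) : ℝ := Function.invFunOn (fun s : ℝ => s * g.eval s) (Ici 0) ξ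

/-- `K(ξ) = 1 / g(s(ξ))`, for `ξ ≥ 0`. -/
def K (ξ : ℝ) : ℝ := 1 / g.eval (g.root ξ)

/-- `a = α_N / (α_N + 1)`. -/
def a : ℝ := g.deg / (g.deg + 1)

/-- `β = 2 - a`. -/
def β : ℝ := 2 - g.a

/-- `λ = (2 - a) / (1 - a)`. -/
def lam : ℝ := (2 - g.a) / (1 - g.a)

end Law

/-! ### `L²(Ω)` and `H¹(Ω)` -/

/-- `ℝ^d` with its Euclidean norm. -/
abbrev Space (d : ℕ) := EuclideanSpace ℝ (Fin d)

variable {d : ℕ}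

/-- `L²(Ω)`. -/
abbrev L2 (Ω : Set (Space d)) := Lp ℝ 2 (volume.restrict Ω)

/-- `(L²(Ω))^d`. -/
abbrev L2Vec (Ω : Set (Space d)) := Lp (Space d) 2 (volume.restrict Ω)

/-- `ψ` is a test function on `Ω`: smooth, with compact support inside `Ω`. -/
def IsTestFunction (Ω : Set (Space d)) (ψ : Space d → ℝ) : Prop :=
  ContDiff ℝ ∞ ψ ∧ HasCompactSupport ψ ∧ tsupport ψ ⊆ Ω

/-- `G` is the weak (distributional) gradient of `u` in `Ω`. -/
def HasWeakGradient (Ω : Set (Space d)) (u : L2 Ω) (G : L2Vec Ω) : Prop :=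
  ∀ ψ : Space d → ℝ, IsTestFunction Ω ψ →
    ∫ x in Ω, u x • gradient ψ x = - ∫ x in Ω, ψ x • G x

theorem IsTestFunction.memLp {Ω : Set (Space d)} {ψ : Space d → ℝ}
    (h : IsTestFunction Ω ψ) : MemLp ψ 2 (volume.restrict Ω) :=
  (h.1.continuous.memLp_of_hasCompactSupport h.2.1).restrict _

theorem IsTestFunction.memLp_gradient {Ω : Set (Space d)} {ψ : Space d → ℝ}
    (h : IsTestFunction Ω ψ) : MemLp (gradient ψ) 2 (volume.restrict Ω) := by
  have hc : Continuous (gradient ψ) :=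
    (InnerProductSpace.toDual ℝ (Space d)).symm.continuous.comp
      (h.1.continuous_fderiv (by simp))
  have hs : HasCompactSupport (gradient ψ) :=
    (h.2.1.fderiv ℝ).comp_left (g := (InnerProductSpace.toDual ℝ (Space d)).symm) (map_zero _)
  exact (hc.memLp_of_hasCompactSupport hs).restrict _

/-- `H¹(Ω)`, as the space of pairs `(u, ∇u)` inside `L²(Ω) × (L²(Ω))^d`. The norm it inherits from
the `ℓ²`-product is `‖u‖₁ = (‖u‖² + ‖∇u‖²)^{1/2}`. -/
def H1 (Ω : Set (Space d)) : Submodule ℝ (WithLp 2 (L2 Ω × L2Vec Ω)) where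
  carrier := {p | HasWeakGradient Ω p.fst p.snd}
  zero_mem' := by
    intro ψ _
    have h1 : ∫ x in Ω, (0 : L2 Ω) x • gradient ψ x = 0 := by
      rw [integral_congr_ae (g := fun _ => 0), integral_zero]
      filter_upwards [Lp.coeFn_zero ℝ 2 (volume.restrict Ω)] with x hx
      rw [hx, Pi.zero_apply, zero_smul]
    have h2 : ∫ x in Ω, ψ x • (0 : L2Vec Ω) x = 0 := by
      rw [integral_congr_ae (g := fun _ => 0), integral_zero]
      filter_upwards [Lp.coeFn_zero (Space d) 2 (volume.restrict Ω)] with x hx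
      rw [hx, Pi.zero_apply, smul_zero]
    simp only [WithLp.zero_fst, WithLp.zero_snd]
    rw [h1, h2, neg_zero]
  add_mem' := by
    intro p q hp hq ψ hψ
    have i1 : ∀ u : L2 Ω, Integrable (fun x => u x • gradient ψ x) (volume.restrict Ω) :=
      fun u => memLp_one_iff_integrable.1 (hψ.memLp_gradient.smul (Lp.memLp u))
    have i2 : ∀ G : L2Vec Ω, Integrable (fun x => ψ x • G x) (volume.restrict Ω) :=
      fun G => memLp_one_iff_integrable.1 ((Lp.memLp G).smul hψ.memLp)
    have h1 : ∫ x in Ω, (p + q).fst x • gradient ψ x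
        = ∫ x in Ω, p.fst x • gradient ψ x + q.fst x • gradient ψ x := by
      apply integral_congr_ae
      filter_upwards [Lp.coeFn_add p.fst q.fst] with x hx
      rw [WithLp.add_fst, hx, Pi.add_apply, add_smul]
    have h2 : ∫ x in Ω, ψ x • (p + q).snd x
        = ∫ x in Ω, ψ x • p.snd x + ψ x • q.snd x := by
      apply integral_congr_ae
      filter_upwards [Lp.coeFn_add p.snd q.snd] with x hx
      rw [WithLp.add_snd, hx, Pi.add_apply, smul_add]
    rw [h1, h2, integral_add (i1 _) (i1 _), integral_add (i2 _) (i2 _), hp ψ hψ, hq ψ hψ, neg_add]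
  smul_mem' := by
    intro c p hp ψ hψ
    have h1 : ∫ x in Ω, (c • p).fst x • gradient ψ x
        = ∫ x in Ω, c • (p.fst x • gradient ψ x) := by
      apply integral_congr_ae
      filter_upwards [Lp.coeFn_smul c p.fst] with x hx
      rw [WithLp.smul_fst, hx, Pi.smul_apply, smul_assoc]
    have h2 : ∫ x in Ω, ψ x • (c • p).snd x
        = ∫ x in Ω, c • (ψ x • p.snd x) := by
      apply integral_congr_ae
      filter_upwards [Lp.coeFn_smul c p.snd] with x hx
      rw [WithLp.smul_snd, hx, Pi.smul_apply, smul_comm]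
    rw [h1, h2, integral_smul, integral_smul, hp ψ hψ, smul_neg]

/-- The inclusion `H¹(Ω) → L²(Ω)`. -/
def incl {Ω : Set (Space d)} (u : H1 Ω) : L2 Ω := (u : WithLp 2 (L2 Ω × L2Vec Ω)).fst

/-! ### Triangulations and piecewise polynomials -/

/-- A finite subdivision of `Ω` into pairwise disjoint nonempty bounded open elements, covering `Ω`
up to a null set. The elements need not be simplices, so that curved elements along a smooth
boundary are allowed. -/
structure Triangulation (Ω : Set (Space d)) where
  elements : Finset (Set (Space d))
  isOpen : ∀ T ∈ elements, IsOpen T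
  nonempty : ∀ T ∈ elements, T.Nonempty
  isBounded : ∀ T ∈ elements, Bornology.IsBounded T
  subset : ∀ T ∈ elements, T ⊆ Ω
  disjoint : (elements : Set (Set (Space d))).PairwiseDisjoint id
  covers : volume (Ω \ ⋃ T ∈ elements, T) = 0

namespace Triangulation

variable {Ω : Set (Space d)} (𝒯 : Triangulation Ω)

/-- The mesh size `h`: the largest diameter of an element. -/
def meshSize : ℝ := sSup (Metric.diam '' (𝒯.elements : Set (Set (Space d))))

/-- Quasiuniformity with constant `σ`: each element is star-shaped with respect to every point of
some ball of radius `σ h` that it contains. -/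
def IsQuasiUniform (σ : ℝ) : Prop :=
  ∀ T ∈ 𝒯.elements, ∃ c : Space d, Metric.ball c (σ * 𝒯.meshSize) ⊆ T ∧
    ∀ y ∈ Metric.ball c (σ * 𝒯.meshSize), StarConvex ℝ y T

/-- Families of polynomials of total degree at most `r`, one for each element. -/
abbrev PolyFamily (r : ℕ) : Type :=
  𝒯.elements → MvPolynomial.restrictTotalDegree (Fin d) ℝ r

variable {𝒯} {r : ℕ}

/-- The function that agrees with `p T` on the element `T`, for each `T`. -/
def polyFun (p : 𝒯.PolyFamily r) (x : Space d) : ℝ :=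
  ∑ T : 𝒯.elements, (T : Set (Space d)).indicator
    (fun x => MvPolynomial.eval x.ofLp (p T : MvPolynomial (Fin d) ℝ)) x

/-- The elementwise gradient: the function that agrees with `∇ (p T)` on the element `T`. -/
def polyGrad (p : 𝒯.PolyFamily r) (x : Space d) : Space d :=
  ∑ T : 𝒯.elements, (T : Set (Space d)).indicator
    (fun x => WithLp.toLp 2 fun i =>
      MvPolynomial.eval x.ofLp (MvPolynomial.pderiv i (p T : MvPolynomial (Fin d) ℝ))) x

theorem continuous_eval (p : MvPolynomial (Fin d) ℝ) :
    Continuous fun x : Space d => MvPolynomial.eval x.ofLp p :=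
  (MvPolynomial.continuous_eval p).comp (PiLp.continuous_ofLp 2 _)

theorem memLp_polyFun (p : 𝒯.PolyFamily r) : MemLp (polyFun p) 2 (volume.restrict Ω) := by
  refine MemLp.restrict _ ?_
  refine memLp_finsetSum _ fun T _ => ?_
  rw [memLp_indicator_iff_restrict (𝒯.isOpen _ T.2).measurableSet]
  have hc : IsCompact (closure (T : Set (Space d))) := (𝒯.isBounded _ T.2).isCompact_closure
  obtain ⟨M, hM⟩ := hc.exists_bound_of_continuousOn
    (continuous_eval (p T : MvPolynomial (Fin d) ℝ)).continuousOn
  have : IsFiniteMeasure (volume.restrict (T : Set (Space d))) :=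
    ⟨by simpa using (𝒯.isBounded _ T.2).measure_lt_top⟩
  refine MemLp.of_bound (continuous_eval _).aestronglyMeasurable M ?_
  filter_upwards [ae_restrict_mem (𝒯.isOpen _ T.2).measurableSet] with x hx
  exact hM x (subset_closure hx)

theorem polyFun_of_mem (p : 𝒯.PolyFamily r) (T : 𝒯.elements) {x : Space d}
    (hx : x ∈ (T : Set (Space d))) :
    polyFun p x = MvPolynomial.eval x.ofLp (p T : MvPolynomial (Fin d) ℝ) := by
  unfold polyFun
  rw [Finset.sum_eq_single T, indicator_of_mem hx]
  · intro T' _ hne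
    refine indicator_of_notMem (fun hx' => ?_) _
    exact Set.disjoint_left.1 (𝒯.disjoint T'.2 T.2 (fun h => hne (Subtype.ext h))) hx' hx
  · simp

variable (𝒯 r)

/-- The map sending a family of polynomials to the piecewise polynomial function in `L²(Ω)`. -/
def toL2 : 𝒯.PolyFamily r →ₗ[ℝ] L2 Ω where
  toFun p := (memLp_polyFun p).toLp (polyFun p)
  map_add' p q := by
    rw [← MemLp.toLp_add]
    congr 1
    ext x
    simp only [polyFun, Pi.add_apply, ← Finset.sum_add_distrib]
    refine Finset.sum_congr rfl fun T _ => ?_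
    by_cases hx : x ∈ (T : Set (Space d)) <;> simp [hx]
  map_smul' c p := by
    rw [RingHom.id_apply, ← MemLp.toLp_const_smul]
    congr 1
    ext x
    simp only [polyFun, Pi.smul_apply, smul_eq_mul, Finset.mul_sum]
    refine Finset.sum_congr rfl fun T _ => ?_
    by_cases hx : x ∈ (T : Set (Space d)) <;> simp [hx]

theorem toL2_injective : Function.Injective (𝒯.toL2 r) := by
  rw [← LinearMap.ker_eq_bot, LinearMap.ker_eq_bot']
  intro p hp
  have h0 : polyFun p =ᵐ[volume.restrict Ω] 0 :=
    ((memLp_polyFun p).coeFn_toLp.symm.trans (by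
      change ⇑(𝒯.toL2 r p) =ᵐ[_] _
      rw [hp]
      exact Lp.coeFn_zero _ _ _))
  funext T
  apply Subtype.ext
  have hT : EqOn (fun x : Space d => MvPolynomial.eval x.ofLp (p T : MvPolynomial (Fin d) ℝ))
      (fun _ => 0) (T : Set (Space d)) := by
    refine Measure.eqOn_open_of_ae_eq (μ := volume) ?_ (𝒯.isOpen _ T.2)
      (continuous_eval _).continuousOn continuousOn_const
    have h1 := ae_restrict_of_ae_restrict_of_subset (𝒯.subset _ T.2) h0
    filter_upwards [h1, ae_restrict_mem (𝒯.isOpen _ T.2).measurableSet] with x hx hxT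
    rw [← polyFun_of_mem p T hxT, hx]
    rfl
  obtain ⟨x₀, hx₀⟩ := 𝒯.nonempty _ T.2
  have hopen : IsOpen ((WithLp.toLp 2 : (Fin d → ℝ) → Space d) ⁻¹' (T : Set (Space d))) :=
    (𝒯.isOpen _ T.2).preimage (PiLp.continuous_toLp 2 _)
  obtain ⟨ε, hε, hball⟩ := Metric.isOpen_iff.1 hopen x₀.ofLp (by simpa using hx₀)
  refine MvPolynomial.funext_set (fun i => Metric.ball (x₀.ofLp i) ε) (fun i => ?_) fun x hx => ?_
  · rw [Real.ball_eq_Ioo]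
    exact Ioo_infinite (by linarith)
  · have hxT : WithLp.toLp 2 x ∈ (T : Set (Space d)) := by
      apply hball
      rw [← ball_pi _ hε] at hx
      exact hx
    simpa using hT hxT

/-- `W_h`: the subspace of `L²(Ω)` of (discontinuous) piecewise polynomials of degree at most `r`
over the triangulation. -/
def femSpace : Submodule ℝ (L2 Ω) := LinearMap.range (𝒯.toL2 r)

instance : FiniteDimensional ℝ (𝒯.femSpace r) :=
  inferInstanceAs (FiniteDimensional ℝ (LinearMap.range (𝒯.toL2 r)))

/-- The `L²`-projection `π` onto `W_h`. -/
def proj (u : L2 Ω) : 𝒯.femSpace r := (𝒯.femSpace r).orthogonalProjectionOnto u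

variable {𝒯 r}

/-- The elementwise gradient of an element of `W_h`. -/
def grad (v : 𝒯.femSpace r) : Space d → Space d :=
  polyGrad ((LinearEquiv.ofInjective (𝒯.toL2 r) (𝒯.toL2_injective r)).symm v)

end Triangulation

/-! ### The semidiscrete problem -/

/-- The data of the problem: the initial density `ρ⁰`, the extension `φ` of the boundary data, the
source `f`, and the time derivatives of `φ` and of `f̃ = f - φ_t`, all as functions of time with
values in function spaces on `Ω`; `φ` is `C¹` into `H¹(Ω)` and `f̃` is `C¹` into `L²(Ω)`. -/
structure Data (Ω : Set (Space d)) where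
  /-- the initial density `ρ⁰` -/
  ρ₀ : H1 Ω
  /-- the extension `φ` of the boundary data -/
  φ : ℝ → H1 Ω
  /-- its time derivative `φ_t` -/
  φt : ℝ → H1 Ω
  /-- the source `f` -/
  f : ℝ → L2 Ω
  /-- the time derivative of `f̃ = f - φ_t` -/
  ftilt : ℝ → L2 Ω
  hasDeriv_φ : ∀ t, 0 ≤ t → HasDerivWithinAt φ (φt t) (Ici 0) t
  continuousOn_φt : ContinuousOn φt (Ici 0)
  hasDeriv_ftil : ∀ t, 0 ≤ t → HasDerivWithinAt (fun s => f s - incl (φt s)) (ftilt t) (Ici 0) t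
  continuousOn_ftilt : ContinuousOn ftilt (Ici 0)

namespace Data

variable {Ω : Set (Space d)} (D : Data Ω)

/-- `f̃ = f - φ_t`. -/
def ftil (t : ℝ) : L2 Ω := D.f t - incl (D.φt t)

/-- `ρ̃⁰ = ρ⁰ - φ(0)`. -/
def ρtil₀ : L2 Ω := incl D.ρ₀ - incl (D.φ 0)

/-- The function `t ↦ ‖f̃(t)‖^λ + ‖φ(t)‖₁²`. -/
def size (g : Law) (t : ℝ) : ℝ := ‖D.ftil t‖ ^ g.lam + ‖D.φ t‖ ^ 2

/-- `G` is a continuous increasing envelope on `[0, ∞)` of `t ↦ ‖f̃(t)‖^λ + ‖φ(t)‖₁²`. -/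
def IsEnvelope (g : Law) (G : ℝ → ℝ) : Prop :=
  ContinuousOn G (Ici 0) ∧ MonotoneOn G (Ici 0) ∧ ∀ t, 0 ≤ t → D.size g t ≤ G t

/-- The bound `𝓑(t)`, for a given `t₀` and a given envelope `G`. -/
def bound (g : Law) (G : ℝ → ℝ) (t₀ t : ℝ) : ℝ :=
  t₀⁻¹ * Real.exp (-(1 / 4) * (t - t₀)) *
      (1 + ‖D.ρ₀‖ ^ 2 + ‖incl (D.φ 0)‖ ^ 2
        + ∫ s in (0 : ℝ)..t₀, (‖D.φt s‖ ^ 2 + G s ^ (2 / g.β)))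
    + ∫ s in (0 : ℝ)..t, Real.exp (-(1 / 4) * (t - s)) *
        (1 + ‖D.ρtil₀‖ ^ 2 + ‖D.φt s‖ ^ 2 + ‖D.ftilt s‖ ^ 2 + G s ^ (2 / g.β))

end Data

/-- `ρtil : [0, ∞) → W_h` solves the semidiscrete problem: with `ρ_h = ρ̃_h + π φ`,
`(ρ̃_{h,t}, w) + (K(|∇ρ_h|) ∇ρ_h, ∇w) = (f̃, w)` for all `w ∈ W_h` and `t > 0`, and
`ρ̃_h(0) = π ρ̃⁰`. -/
structure IsSemidiscreteSolution (g : Law) {Ω : Set (Space d)} (𝒯 : Triangulation Ω) (r : ℕ)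
    (D : Data Ω) (ρtil : ℝ → 𝒯.femSpace r) : Prop where
  continuousOn : ContinuousOn ρtil (Ici 0)
  differentiableAt : ∀ t, 0 < t → DifferentiableAt ℝ ρtil t
  initial : ρtil 0 = 𝒯.proj r D.ρtil₀
  equation : ∀ t, 0 < t → ∀ w : 𝒯.femSpace r,
    ⟪deriv ρtil t, w⟫
      + ∫ x in Ω, ⟪g.K ‖Triangulation.grad (ρtil t + 𝒯.proj r (incl (D.φ t))) x‖ •
          Triangulation.grad (ρtil t + 𝒯.proj r (incl (D.φ t))) x, Triangulation.grad w x⟫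
      = ⟪D.ftil t, (w : L2 Ω)⟫

end ForchheimerFlow

end

/-! On the finite-dimensional space W_h the scheme is a perturbed gradient flow ρ̃' = πf̃ − A(ρ̃ +
πφ), where A = ∇* K(|∇·|)∇ is the gradient of a convex energy, the integral of a potential of the
flux z ↦ K(|z|)z. Three scalars are followed: y, the squared distance of ρ̃_h to the kernel of ∇; H,
the energy of ρ_h; and p = ‖ρ̃_{h,t}‖². Elementwise constants lie in that kernel and nothing damps
them, which is why y is a distance and not ‖ρ̃_h‖².

Let κ = (K(|∇ρ_h|)∇ρ_h, ∇ρ_h) be the dissipation, S = 𝔤, P = ‖φ_t‖₁² and Q = ‖f̃_t‖². Testing with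
the oscillation of ρ̃_h gives y' ≤ −κ/2 − c y^{β/2} + C(1 + S); testing with the velocity gives H' ≤
−¾p + Cκ + C(1 + S^{2/β} + P); differentiating the equation in time gives p' ≤ ½p + C(P + Q). This
is `IsFlow.energySystem`. Since H ≤ κ, the sum J = p + H + A₀y with A₀ = 2(C + 1/4) satisfies J' ≤
−J/4 + A₀y/4 + data, and y cannot climb past the level where its damping balances S; this level
produces the power 2/β. Gronwall's inequality, started at a time s < t₀ where p is of order 1/t₀,
gives the first claim (`EnergySystem.le_bound`). Started once the data are close to their upper
limits and y has sunk to its absorbing level, it gives the second (`EnergySystem.eventually_le`).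

The delicate inequality is the one for p, because K decays at infinity and the flux is not uniformly
monotone. `Law.exists_weight` supplies a single weight that governs both monotonicity and Lipschitz
continuity, so the contribution of ∇πφ_t is absorbed and only the upper bound of the weight
survives. Differentiability of the flux is not used: p is estimated through difference quotients
(`IsFlow.slope_velocity_lt`).

Independence of the mesh rests on two facts. In `Triangulation.exists_poincare_le_femSpace`,
equivalence of norms on polynomials and scaling produce the factor h^{2+d−2d/β}, whose exponent is
nonnegative exactly when a ≤ 4/(d+2). In `Triangulation.exists_norm_gradL2_proj_le`, the inverse
inequality loses a factor 1/h, and approximation by piecewise constants, from a Poincaré inequality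
on star-shaped elements, regains it. -/

noncomputable section

namespace ForchheimerFlow

/-! ### Elementary inequalities for the Forchheimer polynomial -/

namespace Law

variable (g : Law)

theorem α_nonneg (i : Fin (g.N + 1)) : 0 ≤ g.α i := by
  rw [← g.α_zero]
  exact g.α_strictMono.monotone (Fin.zero_le i)

theorem α_le_deg (i : Fin (g.N + 1)) : g.α i ≤ g.deg :=
  g.α_strictMono.monotone (Fin.le_last i)

theorem deg_pos : 0 < g.deg := by
  have h : (0 : Fin (g.N + 1)) < Fin.last g.N := by
    rw [Fin.lt_def]
    simpa using Nat.lt_of_succ_le g.one_le_N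
  have := g.α_strictMono h
  rwa [g.α_zero] at this

theorem a_pos : 0 < g.a := div_pos g.deg_pos (by linarith [g.deg_pos])

theorem one_sub_a : 1 - g.a = 1 / (g.deg + 1) := by
  have := g.deg_pos
  unfold a
  field_simp
  ring

theorem a_lt_one : g.a < 1 := by
  have h : 0 < 1 / (g.deg + 1) := by have := g.deg_pos; positivity
  rw [← one_sub_a] at h
  linarith

theorem one_lt_β : 1 < g.β := by unfold β; linarith [g.a_lt_one]

theorem β_lt_two : g.β < 2 := by unfold β; linarith [g.a_pos]

theorem β_pos : 0 < g.β := by linarith [g.one_lt_β]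

theorem eval_mono {s t : ℝ} (hs : 0 ≤ s) (hst : s ≤ t) : g.eval s ≤ g.eval t :=
  Finset.sum_le_sum fun i _ =>
    mul_le_mul_of_nonneg_left (Real.rpow_le_rpow hs hst (g.α_nonneg i)) (g.coeff_nonneg i)

theorem coeff_zero_le_eval {s : ℝ} (hs : 0 ≤ s) : g.coeff 0 ≤ g.eval s := by
  have h := Finset.single_le_sum (f := fun i => g.coeff i * s ^ g.α i)
    (fun i _ => mul_nonneg (g.coeff_nonneg i) (Real.rpow_nonneg hs _)) (Finset.mem_univ 0)
  simpa [eval, g.α_zero] using h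

theorem eval_pos {s : ℝ} (hs : 0 ≤ s) : 0 < g.eval s :=
  g.coeff_zero_pos.trans_le (g.coeff_zero_le_eval hs)

theorem continuous_eval : Continuous g.eval :=
  continuous_finsetSum _ fun i _ =>
    continuous_const.mul (Real.continuous_rpow_const (g.α_nonneg i))

/-- Since g ≥ a₀, the product s g(s) has reached ξ by s = ξ/a₀, and the intermediate value theorem
applies. Only the root equation is used in what follows, never uniqueness. -/
theorem root_spec {ξ : ℝ} (hξ : 0 ≤ ξ) : 0 ≤ g.root ξ ∧ g.root ξ * g.eval (g.root ξ) = ξ := by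
  have hmem : ξ ∈ (fun s : ℝ => s * g.eval s) '' Ici 0 := by
    have hT : 0 ≤ ξ / g.coeff 0 := div_nonneg hξ g.coeff_zero_pos.le
    have hiv := intermediate_value_Icc hT
      (f := fun s : ℝ => s * g.eval s) (continuous_id.mul g.continuous_eval).continuousOn
    obtain ⟨s, hs, hs'⟩ := hiv (show ξ ∈ Icc _ _ by
      refine ⟨by simpa using hξ, ?_⟩
      calc ξ = ξ / g.coeff 0 * g.coeff 0 := (div_mul_cancel₀ _ g.coeff_zero_pos.ne').symm
        _ ≤ _ := mul_le_mul_of_nonneg_left (g.coeff_zero_le_eval hT) hT)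
    exact ⟨s, hs.1, hs'⟩
  exact ⟨Function.invFunOn_mem hmem, Function.invFunOn_eq hmem⟩

/-- Mean value theorem. The factor s tames the derivative p c^(p-1), which may blow up at 0 when p <
1: at the intermediate point c > s one has c^(p-1) s ≤ c^p ≤ t^p. -/
theorem rpow_sub_rpow_mul_le {s t p : ℝ} (hs : 0 ≤ s) (hst : s ≤ t) (hp : 0 ≤ p) :
    (t ^ p - s ^ p) * s ≤ p * t ^ p * (t - s) := by
  rcases hs.eq_or_lt with rfl | hs0
  · have : 0 ≤ p * t ^ p * (t - 0) :=
      mul_nonneg (mul_nonneg hp (Real.rpow_nonneg hst _)) (by linarith)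
    simpa using this
  rcases hst.eq_or_lt with rfl | hlt
  · simp
  obtain ⟨c, hc, hc'⟩ := exists_deriv_eq_slope (fun x : ℝ => x ^ p) hlt
    (fun x hx => (Real.continuousAt_rpow_const _ _ (Or.inl (by linarith [hx.1]))).continuousWithinAt)
    (fun x hx => (Real.differentiableAt_rpow_const_of_ne p
      (by linarith [hx.1])).differentiableWithinAt)
  have hc0 : 0 < c := hs0.trans hc.1
  rw [Real.deriv_rpow_const, eq_div_iff (by linarith)] at hc'
  rw [← hc']
  have h1 : c ^ (p - 1) * s ≤ t ^ p := by
    calc c ^ (p - 1) * s ≤ c ^ (p - 1) * c :=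
          mul_le_mul_of_nonneg_left hc.1.le (Real.rpow_nonneg hc0.le _)
      _ = c ^ p := by rw [← Real.rpow_add_one hc0.ne']; congr 1; ring
      _ ≤ t ^ p := Real.rpow_le_rpow hc0.le hc.2.le hp
  calc p * c ^ (p - 1) * (t - s) * s = p * (c ^ (p - 1) * s) * (t - s) := by ring
    _ ≤ _ := by
      have := sub_pos.2 hlt
      gcongr

theorem eval_sub_eval_mul_le {s t : ℝ} (hs : 0 ≤ s) (hst : s ≤ t) :
    (g.eval t - g.eval s) * s ≤ g.deg * g.eval t * (t - s) := by
  have ht : 0 ≤ t := hs.trans hst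
  unfold eval
  rw [← Finset.sum_sub_distrib, Finset.sum_mul, Finset.mul_sum, Finset.sum_mul]
  refine Finset.sum_le_sum fun i _ => ?_
  have h := rpow_sub_rpow_mul_le hs hst (g.α_nonneg i)
  have h2 : g.α i * t ^ g.α i * (t - s) ≤ g.deg * t ^ g.α i * (t - s) := by
    have := Real.rpow_nonneg ht (g.α i)
    have := sub_nonneg.2 hst
    have := g.α_le_deg i
    gcongr
  calc (g.coeff i * t ^ g.α i - g.coeff i * s ^ g.α i) * s
      = g.coeff i * ((t ^ g.α i - s ^ g.α i) * s) := by ring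
    _ ≤ g.coeff i * (g.deg * t ^ g.α i * (t - s)) :=
      mul_le_mul_of_nonneg_left (h.trans h2) (g.coeff_nonneg i)
    _ = _ := by ring

/-- The primitive `∑ a_i s^{α_i + 2} / (α_i + 2)` of `s g(s)`. -/
def primitive (s : ℝ) : ℝ := ∑ i, g.coeff i * (s ^ (g.α i + 2) / (g.α i + 2))

theorem primitive_nonneg {s : ℝ} (hs : 0 ≤ s) : 0 ≤ g.primitive s :=
  Finset.sum_nonneg fun i _ => mul_nonneg (g.coeff_nonneg i)
    (div_nonneg (Real.rpow_nonneg hs _) (by linarith [g.α_nonneg i]))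

theorem primitive_zero : g.primitive 0 = 0 :=
  Finset.sum_eq_zero fun i _ => by
    rw [Real.zero_rpow (by linarith [g.α_nonneg i]), zero_div, mul_zero]

/-- The tangent-line inequality of a convex function. Each power reduces to Young's inequality for s
· t^(α_i+1) with exponent α_i + 2. -/
theorem mul_eval_mul_sub_le {s t : ℝ} (hs : 0 ≤ s) (ht : 0 ≤ t) :
    t * g.eval t * (s - t) ≤ g.primitive s - g.primitive t := by
  unfold primitive eval
  rw [← Finset.sum_sub_distrib, Finset.mul_sum, Finset.sum_mul]
  refine Finset.sum_le_sum fun i _ => ?_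
  have hα := g.α_nonneg i
  have hpq : (g.α i + 2).HolderConjugate ((g.α i + 2) / (g.α i + 1)) := by
    rw [Real.holderConjugate_iff]
    refine ⟨by linarith, ?_⟩
    field_simp
    ring
  have hy := Real.young_inequality_of_nonneg hs (Real.rpow_nonneg ht (g.α i + 1)) hpq
  rw [← Real.rpow_mul ht, mul_div_cancel₀ _ (by linarith : g.α i + 1 ≠ 0)] at hy
  have h1 : t ^ (g.α i + 1) = t * t ^ g.α i := by
    rw [Real.rpow_add_one' ht (by linarith)]; ring
  have h2 : t ^ (g.α i + 2) = t * (t * t ^ g.α i) := by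
    rw [← h1, show g.α i + 2 = (g.α i + 1) + 1 by ring, Real.rpow_add_one' ht (by linarith)]; ring
  have h3 : t ^ (g.α i + 2) / ((g.α i + 2) / (g.α i + 1))
      = t ^ (g.α i + 2) - t ^ (g.α i + 2) / (g.α i + 2) := by
    field_simp
    ring
  rw [h3, h1] at hy
  calc t * (g.coeff i * t ^ g.α i) * (s - t)
      = g.coeff i * (s * (t * t ^ g.α i) - t ^ (g.α i + 2)) := by rw [h2]; ring
    _ ≤ g.coeff i * (s ^ (g.α i + 2) / (g.α i + 2) - t ^ (g.α i + 2) / (g.α i + 2)) :=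
      mul_le_mul_of_nonneg_left (by linarith) (g.coeff_nonneg i)
    _ = _ := by ring

/-! ### The flux z ↦ K(|z|)z: monotonicity, potential, coercivity -/

section Flux

variable {E : Type*} [NormedAddCommGroup E] [InnerProductSpace ℝ E]

/-- The nonlinear flux `z ↦ K(|z|) z`. -/
def flux (z : E) : E := g.K ‖z‖ • z

theorem K_pos {ξ : ℝ} (hξ : 0 ≤ ξ) : 0 < g.K ξ := one_div_pos.2 (g.eval_pos (g.root_spec hξ).1)

theorem norm_flux (z : E) : ‖g.flux z‖ = g.root ‖z‖ := by
  obtain ⟨h0, h1⟩ := g.root_spec (norm_nonneg z)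
  have hp := g.eval_pos h0
  rw [flux, norm_smul, Real.norm_of_nonneg (g.K_pos (norm_nonneg z)).le, K, one_div,
    inv_mul_eq_iff_eq_mul₀ hp.ne']
  linarith

/-- The flux is defined implicitly, but v ↦ g(|v|)v is an explicit left inverse of it. Monotonicity
and Lipschitz bounds are proved for this inverse and then transferred. -/
theorem eval_norm_flux_smul (z : E) : g.eval ‖g.flux z‖ • g.flux z = z := by
  obtain ⟨h0, h1⟩ := g.root_spec (norm_nonneg z)
  rw [norm_flux, flux, smul_smul, K, mul_one_div_cancel (g.eval_pos h0).ne', one_smul]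

theorem flux_zero : g.flux (0 : E) = 0 := by simp [flux]

theorem inner_flux_self (z : E) : ⟪g.flux z, z⟫ = g.root ‖z‖ * ‖z‖ := by
  obtain ⟨h0, h1⟩ := g.root_spec (norm_nonneg z)
  have hp := g.eval_pos h0
  rw [flux, real_inner_smul_left, real_inner_self_eq_norm_sq, K]
  field_simp
  linear_combination (-‖z‖) * h1

theorem inner_flux_self_nonneg (z : E) : 0 ≤ ⟪g.flux z, z⟫ := by
  rw [inner_flux_self]
  exact mul_nonneg (g.root_spec (norm_nonneg z)).1 (norm_nonneg z)

/-- Symmetrization: the inner product equals ½(g(|w|) + g(|v|))|w − v|² + ½(g(|w|) − g(|v|))(|w|² −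
|v|²), and the last product is nonnegative because g increases. -/
theorem inner_sub_eval_smul_ge {v w : E} (h : ‖v‖ ≤ ‖w‖) :
    1 / 2 * g.eval ‖w‖ * ‖w - v‖ ^ 2 ≤ ⟪w - v, g.eval ‖w‖ • w - g.eval ‖v‖ • v⟫ := by
  have hv := g.eval_pos (norm_nonneg v)
  have hm := g.eval_mono (norm_nonneg v) h
  have e1 : ⟪w - v, g.eval ‖w‖ • w - g.eval ‖v‖ • v⟫
      = 1 / 2 * (g.eval ‖w‖ + g.eval ‖v‖) * ‖w - v‖ ^ 2
        + 1 / 2 * (g.eval ‖w‖ - g.eval ‖v‖) * (‖w‖ ^ 2 - ‖v‖ ^ 2) := by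
    rw [norm_sub_sq_real]
    simp only [inner_sub_left, inner_sub_right, real_inner_smul_right, real_inner_self_eq_norm_sq,
      real_inner_comm w v]
    ring
  have h2 : 0 ≤ (g.eval ‖w‖ - g.eval ‖v‖) * (‖w‖ ^ 2 - ‖v‖ ^ 2) :=
    mul_nonneg (by linarith) (by nlinarith [norm_nonneg v])
  have h3 : 0 ≤ g.eval ‖v‖ * ‖w - v‖ ^ 2 := by positivity
  rw [e1]
  linarith

theorem norm_sub_eval_smul_le {v w : E} (h : ‖v‖ ≤ ‖w‖) :
    ‖g.eval ‖w‖ • w - g.eval ‖v‖ • v‖ ≤ (1 + g.deg) * g.eval ‖w‖ * ‖w - v‖ := by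
  have hw := g.eval_pos (norm_nonneg w)
  have hm := g.eval_mono (norm_nonneg v) h
  have e1 : g.eval ‖w‖ • w - g.eval ‖v‖ • v
      = g.eval ‖w‖ • (w - v) + (g.eval ‖w‖ - g.eval ‖v‖) • v := by
    rw [smul_sub, sub_smul]; abel
  have h1 := g.eval_sub_eval_mul_le (norm_nonneg v) h
  have h2 : ‖w‖ - ‖v‖ ≤ ‖w - v‖ := norm_sub_norm_le w v
  calc _ ≤ g.eval ‖w‖ * ‖w - v‖ + (g.eval ‖w‖ - g.eval ‖v‖) * ‖v‖ := by
        rw [e1]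
        refine (norm_add_le _ _).trans ?_
        rw [norm_smul, norm_smul, Real.norm_of_nonneg hw.le, Real.norm_of_nonneg (by linarith)]
    _ ≤ g.eval ‖w‖ * ‖w - v‖ + g.deg * g.eval ‖w‖ * ‖w - v‖ := by
        have := mul_le_mul_of_nonneg_left h2 (mul_nonneg g.deg_pos.le hw.le)
        linarith
    _ = _ := by ring

/-- Weighted monotonicity and Lipschitz continuity of the flux, with a common weight. -/
theorem exists_weight (z z' : E) : ∃ k : ℝ, 0 < k ∧ k ≤ 1 / g.coeff 0 ∧
    1 / (2 * (1 + g.deg) ^ 2) * k * ‖z' - z‖ ^ 2 ≤ ⟪g.flux z' - g.flux z, z' - z⟫ ∧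
    ‖g.flux z' - g.flux z‖ ≤ 2 * k * ‖z' - z‖ := by
  wlog h : ‖g.flux z‖ ≤ ‖g.flux z'‖ generalizing z z'
  · obtain ⟨k, h0, h1, h2, h3⟩ := this z' z (le_of_not_ge h)
    refine ⟨k, h0, h1, ?_, ?_⟩
    · rw [norm_sub_rev, ← neg_sub (g.flux z), ← neg_sub z, inner_neg_neg]
      exact h2
    · rw [norm_sub_rev, norm_sub_rev z']
      exact h3
  have hM := g.eval_pos (norm_nonneg (g.flux z'))
  have hd := g.deg_pos
  have hin := g.inner_sub_eval_smul_ge h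
  have hno := g.norm_sub_eval_smul_le h
  rw [eval_norm_flux_smul, eval_norm_flux_smul] at hin hno
  set M := g.eval ‖g.flux z'‖
  set V := ‖g.flux z' - g.flux z‖
  set Z := ‖z' - z‖
  have hV : 0 ≤ V := norm_nonneg _
  have hZ : 0 ≤ Z := norm_nonneg _
  -- The weight is 1/g at the larger of the two fluxes. The inverse map has strong monotonicity and
  -- Lipschitz constants both comparable to M; inverting turns both into constants comparable to
  -- 1/M.
  refine ⟨1 / M, by positivity,
    one_div_le_one_div_of_le g.coeff_zero_pos (g.coeff_zero_le_eval (norm_nonneg _)), ?_, ?_⟩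
  · refine le_trans ?_ hin
    calc 1 / (2 * (1 + g.deg) ^ 2) * (1 / M) * Z ^ 2
        ≤ 1 / (2 * (1 + g.deg) ^ 2) * (1 / M) * ((1 + g.deg) * M * V) ^ 2 := by gcongr
      _ = _ := by field_simp
  -- Strong monotonicity of the inverse and Cauchy–Schwarz give ½MV² ≤ VZ; dividing by V yields the
  -- Lipschitz bound.
  · have hcs : 1 / 2 * M * V ^ 2 ≤ V * Z := hin.trans (real_inner_le_norm _ _)
    rcases hV.eq_or_lt with h0 | h0
    · rw [← h0]; positivity
    · have : M * V ≤ 2 * Z := by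
        have : V * (M * V) ≤ V * (2 * Z) := by nlinarith
        exact le_of_mul_le_mul_left this h0
      rw [show 2 * (1 / M) * Z = 2 * Z / M by ring, le_div_iff₀ hM]
      linarith

theorem lipschitzWith_flux :
    LipschitzWith (2 / g.coeff 0).toNNReal (g.flux : E → E) := by
  refine LipschitzWith.of_dist_le_mul fun z' z => ?_
  obtain ⟨k, h0, h1, -, h3⟩ := g.exists_weight z z'
  rw [dist_eq_norm, dist_eq_norm,
    Real.coe_toNNReal _ (div_nonneg zero_le_two g.coeff_zero_pos.le)]
  refine h3.trans ?_
  rw [show 2 / g.coeff 0 = 2 * (1 / g.coeff 0) by ring]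
  gcongr

/-- Perturbed monotonicity of the flux. -/
theorem inner_flux_sub_sub_ge (z z' η : E) :
    -(2 * (1 + g.deg) ^ 2 / g.coeff 0) * ‖η‖ ^ 2 ≤ ⟪g.flux z' - g.flux z, z' - z - η⟫ := by
  obtain ⟨k, h0, h1, h2, h3⟩ := g.exists_weight z z'
  have hd := g.deg_pos
  have ha := g.coeff_zero_pos
  have h4 : ⟪g.flux z' - g.flux z, η⟫ ≤ 2 * k * ‖z' - z‖ * ‖η‖ :=
    (real_inner_le_norm _ _).trans (by gcongr)
  rw [inner_sub_right]
  set A := 2 * (1 + g.deg) ^ 2 with hA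
  have hA0 : 0 < A := by positivity
  -- Young's inequality with the parameter for which the quadratic term equals the monotonicity
  -- gain. Both carry the same weight k, so they cancel and k remains only in front of |η|², where k
  -- ≤ 1/a₀.
  have h5 : 2 * ‖z' - z‖ * ‖η‖ ≤ 1 / A * ‖z' - z‖ ^ 2 + A * ‖η‖ ^ 2 := by
    have : 0 ≤ 1 / A * (‖z' - z‖ - A * ‖η‖) ^ 2 := by positivity
    have e : 1 / A * (‖z' - z‖ - A * ‖η‖) ^ 2
      = 1 / A * ‖z' - z‖ ^ 2 + A * ‖η‖ ^ 2 - 2 * ‖z' - z‖ * ‖η‖ := by field_simp; ring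
    linarith
  have h6 := mul_le_mul_of_nonneg_left h5 h0.le
  have h7 : k * (A * ‖η‖ ^ 2) ≤ 1 / g.coeff 0 * (A * ‖η‖ ^ 2) := by gcongr
  have e : -(A / g.coeff 0) * ‖η‖ ^ 2 = -(1 / g.coeff 0 * (A * ‖η‖ ^ 2)) := by ring
  rw [e]
  nlinarith

theorem K_le {ξ : ℝ} (hξ : 0 ≤ ξ) : g.K ξ ≤ 1 / g.coeff 0 :=
  one_div_le_one_div_of_le g.coeff_zero_pos (g.coeff_zero_le_eval (g.root_spec hξ).1)

theorem inner_flux_self_eq (z : E) : ⟪g.flux z, z⟫ = g.K ‖z‖ * ‖z‖ ^ 2 := by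
  rw [flux, real_inner_smul_left, real_inner_self_eq_norm_sq]

/-- Young's inequality under the weight K(|z|): half of the dissipation absorbs the first factor,
and K ≤ 1/a₀ is spent only on η. -/
theorem abs_inner_flux_le (z η : E) :
    |⟪g.flux z, η⟫| ≤ 1 / 2 * ⟪g.flux z, z⟫ + 1 / g.coeff 0 * ‖η‖ ^ 2 := by
  have hK := g.K_pos (norm_nonneg z)
  have hK' := g.K_le (norm_nonneg z)
  have h1 : |⟪g.flux z, η⟫| ≤ g.K ‖z‖ * ‖z‖ * ‖η‖ := by
    refine (abs_real_inner_le_norm _ _).trans ?_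
    rw [flux, norm_smul, Real.norm_of_nonneg hK.le]
  have h2 : g.K ‖z‖ * (‖z‖ * ‖η‖) ≤ g.K ‖z‖ * (1 / 2 * ‖z‖ ^ 2 + ‖η‖ ^ 2) := by
    gcongr
    nlinarith [sq_nonneg (‖z‖ - ‖η‖), sq_nonneg ‖η‖]
  have h3 : g.K ‖z‖ * ‖η‖ ^ 2 ≤ 1 / g.coeff 0 * ‖η‖ ^ 2 := by gcongr
  rw [inner_flux_self_eq]
  nlinarith

/-- The potential of the flux. -/
def potential (z : E) : ℝ := ⟪g.flux z, z⟫ - g.primitive ‖g.flux z‖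

/-- The potential is the Legendre transform of `primitive`, evaluated at the flux. The subgradient
inequality follows by duality from the tangent-line inequality for `primitive` between the two flux
norms, together with Cauchy–Schwarz. -/
theorem inner_flux_le_potential_sub (z z' : E) :
    ⟪g.flux z, z' - z⟫ ≤ g.potential z' - g.potential z := by
  have h := g.mul_eval_mul_sub_le (norm_nonneg (g.flux z)) (norm_nonneg (g.flux z'))
  have h1 : ⟪g.flux z' - g.flux z, z'⟫
      = g.eval ‖g.flux z'‖ * (‖g.flux z'‖ ^ 2 - ⟪g.flux z, g.flux z'⟫) := by
    conv_lhs => rw [← g.eval_norm_flux_smul z']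
    rw [real_inner_smul_right, g.eval_norm_flux_smul z', inner_sub_left,
      real_inner_self_eq_norm_sq]
  have h2 := real_inner_le_norm (g.flux z) (g.flux z')
  have h3 := mul_le_mul_of_nonneg_left h2 (g.eval_pos (norm_nonneg (g.flux z'))).le
  unfold potential
  rw [inner_sub_left] at h1
  rw [inner_sub_right]
  nlinarith

theorem potential_nonneg (z : E) : 0 ≤ g.potential z := by
  have h := g.inner_flux_le_potential_sub 0 z
  have h0 : g.potential (0 : E) = 0 := by simp [potential, flux_zero, primitive_zero]
  rw [h0, flux_zero, inner_zero_left] at h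
  linarith

theorem potential_le (z : E) : g.potential z ≤ ⟪g.flux z, z⟫ := by
  have := g.primitive_nonneg (norm_nonneg (g.flux z))
  unfold potential
  linarith

theorem inner_flux_self_le (z : E) : ⟪g.flux z, z⟫ ≤ 1 / g.coeff 0 * ‖z‖ ^ 2 := by
  rw [inner_flux_self_eq]
  have := g.K_le (norm_nonneg z)
  gcongr

theorem continuous_flux : Continuous (g.flux : E → E) := g.lipschitzWith_flux.continuous

theorem continuous_potential : Continuous (g.potential : E → ℝ) := by
  refine (g.continuous_flux.inner continuous_id).sub ?_
  refine Continuous.comp (g := g.primitive) ?_ g.continuous_flux.norm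
  exact continuous_finsetSum _ fun i _ => continuous_const.mul
    ((Real.continuous_rpow_const (by linarith [g.α_nonneg i])).div_const _)

/-- Coercivity of the flux. -/
theorem exists_rpow_β_le : ∃ C : ℝ, 0 < C ∧ ∀ z : E, ‖z‖ ^ g.β ≤ C * (1 + ⟪g.flux z, z⟫) := by
  have hg1 := g.eval_pos zero_le_one
  have hd := g.deg_pos
  set c := g.eval 1 ^ (1 - g.a) with hc
  have hc0 : 0 < c := Real.rpow_pos_of_pos hg1 _
  refine ⟨c * (g.eval 1 + 2), by positivity, fun z => ?_⟩
  rw [inner_flux_self]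
  obtain ⟨h0, h1⟩ := g.root_spec (norm_nonneg z)
  set s := g.root ‖z‖
  set ξ := ‖z‖
  have hξ : 0 ≤ ξ := norm_nonneg z
  have hgs : g.eval s ≤ g.eval 1 * (1 + s) ^ g.deg := by
    unfold eval
    rw [Finset.sum_mul]
    refine Finset.sum_le_sum fun i _ => ?_
    rw [Real.one_rpow, mul_one]
    refine mul_le_mul_of_nonneg_left ?_ (g.coeff_nonneg i)
    exact (Real.rpow_le_rpow h0 (by linarith) (g.α_nonneg i)).trans
      (Real.rpow_le_rpow_of_exponent_le (by linarith) (g.α_le_deg i))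
  have hξ1 : ξ ≤ g.eval 1 * (1 + s) ^ (g.deg + 1) := by
    rw [Real.rpow_add_one (by linarith), ← h1]
    calc s * g.eval s ≤ (1 + s) * (g.eval 1 * (1 + s) ^ g.deg) :=
          mul_le_mul (by linarith) hgs (g.eval_pos h0).le (by linarith)
      _ = _ := by ring
  -- The exponents match because (1 − a)(α_N + 1) = 1, so ξ^(1−a) grows at most linearly in s.
  have hξ2 : ξ ^ (1 - g.a) ≤ c * (1 + s) := by
    refine (Real.rpow_le_rpow hξ hξ1 (by linarith [g.a_lt_one])).trans ?_
    rw [Real.mul_rpow hg1.le (by positivity), ← Real.rpow_mul (by linarith), one_sub_a,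
      mul_one_div_cancel (by linarith), Real.rpow_one, hc, one_sub_a]
  -- If s ≤ 1 then ξ = s g(s) ≤ g(1); if s ≥ 1 then ξ ≤ sξ.
  have hξ3 : ξ ≤ g.eval 1 + s * ξ := by
    rcases le_total s 1 with hs | hs
    · have : ξ ≤ g.eval 1 := by
        rw [← h1]
        have := g.eval_mono h0 hs
        have := g.eval_pos h0
        nlinarith
      have : 0 ≤ s * ξ := mul_nonneg h0 hξ
      linarith
    · nlinarith
  have hβ : ξ ^ g.β = ξ * ξ ^ (1 - g.a) := by
    have : g.β = (1 - g.a) + 1 := by unfold β; ring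
    rw [this, Real.rpow_add_one' hξ (by linarith [g.a_lt_one])]; ring
  rw [hβ]
  calc ξ * ξ ^ (1 - g.a) ≤ ξ * (c * (1 + s)) := by gcongr
    _ = c * (ξ + s * ξ) := by ring
    _ ≤ c * ((g.eval 1 + 2) * (1 + s * ξ)) := by
      have : 0 ≤ s * ξ := mul_nonneg h0 hξ
      gcongr
      nlinarith
    _ = _ := by ring

end Flux

end Law

/-! ### L² norms as integrals and elementary power inequalities -/

section General

variable {X E : Type*} [MeasurableSpace X] {μ : Measure X} [NormedAddCommGroup E]
  [InnerProductSpace ℝ E]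

theorem norm_sq_eq_integral (H : Lp E 2 μ) : ‖H‖ ^ 2 = ∫ x, ‖H x‖ ^ 2 ∂μ := by
  rw [← real_inner_self_eq_norm_sq, L2.inner_def]
  simp only [real_inner_self_eq_norm_sq]

theorem integrable_norm_sq (H : Lp E 2 μ) : Integrable (fun x => ‖H x‖ ^ 2) μ := by
  have := L2.integrable_inner (𝕜 := ℝ) H H
  simpa only [real_inner_self_eq_norm_sq] using this

theorem rpow_le_one_add_sq {x p : ℝ} (hx : 0 ≤ x) (hp : 0 ≤ p) (hp2 : p ≤ 2) :
    x ^ p ≤ 1 + x ^ 2 := by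
  rcases le_total x 1 with h | h
  · have := Real.rpow_le_one hx h hp
    nlinarith [sq_nonneg x]
  · have := Real.rpow_le_rpow_of_exponent_le h hp2
    rw [Real.rpow_two] at this
    linarith

theorem add_rpow_le_four_mul {x y p : ℝ} (hx : 0 ≤ x) (hy : 0 ≤ y) (hp : 0 ≤ p) (hp2 : p ≤ 2) :
    (x + y) ^ p ≤ 4 * (x ^ p + y ^ p) := by
  have key : ∀ {a b : ℝ}, 0 ≤ a → a ≤ b → (a + b) ^ p ≤ 4 * b ^ p := by
    intro a b ha hab
    calc (a + b) ^ p ≤ (2 * b) ^ p := Real.rpow_le_rpow (by linarith) (by linarith) hp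
      _ = 2 ^ p * b ^ p := Real.mul_rpow zero_le_two (ha.trans hab)
      _ ≤ 2 ^ (2 : ℝ) * b ^ p := mul_le_mul_of_nonneg_right
        (Real.rpow_le_rpow_of_exponent_le one_le_two hp2) (Real.rpow_nonneg (ha.trans hab) _)
      _ = 4 * b ^ p := by norm_num
  have h1 := Real.rpow_nonneg hx p
  have h2 := Real.rpow_nonneg hy p
  rcases le_total x y with h | h
  · linarith [key hx h]
  · rw [add_comm]
    linarith [key hy h]

end General

/-! ### The flux and its energy on L² -/

namespace Law

variable (g : Law) {X E : Type*} [MeasurableSpace X] {μ : Measure X} [NormedAddCommGroup E]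
  [InnerProductSpace ℝ E]

/-- The superposition operator `Z ↦ K(|Z|) Z` on `L²`. -/
def fluxLp (Z : Lp E 2 μ) : Lp E 2 μ := g.lipschitzWith_flux.compLp g.flux_zero Z

theorem coeFn_fluxLp (Z : Lp E 2 μ) : g.fluxLp Z =ᵐ[μ] fun x => g.flux (Z x) :=
  LipschitzWith.coeFn_compLp _ _ Z

theorem norm_fluxLp_sub_le (Z Z' : Lp E 2 μ) :
    ‖g.fluxLp Z - g.fluxLp Z'‖ ≤ 2 / g.coeff 0 * ‖Z - Z'‖ := by
  have h := g.lipschitzWith_flux.norm_compLp_sub_le g.flux_zero Z Z'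
  rwa [Real.coe_toNNReal _ (div_nonneg zero_le_two g.coeff_zero_pos.le)] at h

theorem inner_fluxLp (Z H : Lp E 2 μ) : ⟪g.fluxLp Z, H⟫ = ∫ x, ⟪g.flux (Z x), H x⟫ ∂μ := by
  rw [L2.inner_def]
  refine integral_congr_ae ?_
  filter_upwards [g.coeFn_fluxLp Z] with x hx
  rw [hx]

theorem integrable_inner_flux (Z H : Lp E 2 μ) :
    Integrable (fun x => ⟪g.flux (Z x), H x⟫) μ := by
  refine (L2.integrable_inner (𝕜 := ℝ) (g.fluxLp Z) H).congr ?_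
  filter_upwards [g.coeFn_fluxLp Z] with x hx
  rw [hx]

theorem inner_fluxLp_sub_sub_ge (Z Z' H : Lp E 2 μ) :
    -(2 * (1 + g.deg) ^ 2 / g.coeff 0) * ‖H‖ ^ 2 ≤ ⟪g.fluxLp Z' - g.fluxLp Z, Z' - Z - H⟫ := by
  rw [norm_sq_eq_integral, L2.inner_def, ← integral_const_mul]
  refine integral_mono_ae ((integrable_norm_sq H).const_mul _) (L2.integrable_inner _ _) ?_
  filter_upwards [g.coeFn_fluxLp Z, g.coeFn_fluxLp Z', Lp.coeFn_sub (g.fluxLp Z') (g.fluxLp Z),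
    Lp.coeFn_sub (Z' - Z) H, Lp.coeFn_sub Z' Z] with x h1 h2 h3 h4 h5
  rw [h3, h4, Pi.sub_apply, Pi.sub_apply, h5, Pi.sub_apply, h1, h2]
  exact g.inner_flux_sub_sub_ge _ _ _

theorem inner_fluxLp_self_nonneg (Z : Lp E 2 μ) : 0 ≤ ⟪g.fluxLp Z, Z⟫ := by
  rw [inner_fluxLp]
  exact integral_nonneg fun x => g.inner_flux_self_nonneg _

theorem abs_inner_fluxLp_le (Z H : Lp E 2 μ) :
    |⟪g.fluxLp Z, H⟫| ≤ 1 / 2 * ⟪g.fluxLp Z, Z⟫ + 1 / g.coeff 0 * ‖H‖ ^ 2 := by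
  rw [inner_fluxLp, inner_fluxLp, norm_sq_eq_integral, ← integral_const_mul, ← integral_const_mul,
    ← integral_add ((g.integrable_inner_flux Z Z).const_mul _) ((integrable_norm_sq H).const_mul _)]
  refine abs_integral_le_integral_abs.trans (integral_mono (g.integrable_inner_flux Z H).abs
    (((g.integrable_inner_flux Z Z).const_mul _).add ((integrable_norm_sq H).const_mul _))
    fun x => g.abs_inner_flux_le _ _)

theorem inner_fluxLp_self_le (Z : Lp E 2 μ) :
    ⟪g.fluxLp Z, Z⟫ ≤ 1 / g.coeff 0 * ‖Z‖ ^ 2 := by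
  rw [inner_fluxLp, norm_sq_eq_integral, ← integral_const_mul]
  exact integral_mono (g.integrable_inner_flux Z Z) ((integrable_norm_sq Z).const_mul _)
    fun x => g.inner_flux_self_le _

theorem integrable_potential (Z : Lp E 2 μ) : Integrable (fun x => g.potential (Z x)) μ := by
  refine (g.integrable_inner_flux Z Z).mono'
    (g.continuous_potential.comp_aestronglyMeasurable (Lp.aestronglyMeasurable Z)) ?_
  filter_upwards with x
  rw [Real.norm_of_nonneg (g.potential_nonneg _)]
  exact g.potential_le _

/-- The integrated potential. -/
def energy (Z : Lp E 2 μ) : ℝ := ∫ x, g.potential (Z x) ∂μ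

theorem energy_nonneg (Z : Lp E 2 μ) : 0 ≤ g.energy Z :=
  integral_nonneg fun _ => g.potential_nonneg _

theorem energy_le (Z : Lp E 2 μ) : g.energy Z ≤ ⟪g.fluxLp Z, Z⟫ := by
  rw [inner_fluxLp]
  exact integral_mono (g.integrable_potential Z) (g.integrable_inner_flux Z Z)
    fun x => g.potential_le _

theorem inner_fluxLp_le_energy_sub (Z Z' : Lp E 2 μ) :
    ⟪g.fluxLp Z, Z' - Z⟫ ≤ g.energy Z' - g.energy Z := by
  rw [inner_fluxLp, energy, energy,
    ← integral_sub (g.integrable_potential Z') (g.integrable_potential Z)]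
  refine integral_mono_ae (g.integrable_inner_flux Z _)
    ((g.integrable_potential Z').sub (g.integrable_potential Z)) ?_
  filter_upwards [Lp.coeFn_sub Z' Z] with x hx
  simp only [hx, Pi.sub_apply]
  exact g.inner_flux_le_potential_sub _ _

theorem integrable_norm_rpow_β [IsFiniteMeasure μ] (Z : Lp E 2 μ) :
    Integrable (fun x => ‖Z x‖ ^ g.β) μ := by
  refine ((integrable_const (1 : ℝ)).add (integrable_norm_sq Z)).mono'
    ((Real.continuous_rpow_const g.β_pos.le).comp_aestronglyMeasurable
      (Lp.aestronglyMeasurable Z).norm) ?_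
  filter_upwards with x
  rw [Real.norm_of_nonneg (Real.rpow_nonneg (norm_nonneg _) _)]
  exact rpow_le_one_add_sq (norm_nonneg _) g.β_pos.le g.β_lt_two.le

variable (E μ) in
-- Meant for Z = ∇ρ_h and H = ∇πφ, so that Z − H = ∇ρ̃_h: dissipation of the full density controls
-- the gradient of the homogeneous part. The finite measure pays for the constant in the pointwise
-- coercivity and for |H|^β ≤ 1 + |H|².
theorem exists_integral_rpow_β_le [IsFiniteMeasure μ] : ∃ C : ℝ, 0 < C ∧ ∀ Z H : Lp E 2 μ,
    ∫ x, ‖(Z - H) x‖ ^ g.β ∂μ ≤ C * (1 + ⟪g.fluxLp Z, Z⟫ + ‖H‖ ^ 2) := by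
  obtain ⟨C, hC, h⟩ := g.exists_rpow_β_le (E := E)
  have hm : 0 ≤ μ.real univ := measureReal_nonneg
  refine ⟨4 * (C + 1) * (1 + μ.real univ), by positivity, fun Z H => ?_⟩
  have hpt : ∀ᵐ x ∂μ, ‖(Z - H) x‖ ^ g.β
      ≤ 4 * (C + 1) * (1 + ⟪g.flux (Z x), Z x⟫ + ‖H x‖ ^ 2) := by
    filter_upwards [Lp.coeFn_sub Z H] with x hx
    rw [hx, Pi.sub_apply]
    have h1 := Real.rpow_le_rpow (norm_nonneg _) (norm_sub_le (Z x) (H x)) g.β_pos.le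
    have h2 := add_rpow_le_four_mul (norm_nonneg (Z x)) (norm_nonneg (H x)) g.β_pos.le
      g.β_lt_two.le
    have h3 := h (Z x)
    have h4 := rpow_le_one_add_sq (norm_nonneg (H x)) g.β_pos.le g.β_lt_two.le
    have h5 := g.inner_flux_self_nonneg (Z x)
    nlinarith [sq_nonneg ‖H x‖, mul_nonneg hC.le (sq_nonneg ‖H x‖)]
  have hint₀ : Integrable (fun x => 1 + ⟪g.flux (Z x), Z x⟫) μ :=
    (integrable_const 1).add (g.integrable_inner_flux Z Z)
  have hint : Integrable (fun x => 1 + ⟪g.flux (Z x), Z x⟫ + ‖H x‖ ^ 2) μ :=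
    hint₀.add (integrable_norm_sq H)
  refine (integral_mono_ae (g.integrable_norm_rpow_β _) (hint.const_mul _) hpt).trans ?_
  rw [integral_const_mul, integral_add hint₀ (integrable_norm_sq H),
    integral_add (integrable_const 1) (g.integrable_inner_flux Z Z),
    ← inner_fluxLp, ← norm_sq_eq_integral, integral_const, smul_eq_mul, mul_one]
  have h1 := g.inner_fluxLp_self_nonneg Z
  rw [mul_assoc (4 * (C + 1)) (1 + _)]
  refine mul_le_mul_of_nonneg_left ?_ (by positivity : 0 ≤ 4 * (C + 1))
  have h2 : 0 ≤ μ.real univ * ⟪g.fluxLp Z, Z⟫ := mul_nonneg hm h1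
  have h3 : 0 ≤ μ.real univ * ‖H‖ ^ 2 := mul_nonneg hm (sq_nonneg _)
  linarith

end Law

/-! ### Comparison principles and Gronwall's inequality -/

section Comparison

/-- A level above which a function strictly decreases cannot be crossed from below. -/
theorem le_of_deriv_neg_above {y y' : ℝ → ℝ} {s t m : ℝ} (hst : s ≤ t)
    (hc : ContinuousOn y (Icc s t)) (hd : ∀ x ∈ Ioo s t, HasDerivAt y (y' x) x) (hs : y s ≤ m)
    (h : ∀ x ∈ Ioo s t, m < y x → y' x < 0) : y t ≤ m := by
  by_contra! hlt
  rcases hst.eq_or_lt with rfl | hst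
  · linarith
  have hev : ∀ᶠ x in 𝓝[>] s, y x < y t := by
    have h1 : Tendsto y (𝓝[>] s) (𝓝 (y s)) :=
      ((hc s (left_mem_Icc.2 hst.le)).mono_of_mem_nhdsWithin (Icc_mem_nhdsGE hst)).mono_left
        (nhdsWithin_mono _ Ioi_subset_Ici_self)
    exact h1.eventually_lt_const (by linarith)
  -- The barrier is the constant midway between m and y t. It exceeds m, so y decreases wherever it
  -- touches the barrier, and it lies below y t, which gives the contradiction.
  have hev2 : ∀ᶠ x in 𝓝[>] s, y x < (y t + m) / 2 := by
    have h1 : Tendsto y (𝓝[>] s) (𝓝 (y s)) :=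
      ((hc s (left_mem_Icc.2 hst.le)).mono_of_mem_nhdsWithin (Icc_mem_nhdsGE hst)).mono_left
        (nhdsWithin_mono _ Ioi_subset_Ici_self)
    exact h1.eventually_lt_const (by linarith)
  obtain ⟨s', hs', hI⟩ := (hev2.and (Ioo_mem_nhdsGT hst)).exists
  have := image_le_of_deriv_right_lt_deriv_boundary' (f := y) (f' := y') (a := s') (b := t)
    (hc.mono (Icc_subset_Icc_left hI.1.le))
    (fun x hx => (hd x ⟨hI.1.trans_le hx.1, hx.2⟩).hasDerivWithinAt)
    (B := fun _ => (y t + m) / 2) (B' := fun _ => 0) hs'.le continuousOn_const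
    (fun x _ => hasDerivWithinAt_const _ _ _)
    (fun x hx hx' => h x ⟨hI.1.trans_le hx.1, hx.2⟩ (by rw [hx']; linarith))
    (right_mem_Icc.2 hI.2.le)
  linarith

theorem intervalIntegrable_of_continuousOn_Ici {f : ℝ → ℝ} {a b : ℝ} (hf : ContinuousOn f (Ici 0))
    (ha : 0 ≤ a) (hb : 0 ≤ b) : IntervalIntegrable f volume a b :=
  (hf.mono fun x hx => by
    rcases le_total a b with h | h
    · rw [uIcc_of_le h] at hx
      exact ha.trans hx.1
    · rw [uIcc_of_ge h] at hx
      exact hb.trans hx.1).intervalIntegrable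

/-- Gronwall's inequality with rate `1/4`, for functions with a bound on the right upper
derivative. -/
theorem le_exp_mul_add_integral_of_slope_lt {J J' R : ℝ → ℝ} {s t : ℝ} (hs : 0 < s) (hst : s ≤ t)
    (hJ : ContinuousOn J (Icc s t)) (hR : ContinuousOn R (Ici 0))
    (hslope : ∀ x ∈ Ico s t, ∀ r, J' x < r → ∀ᶠ z in 𝓝[>] x, slope J x z < r)
    (hlt : ∀ x ∈ Ico s t, J' x < -(1 / 4) * J x + R x) :
    J t ≤ Real.exp (-(1 / 4) * (t - s)) * J s
      + ∫ x in s..t, Real.exp (-(1 / 4) * (t - x)) * R x := by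
  set I : ℝ → ℝ := fun x => ∫ τ in s..x, Real.exp (1 / 4 * τ) * R τ with hI
  have hcont : ContinuousOn (fun τ => Real.exp (1 / 4 * τ) * R τ) (Ici 0) :=
    (by fun_prop : Continuous fun τ : ℝ => Real.exp (1 / 4 * τ)).continuousOn.mul hR
  have hId : ∀ x, 0 < x → HasDerivAt I (Real.exp (1 / 4 * x) * R x) x := fun x hx =>
    intervalIntegral.integral_hasDerivAt_right
      (intervalIntegrable_of_continuousOn_Ici hcont hs.le hx.le)
      ((hcont.mono Ioi_subset_Ici_self).stronglyMeasurableAtFilter isOpen_Ioi x hx)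
      (hcont.continuousAt (Ici_mem_nhds hx))
  -- Variation of constants: B solves B' = −B/4 + R with B(s) = J(s). At a contact point J = B the
  -- strict hypothesis says that J grows more slowly than B.
  set B : ℝ → ℝ := fun x => Real.exp (-(1 / 4) * x) * (Real.exp (1 / 4 * s) * J s + I x) with hB
  have hBd : ∀ x, 0 < x → HasDerivAt B (-(1 / 4) * B x + R x) x := fun x hx => by
    have h1 : HasDerivAt (fun x : ℝ => Real.exp (-(1 / 4) * x))
        (Real.exp (-(1 / 4) * x) * -(1 / 4)) x := by
      have := ((hasDerivAt_id x).const_mul (-(1 / 4 : ℝ))).exp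
      simpa using this
    have h2 := h1.mul ((hId x hx).const_add (Real.exp (1 / 4 * s) * J s))
    refine h2.congr_deriv ?_
    have e : Real.exp (-(1 / 4) * x) * Real.exp (1 / 4 * x) = 1 := by
      rw [← Real.exp_add]; simp
    simp only [hB]
    linear_combination (R x) * e
  have hmain := image_le_of_liminf_slope_right_lt_deriv_boundary' (f := J) (f' := J') (a := s)
    (b := t) hJ (fun x hx r hr => (hslope x hx r hr).frequently) (B := B)
    (B' := fun x => -(1 / 4) * B x + R x) (by
      simp only [hB, hI, intervalIntegral.integral_same, add_zero]
      rw [← mul_assoc, ← Real.exp_add]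
      simp)
    (fun x hx => (hBd x (hs.trans_le hx.1)).continuousAt.continuousWithinAt)
    (fun x hx => (hBd x (hs.trans_le hx.1)).hasDerivWithinAt)
    (fun x hx hx' => by rw [← hx']; exact hlt x hx) (right_mem_Icc.2 hst)
  refine hmain.trans_eq ?_
  simp only [hB, hI]
  rw [mul_add, ← mul_assoc, ← Real.exp_add, ← intervalIntegral.integral_const_mul]
  congr 1
  · congr 2; ring
  · refine intervalIntegral.integral_congr fun x _ => ?_
    rw [← mul_assoc, ← Real.exp_add]
    congr 2; ring

end Comparison

/-- The scalar differential inequalities satisfied by the flow: `y` is the squared norm of the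
solution modulo elementwise constants, `H` its energy, `p` the squared norm of its velocity. -/
structure EnergySystem (b c C : ℝ) (y y' H H' p κ S P Q : ℝ → ℝ) : Prop where
  y_nonneg : ∀ t, 0 ≤ t → 0 ≤ y t
  H_nonneg : ∀ t, 0 ≤ t → 0 ≤ H t
  p_nonneg : ∀ t, 0 ≤ t → 0 ≤ p t
  S_nonneg : ∀ t, 0 ≤ t → 0 ≤ S t
  P_nonneg : ∀ t, 0 ≤ t → 0 ≤ P t
  Q_nonneg : ∀ t, 0 ≤ t → 0 ≤ Q t
  H_le : ∀ t, 0 < t → H t ≤ κ t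
  continuousOn_y : ContinuousOn y (Ici 0)
  continuousOn_H : ContinuousOn H (Ici 0)
  continuousOn_p : ContinuousOn p (Ioi 0)
  hasDerivAt_y : ∀ t, 0 < t → HasDerivAt y (y' t) t
  hasDerivAt_H : ∀ t, 0 < t → HasDerivAt H (H' t) t
  -- Here κ plays the dissipation, S the size of the data, P and Q their time derivatives. Half of
  -- the dissipation is kept in this inequality in order to pay for the term C κ in the next one.
  y'_le : ∀ t, 0 < t → y' t ≤ -(1 / 2) * κ t - c * y t ^ (b / 2) + C * (1 + S t)
  H'_le : ∀ t, 0 < t → H' t ≤ -(3 / 4) * p t + C * κ t + C * (1 + S t ^ (2 / b) + P t)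
  slope_p_lt : ∀ t, 0 < t → ∀ r, 1 / 2 * p t + C * (Q t + P t) < r →
    ∀ᶠ z in 𝓝[>] t, slope p t z < r

/-! ### Bounds for the scalar energy system -/

namespace EnergySystem

variable {b c C : ℝ} {y y' H H' p κ S P Q : ℝ → ℝ}

theorem le_one_add_rpow {x e : ℝ} (hx : 0 ≤ x) (he : 1 ≤ e) : x ≤ 1 + x ^ e := by
  have h0 := Real.rpow_nonneg hx e
  rcases le_total x 1 with h | h
  · linarith
  · have := Real.rpow_le_rpow_of_exponent_le h he
    rw [Real.rpow_one] at this
    linarith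

/-- With the multiplier 2(C + 1/4), the damping −κ/2 of y becomes −(C + 1/4)κ: the part Cκ cancels
the production in H', and the rest is at most −H/4. -/
theorem lower_le (h : EnergySystem b c C y y' H H' p κ S P Q) (hb1 : 1 < b) (hb2 : b < 2)
    (hc : 0 < c) (hC : 0 < C) {t : ℝ} (ht : 0 < t) :
    H' t + 2 * (C + 1 / 4) * y' t ≤ -(3 / 4) * p t - 1 / 4 * H t
      + (C + 4 * (C + 1 / 4) * C) * (1 + S t ^ (2 / b) + P t) := by
  have h1 := h.y'_le t ht
  have h2 := h.H'_le t ht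
  have h3 := h.H_le t ht
  have h4 := h.P_nonneg t ht.le
  have h5 := h.S_nonneg t ht.le
  have h6 := Real.rpow_nonneg h5 (2 / b)
  have h7 := Real.rpow_nonneg (h.y_nonneg t ht.le) (b / 2)
  have h8 : S t ≤ 1 + S t ^ (2 / b) :=
    le_one_add_rpow h5 (by rw [le_div_iff₀ (by linarith)]; linarith)
  have h9 : y' t ≤ -(1 / 2) * κ t + C * (2 + S t ^ (2 / b)) := by
    have : 0 ≤ c * y t ^ (b / 2) := by positivity
    have : C * (1 + S t) ≤ C * (2 + S t ^ (2 / b)) :=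
      mul_le_mul_of_nonneg_left (by linarith) hC.le
    linarith
  have h10 := mul_le_mul_of_nonneg_left h9 (by positivity : 0 ≤ 2 * (C + 1 / 4))
  have h11 : 0 ≤ (C + 1 / 4) * C * S t ^ (2 / b) := by positivity
  have h12 : 0 ≤ (C + 1 / 4) * C * P t := by positivity
  linarith

theorem slope_total_lt (h : EnergySystem b c C y y' H H' p κ S P Q) {A t : ℝ} (ht : 0 < t) {r : ℝ}
    (hr : 1 / 2 * p t + C * (Q t + P t) + (H' t + A * y' t) < r) :
    ∀ᶠ z in 𝓝[>] t, slope (fun x => p x + (H x + A * y x)) t z < r := by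
  set δ := (r - (1 / 2 * p t + C * (Q t + P t) + (H' t + A * y' t))) / 2 with hδ
  have hδ0 : 0 < δ := by rw [hδ]; linarith
  have hd : HasDerivAt (fun x => H x + A * y x) (H' t + A * y' t) t :=
    (h.hasDerivAt_H t ht).add ((h.hasDerivAt_y t ht).const_mul A)
  have h1 : ∀ᶠ z in 𝓝[>] t, slope (fun x => H x + A * y x) t z < H' t + A * y' t + δ :=
    ((hasDerivAt_iff_tendsto_slope.1 hd).mono_left
      (nhdsWithin_mono _ fun x hx => ne_of_gt hx)).eventually_lt_const (by linarith)
  filter_upwards [h1, h.slope_p_lt t ht (1 / 2 * p t + C * (Q t + P t) + δ) (by linarith)]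
    with z hz1 hz2
  have e : slope (fun x => p x + (H x + A * y x)) t z
      = slope p t z + slope (fun x => H x + A * y x) t z := by
    simp only [slope_def_field]
    ring
  rw [e, show r = (1 / 2 * p t + C * (Q t + P t) + δ) + (H' t + A * y' t + δ) by rw [hδ]; ring]
  exact add_lt_add hz2 hz1

theorem continuousOn_lower (h : EnergySystem b c C y y' H H' p κ S P Q) (A : ℝ) :
    ContinuousOn (fun x => H x + A * y x) (Ici 0) :=
  h.continuousOn_H.add (continuousOn_const.mul h.continuousOn_y)

theorem continuousOn_total (h : EnergySystem b c C y y' H H' p κ S P Q) (A : ℝ) :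
    ContinuousOn (fun x => p x + (H x + A * y x)) (Ioi 0) :=
  h.continuousOn_p.add ((h.continuousOn_lower A).mono Ioi_subset_Ici_self)

/-- The damping c y^(b/2) equals D at y = (D/c)^(2/b). This level is the origin of the exponent 2/β
in the theorem. -/
theorem deriv_neg_of_lt {c D b y y' M : ℝ} (hb : 0 < b) (hc : 0 < c) (hD : 0 ≤ D)
    (hM : (D / c) ^ (2 / b) ≤ M) (hy : M < y) (h : y' ≤ -c * y ^ (b / 2) + D) : y' < 0 := by
  have h0 : 0 ≤ D / c := by positivity
  have h1 : D / c < y ^ (b / 2) := by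
    have h2 : ((D / c) ^ (2 / b)) ^ (b / 2) < y ^ (b / 2) :=
      Real.rpow_lt_rpow (Real.rpow_nonneg h0 _) (hM.trans_lt hy) (by positivity)
    rwa [← Real.rpow_mul h0, show 2 / b * (b / 2) = 1 by field_simp, Real.rpow_one] at h2
  rw [div_lt_iff₀ hc] at h1
  linarith

/-- On [0, t] the data are bounded by the single number G t; this is where monotonicity of the
envelope enters. Above the corresponding absorbing level y decreases, and starting from y 0 it
cannot cross the stated value. -/
theorem y_le (h : EnergySystem b c C y y' H H' p κ S P Q) (hb1 : 1 < b)
    (hc : 0 < c) (hC : 0 < C) {G : ℝ → ℝ} (hG : MonotoneOn G (Ici 0))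
    (hSG : ∀ t, 0 ≤ t → S t ≤ G t) {t : ℝ} (ht : 0 ≤ t) :
    y t ≤ y 0 + (C * (1 + G t) / c) ^ (2 / b) := by
  have hG0 : 0 ≤ G t := (h.S_nonneg t ht).trans (hSG t ht)
  have hD : 0 ≤ C * (1 + G t) := by positivity
  have hM0 : 0 ≤ (C * (1 + G t) / c) ^ (2 / b) := by positivity
  refine le_of_deriv_neg_above ht (h.continuousOn_y.mono Icc_subset_Ici_self)
    (fun x hx => h.hasDerivAt_y x hx.1) (by linarith) fun x hx hlt => ?_
  refine deriv_neg_of_lt (b := b) (by linarith) hc hD (by linarith [h.y_nonneg 0 le_rfl]) hlt ?_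
  have h1 := h.y'_le x hx.1
  have h2 := h.H_le x hx.1
  have h3 := h.H_nonneg x hx.1.le
  have h4 : S x ≤ G t := (hSG x hx.1.le).trans (hG hx.1.le ht hx.2.le)
  have h5 : C * (1 + S x) ≤ C * (1 + G t) := by gcongr
  linarith

/-- The long-time bound. -/
theorem eventually_le (b c C : ℝ) (hb1 : 1 < b) (hb2 : b < 2) (hc : 0 < c) (hC : 0 < C) :
    ∃ C₁ : ℝ, 0 < C₁ ∧ ∀ {y y' H H' p κ S P Q : ℝ → ℝ},
      EnergySystem b c C y y' H H' p κ S P Q → ∀ {L LP LQ : ℝ}, 0 ≤ L → 0 ≤ LP → 0 ≤ LQ →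
      (∀ᶠ t in atTop, S t ≤ L) → (∀ᶠ t in atTop, P t ≤ LP) → (∀ᶠ t in atTop, Q t ≤ LQ) →
      ∀ᶠ t in atTop, p t ≤ C₁ * (1 + L ^ (2 / b) + LP + LQ) := by
  set A := 2 * (C + 1 / 4) with hA
  have hA0 : 0 < A := by positivity
  set B := (2 * C / c) ^ (2 / b) * 4 with hB
  have hB0 : 0 ≤ B := by positivity
  set E := 2 * C + 4 * (C + 1 / 4) * C + 1 / 4 * A * B + 1 with hE
  have hE0 : 1 ≤ E := by
    have : 0 ≤ 2 * C + 4 * (C + 1 / 4) * C + 1 / 4 * A * B := by positivity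
    linarith
  have he1 : 1 ≤ 2 / b := by rw [le_div_iff₀ (by linarith)]; linarith
  have he2 : 2 / b ≤ 2 := by rw [div_le_iff₀ (by linarith)]; linarith
  refine ⟨5 * E, by positivity, fun {y y' H H' p κ S P Q} h {L LP LQ} hL hLP hLQ hS hP hQ => ?_⟩
  obtain ⟨T, hT⟩ := eventually_atTop.1 (hS.and (hP.and (hQ.and (eventually_ge_atTop 1))))
  have hT1 : 1 ≤ T := (hT T le_rfl).2.2.2
  -- The factor 2 makes the damping above M twice the source, so y' < −C(1 + L) there and M is
  -- reached in finite time.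
  set M := (2 * (C * (1 + L)) / c) ^ (2 / b) with hM
  have hMB : M ≤ B * (1 + L ^ (2 / b)) := by
    have := add_rpow_le_four_mul zero_le_one hL (by linarith : 0 ≤ 2 / b) he2
    rw [Real.one_rpow] at this
    calc M = (2 * C / c) ^ (2 / b) * (1 + L) ^ (2 / b) := by
          rw [hM, ← Real.mul_rpow (by positivity) (by positivity)]
          congr 1
          ring
      _ ≤ (2 * C / c) ^ (2 / b) * (4 * (1 + L ^ (2 / b))) := by gcongr
      _ = _ := by rw [hB]; ring
  have hdec : ∀ x, T ≤ x → y' x ≤ -c * y x ^ (b / 2) + C * (1 + L) := fun x hx => by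
    have hx0 : 0 < x := by linarith
    have h1 := h.y'_le x hx0
    have h2 := h.H_le x hx0
    have h3 := h.H_nonneg x hx0.le
    have h5 : C * (1 + S x) ≤ C * (1 + L) := by gcongr; exact (hT x hx).1
    linarith
  have hT' : ∃ T', T ≤ T' ∧ y T' ≤ M := by
    by_contra! hcon
    set D := C * (1 + L) with hD
    have hD0 : 0 < D := by positivity
    -- Decreasing at rate D for longer than y T / D would make y negative.
    set t := T + y T / D + 1 with ht
    have hyT := h.y_nonneg T (by linarith)
    have hTt : T ≤ t := by
      have : 0 ≤ y T / D := by positivity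
      linarith
    have h1 := intervalIntegral.sub_le_integral_of_hasDeriv_right_of_le (g := y) (g' := y')
      (φ := fun _ => -D) hTt (h.continuousOn_y.mono fun x hx => by
        rw [mem_Ici]; linarith [hx.1])
      (fun x hx => (h.hasDerivAt_y x (by linarith [hx.1])).hasDerivWithinAt)
      (by simp) (fun x hx => by
        have h2 := hdec x hx.1.le
        have h3 : 2 * D / c < y x ^ (b / 2) := by
          have h2 : M ^ (b / 2) < y x ^ (b / 2) :=
            Real.rpow_lt_rpow (by positivity) (hcon x hx.1.le) (by positivity)
          rwa [hM, ← Real.rpow_mul (by positivity),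
            show 2 / b * (b / 2) = 1 by field_simp, Real.rpow_one] at h2
        rw [div_lt_iff₀ hc] at h3
        linarith)
    rw [intervalIntegral.integral_const, smul_eq_mul] at h1
    have h2 := h.y_nonneg t (by linarith)
    have h3 : (t - T) * D = y T + D := by rw [ht]; field_simp; ring
    linarith
  obtain ⟨T', hTT', hyT'⟩ := hT'
  have hyM : ∀ t, T' ≤ t → y t ≤ M := fun t ht =>
    le_of_deriv_neg_above ht (h.continuousOn_y.mono fun x hx => by
      rw [mem_Ici]; linarith [hx.1])
      (fun x hx => h.hasDerivAt_y x (by linarith [hx.1])) hyT' fun x hx hlt => by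
        refine deriv_neg_of_lt (by linarith) hc (D := C * (1 + L)) (by positivity) ?_ hlt
          (hdec x (by linarith [hx.1]))
        rw [hM]
        have : 0 ≤ C * (1 + L) := by positivity
        exact Real.rpow_le_rpow (by positivity)
          (div_le_div_of_nonneg_right (by linarith) hc.le) (by linarith)
  set N := E * (1 + L ^ (2 / b) + LP + LQ) with hN
  have hL' : 0 ≤ L ^ (2 / b) := by positivity
  have hN1 : 0 < N := by positivity
  set J : ℝ → ℝ := fun x => p x + (H x + A * y x) with hJ
  -- Since J' < −J/4 + N, the shifted function J − 4N satisfies Gronwall's inequality with zero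
  -- source.
  have hdecay : ∀ t, T' ≤ t →
      J t - 4 * N ≤ Real.exp (-(1 / 4) * (t - T')) * (J T' - 4 * N) := fun t ht => by
    have := le_exp_mul_add_integral_of_slope_lt (J := fun x => J x - 4 * N)
      (J' := fun x => 1 / 2 * p x + C * (Q x + P x) + (H' x + A * y' x)) (R := fun _ => 0)
      (s := T') (t := t) (by linarith) ht
      (((h.continuousOn_total A).mono fun x hx => by
        rw [mem_Ioi]; linarith [hx.1]).sub continuousOn_const) continuousOn_const
      (fun x hx r hr => by
        filter_upwards [h.slope_total_lt (A := A) (by linarith [hx.1]) hr] with z hz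
        convert hz using 1
        simp only [slope_def_field, hJ]
        ring)
      (fun x hx => by
        have hx0 : 0 < x := by linarith [hx.1]
        have h1 := h.lower_le hb1 hb2 hc hC hx0
        obtain ⟨g1, g2, g3, -⟩ := hT x (by linarith [hx.1])
        have g4 := hyM x hx.1
        have g5 : S x ^ (2 / b) ≤ L ^ (2 / b) :=
          Real.rpow_le_rpow (h.S_nonneg x hx0.le) g1 (by linarith)
        have g6 : (C + 4 * (C + 1 / 4) * C) * (1 + S x ^ (2 / b) + P x)
          ≤ (C + 4 * (C + 1 / 4) * C) * (1 + L ^ (2 / b) + LP) := by gcongr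
        have g7 : C * (Q x + P x) ≤ C * (LQ + LP) := by gcongr
        have g8 : A * y x ≤ A * (B * (1 + L ^ (2 / b))) := by
          gcongr
          exact g4.trans hMB
        have g9 : 0 < (C + 1) * (1 + L ^ (2 / b)) := by positivity
        have g10 : 0 ≤ (1 / 4 * A * B + 1) * LP := by positivity
        have g11 : 0 ≤ (C + 4 * (C + 1 / 4) * C + 1 / 4 * A * B + 1) * LQ := by positivity
        simp only [hJ, hN, hE]
        rw [← hA] at h1
        linarith)
    simpa using this
  have htend : Tendsto (fun t => Real.exp (-(1 / 4) * (t - T')) * (J T' - 4 * N)) atTop (𝓝 0) := by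
    have h1 : Tendsto (fun t : ℝ => Real.exp (-(1 / 4) * (t - T'))) atTop (𝓝 0) := by
      refine Real.tendsto_exp_atBot.comp ?_
      refine Tendsto.const_mul_atTop_of_neg (by norm_num) ?_
      exact tendsto_atTop_add_const_right _ _ tendsto_id
    simpa using h1.mul_const (J T' - 4 * N)
  filter_upwards [htend.eventually_lt_const hN1, eventually_ge_atTop T'] with t ht1 ht2
  have h1 := hdecay t ht2
  have h2 := h.H_nonneg t (by linarith)
  have h3 := h.y_nonneg t (by linarith)
  have h4 : 0 ≤ A * y t := by positivity
  have : J t = p t + (H t + A * y t) := rfl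
  -- 4N is the asymptotic level of J; one more N covers the exponentially small remainder.
  rw [show 5 * E * (1 + L ^ (2 / b) + LP + LQ) = 5 * N by rw [hN]; ring]
  linarith

/-- Existence of a good starting time. -/
theorem exists_total_le (h : EnergySystem b c C y y' H H' p κ S P Q) (hb1 : 1 < b) (hb2 : b < 2)
    (hc : 0 < c) (hC : 0 < C) {R : ℝ → ℝ} (hR : ContinuousOn R (Ici 0)) (hR0 : ∀ t, 0 ≤ t → 0 < R t)
    (hle : ∀ t, 0 < t → (C + 4 * (C + 1 / 4) * C) * (1 + S t ^ (2 / b) + P t) ≤ R t)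
    {t₀ : ℝ} (ht₀ : 0 < t₀) (ht₁ : t₀ < 1) :
    ∃ s ∈ Ioo 0 t₀, p s + (H s + 2 * (C + 1 / 4) * y s)
      ≤ 3 * t₀⁻¹ * (H 0 + 2 * (C + 1 / 4) * y 0 + ∫ x in (0 : ℝ)..t₀, R x) := by
  set A := 2 * (C + 1 / 4) with hA
  have hA0 : 0 < A := by positivity
  set I := H 0 + A * y 0 + ∫ x in (0 : ℝ)..t₀, R x with hI
  have hRi : ∀ {u v}, 0 ≤ u → 0 ≤ v → IntervalIntegrable R volume u v := fun hu hv =>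
    intervalIntegrable_of_continuousOn_Ici hR hu hv
  have hRpos : 0 < ∫ x in (0 : ℝ)..t₀, R x :=
    intervalIntegral.intervalIntegral_pos_of_pos_on (hRi le_rfl ht₀.le)
      (fun x hx => hR0 x hx.1.le) ht₀
  have hH0 := h.H_nonneg 0 le_rfl
  have hy0 : 0 ≤ A * y 0 := mul_nonneg hA0.le (h.y_nonneg 0 le_rfl)
  have hI0 : 0 < I := by rw [hI]; linarith
  have hd : ∀ x, 0 < x → HasDerivAt (fun x => H x + A * y x) (H' x + A * y' x) x := fun x hx =>
    (h.hasDerivAt_H x hx).add ((h.hasDerivAt_y x hx).const_mul A)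
  have hbd : ∀ x, 0 < x → H' x + A * y' x ≤ -(3 / 4) * p x + R x := fun x hx => by
    have h1 := h.lower_le hb1 hb2 hc hC hx
    have h2 := h.H_nonneg x hx.le
    have h3 := hle x hx
    rw [← hA] at h1
    linarith
  -- A mean-value argument: if p exceeded 2I/t₀ throughout, the term −¾p would remove at least 3I/2
  -- from H + A y, whose initial value and total source add up to only I.
  have hex : ∃ s ∈ Ioo 0 t₀, p s ≤ 2 * t₀⁻¹ * I := by
    by_contra! hcon
    have h1 := intervalIntegral.sub_le_integral_of_hasDeriv_right_of_le ht₀.le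
      (g := fun x => H x + A * y x) (g' := fun x => H' x + A * y' x)
      (φ := fun x => R x - 3 / 2 * t₀⁻¹ * I)
      ((h.continuousOn_lower A).mono Icc_subset_Ici_self)
      (fun x hx => (hd x hx.1).hasDerivWithinAt)
      (((hR.mono Icc_subset_Ici_self).sub continuousOn_const).integrableOn_compact isCompact_Icc)
      (fun x hx => by
        have h2 := hbd x hx.1
        have h3 := hcon x hx
        linarith)
    rw [intervalIntegral.integral_sub (hRi le_rfl ht₀.le) (by simp),
      intervalIntegral.integral_const, smul_eq_mul] at h1
    have e : (t₀ - 0) * (3 / 2 * t₀⁻¹ * I) = 3 / 2 * I := by field_simp; ring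
    rw [e] at h1
    have h4 := h.H_nonneg t₀ ht₀.le
    have h5 : 0 ≤ A * y t₀ := mul_nonneg hA0.le (h.y_nonneg t₀ ht₀.le)
    linarith
  obtain ⟨s, hs, hps⟩ := hex
  refine ⟨s, hs, ?_⟩
  have h1 := intervalIntegral.sub_le_integral_of_hasDeriv_right_of_le hs.1.le
    (g := fun x => H x + A * y x) (g' := fun x => H' x + A * y' x) (φ := R)
    ((h.continuousOn_lower A).mono Icc_subset_Ici_self)
    (fun x hx => (hd x hx.1).hasDerivWithinAt)
    ((hR.mono Icc_subset_Ici_self).integrableOn_compact isCompact_Icc)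
    (fun x hx => by
      have h2 := hbd x hx.1
      have h3 := h.p_nonneg x hx.1.le
      linarith)
  have h2 : ∫ x in (0 : ℝ)..s, R x ≤ ∫ x in (0 : ℝ)..t₀, R x :=
    intervalIntegral.integral_mono_interval le_rfl hs.1.le hs.2.le
      ((ae_restrict_iff' measurableSet_Ioc).2 (ae_of_all _ fun x hx => (hR0 x hx.1.le).le))
      (hRi le_rfl ht₀.le)
  -- As t₀ < 1, the bound I for H + A y is absorbed in I/t₀; with 2I/t₀ for p this makes the factor
  -- 3.
  have h3 : I ≤ t₀⁻¹ * I := by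
    have : 1 ≤ t₀⁻¹ := (one_le_inv₀ ht₀).2 ht₁.le
    nlinarith
  have h4 : H s + A * y s ≤ I := by rw [hI]; linarith
  linarith

set_option maxHeartbeats 800000 in
/-- The bound for all positive times. -/
theorem le_bound (b c C : ℝ) (hb1 : 1 < b) (hb2 : b < 2) (hc : 0 < c) (hC : 0 < C) :
    ∃ C₁ : ℝ, 0 < C₁ ∧ ∀ {y y' H H' p κ S P Q G : ℝ → ℝ},
      EnergySystem b c C y y' H H' p κ S P Q → ContinuousOn P (Ici 0) → ContinuousOn Q (Ici 0) →
      ContinuousOn G (Ici 0) → MonotoneOn G (Ici 0) → (∀ t, 0 ≤ t → S t ≤ G t) →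
      ∀ t₀ : ℝ, 0 < t₀ → t₀ < 1 → ∀ t, t₀ ≤ t →
      p t ≤ C₁ * (t₀⁻¹ * Real.exp (-(1 / 4) * (t - t₀)) *
          (1 + y 0 + H 0 + ∫ s in (0 : ℝ)..t₀, (P s + G s ^ (2 / b)))
        + ∫ s in (0 : ℝ)..t, Real.exp (-(1 / 4) * (t - s)) *
          (1 + y 0 + P s + Q s + G s ^ (2 / b))) := by
  set A := 2 * (C + 1 / 4) with hA
  have hA0 : 0 < A := by positivity
  set B := (C / c) ^ (2 / b) * 4 with hB
  have hB0 : 0 ≤ B := by positivity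
  set F := C + 4 * (C + 1 / 4) * C with hF
  have hF0 : 0 < F := by positivity
  set E := F + C + 1 / 4 * A * B + 1 / 4 * A + 1 with hE
  have hE0 : 0 < E := by positivity
  have he1 : 1 ≤ 2 / b := by rw [le_div_iff₀ (by linarith)]; linarith
  have he2 : 2 / b ≤ 2 := by rw [div_le_iff₀ (by linarith)]; linarith
  refine ⟨3 * (1 + A + F) + E, by positivity,
    fun {y y' H H' p κ S P Q G} h hPc hQc hGc hGm hSG t₀ ht₀ ht₁ t ht => ?_⟩
  have hG0 : ∀ t, 0 ≤ t → 0 ≤ G t := fun t ht => (h.S_nonneg t ht).trans (hSG t ht)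
  have hGe : ContinuousOn (fun s => G s ^ (2 / b)) (Ici 0) :=
    hGc.rpow_const fun x _ => Or.inr (by linarith)
  have hGe0 : ∀ t, 0 ≤ t → 0 ≤ G t ^ (2 / b) := fun t ht => Real.rpow_nonneg (hG0 t ht) _
  have hSG' : ∀ t, 0 ≤ t → S t ^ (2 / b) ≤ G t ^ (2 / b) := fun t ht =>
    Real.rpow_le_rpow (h.S_nonneg t ht) (hSG t ht) (by linarith)
  -- Nothing bounds p near time 0, so Gronwall's inequality starts at this s instead of at 0.
  obtain ⟨s, hs, hJs⟩ := h.exists_total_le hb1 hb2 hc hC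
    (R := fun x => F * (1 + G x ^ (2 / b) + P x))
    (continuousOn_const.mul ((continuousOn_const.add hGe).add hPc))
    (fun t ht => by have := hGe0 t ht; have := h.P_nonneg t ht; positivity)
    (fun t ht => by have := hSG' t ht.le; gcongr) ht₀ ht₁
  have hy0 := h.y_nonneg 0 le_rfl
  have hH0 := h.H_nonneg 0 le_rfl
  have hyB : ∀ x, 0 ≤ x → y x ≤ y 0 + B * (1 + G x ^ (2 / b)) := fun x hx => by
    refine (h.y_le hb1 hc hC hGm hSG hx).trans ?_
    gcongr
    have := add_rpow_le_four_mul zero_le_one (hG0 x hx) (by linarith : 0 ≤ 2 / b) he2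
    rw [Real.one_rpow] at this
    have hGx := hG0 x hx
    calc _ = (C / c) ^ (2 / b) * (1 + G x) ^ (2 / b) := by
          rw [← Real.mul_rpow (by positivity) (by positivity)]
          congr 1
          ring
      _ ≤ (C / c) ^ (2 / b) * (4 * (1 + G x ^ (2 / b))) := by gcongr
      _ = _ := by rw [hB]; ring
  -- J contains A y, but `lower_le` provides decay only of p and H. The missing A y/4 is added to
  -- the source by means of `hyB`, which is how y 0 gets under the weighted integral.
  set W : ℝ → ℝ := fun x => 1 + y 0 + P x + Q x + G x ^ (2 / b) with hW
  have hWc : ContinuousOn W (Ici 0) := ((continuousOn_const.add hPc).add hQc).add hGe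
  have hW0 : ∀ x, 0 ≤ x → 0 ≤ W x := fun x hx => by
    have := hGe0 x hx; have := h.P_nonneg x hx; have := h.Q_nonneg x hx
    simp only [hW]
    positivity
  have hst : s ≤ t := hs.2.le.trans ht
  have hmain := le_exp_mul_add_integral_of_slope_lt (J := fun x => p x + (H x + A * y x))
    (J' := fun x => 1 / 2 * p x + C * (Q x + P x) + (H' x + A * y' x)) (R := fun x => E * W x)
    hs.1 hst ((h.continuousOn_total A).mono fun x hx => hs.1.trans_le hx.1)
    (continuousOn_const.mul hWc) (fun x hx r hr => h.slope_total_lt (hs.1.trans_le hx.1) hr)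
    (fun x hx => by
      have hx0 : 0 < x := hs.1.trans_le hx.1
      have h1 := h.lower_le hb1 hb2 hc hC hx0
      have h2 := hSG' x hx0.le
      have h3 := hyB x hx0.le
      have h4 := h.P_nonneg x hx0.le
      have h5 := h.Q_nonneg x hx0.le
      have h6 := hGe0 x hx0.le
      have g6 : F * (1 + S x ^ (2 / b) + P x) ≤ F * (1 + G x ^ (2 / b) + P x) := by gcongr
      have g8 : A * y x ≤ A * (y 0 + B * (1 + G x ^ (2 / b))) := by gcongr
      have g9 : 0 ≤ (C + 1 / 4 * A) * (1 + G x ^ (2 / b)) := by positivity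
      have g10 : 0 ≤ (1 / 4 * A * B + 1 / 4 * A) * P x := by positivity
      have g11 : 0 ≤ (F + 1 / 4 * A * B + 1 / 4 * A) * Q x := by positivity
      have g12 : 0 ≤ (F + C + 1 / 4 * A * B) * y 0 := by positivity
      simp only [hW, hE]
      rw [← hA, ← hF] at h1
      linarith)
  have hHt := h.H_nonneg t (ht₀.le.trans ht)
  have hyt := h.y_nonneg t (ht₀.le.trans ht)
  have hp : p t ≤ p t + (H t + A * y t) := by
    have : 0 ≤ A * y t := by positivity
    linarith
  refine (hp.trans hmain).trans ?_
  have hPi : IntervalIntegrable (fun s => P s + G s ^ (2 / b)) volume 0 t₀ :=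
    intervalIntegrable_of_continuousOn_Ici (hPc.add hGe) le_rfl ht₀.le
  have hPi0 : 0 ≤ ∫ s in (0 : ℝ)..t₀, (P s + G s ^ (2 / b)) :=
    intervalIntegral.integral_nonneg ht₀.le fun x hx =>
      add_nonneg (h.P_nonneg x hx.1) (hGe0 x hx.1)
  have hint : ∫ x in (0 : ℝ)..t₀, F * (1 + G x ^ (2 / b) + P x)
      ≤ F * (1 + ∫ s in (0 : ℝ)..t₀, (P s + G s ^ (2 / b))) := by
    rw [intervalIntegral.integral_const_mul]
    have e : ∀ x, 1 + G x ^ (2 / b) + P x = 1 + (P x + G x ^ (2 / b)) := fun x => by ring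
    simp only [e]
    rw [intervalIntegral.integral_add (by simp) hPi, intervalIntegral.integral_const, smul_eq_mul]
    gcongr
    linarith
  set I := ∫ s in (0 : ℝ)..t₀, (P s + G s ^ (2 / b)) with hI
  have hJs' : p s + (H s + A * y s) ≤ 3 * (1 + A + F) * (t₀⁻¹ * (1 + y 0 + H 0 + I)) := by
    refine hJs.trans ?_
    have : H 0 + A * y 0 + ∫ x in (0 : ℝ)..t₀, F * (1 + G x ^ (2 / b) + P x)
        ≤ (1 + A + F) * (1 + y 0 + H 0 + I) := by
      refine (add_le_add_right hint _).trans ?_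
      have g1 : 0 ≤ (1 + A) * (1 + I) := by positivity
      have g2 : 0 ≤ (1 + F) * y 0 := by positivity
      have g3 : 0 ≤ (A + F) * H 0 := by positivity
      linarith
    calc _ ≤ 3 * t₀⁻¹ * ((1 + A + F) * (1 + y 0 + H 0 + I)) := by gcongr
      _ = _ := by ring
  -- Starting at s < t₀ only helps: the decay has acted for longer than t − t₀.
  have hexp : Real.exp (-(1 / 4) * (t - s)) ≤ Real.exp (-(1 / 4) * (t - t₀)) :=
    Real.exp_le_exp.2 (by linarith [hs.2])
  have hwc : ContinuousOn (fun x => Real.exp (-(1 / 4) * (t - x)) * W x) (Ici 0) :=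
    (by fun_prop : Continuous fun x : ℝ => Real.exp (-(1 / 4) * (t - x))).continuousOn.mul hWc
  have hV0 : 0 ≤ ∫ x in (0 : ℝ)..t, Real.exp (-(1 / 4) * (t - x)) * W x :=
    intervalIntegral.integral_nonneg (ht₀.le.trans ht) fun x hx =>
      mul_nonneg (Real.exp_pos _).le (hW0 x hx.1)
  have h2 : ∫ x in s..t, Real.exp (-(1 / 4) * (t - x)) * (E * W x)
      ≤ E * ∫ x in (0 : ℝ)..t, Real.exp (-(1 / 4) * (t - x)) * W x := by
    have e : ∀ x, Real.exp (-(1 / 4) * (t - x)) * (E * W x)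
        = E * (Real.exp (-(1 / 4) * (t - x)) * W x) := fun x => by ring
    simp only [e]
    rw [intervalIntegral.integral_const_mul]
    refine mul_le_mul_of_nonneg_left ?_ hE0.le
    exact intervalIntegral.integral_mono_interval hs.1.le hst le_rfl
      ((ae_restrict_iff' measurableSet_Ioc).2 (ae_of_all _ fun x hx =>
        mul_nonneg (Real.exp_pos _).le (hW0 x hx.1.le)))
      (intervalIntegrable_of_continuousOn_Ici hwc le_rfl (ht₀.le.trans ht))
  have hJs0 : 0 ≤ 3 * (1 + A + F) * (t₀⁻¹ * (1 + y 0 + H 0 + I)) := by positivity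
  have h3 : Real.exp (-(1 / 4) * (t - s)) * (p s + (H s + A * y s))
      ≤ Real.exp (-(1 / 4) * (t - t₀)) * (3 * (1 + A + F) * (t₀⁻¹ * (1 + y 0 + H 0 + I))) :=
    (mul_le_mul_of_nonneg_left hJs' (Real.exp_pos _).le).trans
      (mul_le_mul_of_nonneg_right hexp hJs0)
  refine (add_le_add h3 h2).trans ?_
  set V := ∫ x in (0 : ℝ)..t, Real.exp (-(1 / 4) * (t - x)) * W x with hV
  have h4 : 0 ≤ 3 * (1 + A + F) * V := by positivity
  have h5 : 0 ≤ E * (t₀⁻¹ * Real.exp (-(1 / 4) * (t - t₀)) * (1 + y 0 + H 0 + I)) := by positivity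
  linarith

end EnergySystem

/-! ### Abstract gradient flows and their energy inequalities -/

section GradientFlow

set_option linter.unusedSectionVars false

variable (g : Law) {X E W : Type*} [MeasurableSpace X] {μ : Measure X} [NormedAddCommGroup E]
  [InnerProductSpace ℝ E] [CompleteSpace E] [NormedAddCommGroup W] [InnerProductSpace ℝ W]
  [CompleteSpace W] (grad : W →L[ℝ] Lp E 2 μ)

/-- The nonlinear operator `∇* K(|∇ ⬝|) ∇`. -/
def diffusion (w : W) : W := ContinuousLinearMap.adjoint grad (g.fluxLp (grad w))

theorem inner_diffusion (w v : W) : ⟪diffusion g grad w, v⟫ = ⟪g.fluxLp (grad w), grad v⟫ :=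
  ContinuousLinearMap.adjoint_inner_left _ _ _

/-- The constant involves the operator norm of the gradient and so depends on the mesh. It serves
only qualitatively, for continuity, differentiability of the energy and a vanishing remainder, and
enters none of the final bounds. -/
theorem exists_norm_diffusion_sub_le : ∃ L : ℝ, 0 ≤ L ∧
    ∀ w v : W, ‖diffusion g grad w - diffusion g grad v‖ ≤ L * ‖w - v‖ := by
  have ha := g.coeff_zero_pos
  refine ⟨‖ContinuousLinearMap.adjoint grad‖ * (2 / g.coeff 0 * ‖grad‖), by positivity,
    fun w v => ?_⟩
  unfold diffusion
  rw [← map_sub]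
  refine (ContinuousLinearMap.le_opNorm _ _).trans ?_
  rw [mul_assoc]
  refine mul_le_mul_of_nonneg_left ?_ (norm_nonneg _)
  refine (g.norm_fluxLp_sub_le _ _).trans ?_
  rw [← map_sub, mul_assoc]
  exact mul_le_mul_of_nonneg_left (grad.le_opNorm _) (by positivity)

theorem continuous_diffusion : Continuous (diffusion g grad) := by
  obtain ⟨L, hL, h⟩ := exists_norm_diffusion_sub_le g grad
  exact (LipschitzWith.of_dist_le_mul (K := L.toNNReal) fun w v => by
    rw [dist_eq_norm, dist_eq_norm, Real.coe_toNNReal _ hL]; exact h w v).continuous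

/-- Convexity used from both ends squeezes the first-order remainder between 0 and ⟨Av − Aw, v − w⟩
≤ L‖v − w‖², where A is `diffusion`; no differentiation under the integral is needed. -/
theorem hasFDerivAt_energy (w : W) :
    HasFDerivAt (fun w => g.energy (grad w)) (innerSL ℝ (diffusion g grad w)) w := by
  obtain ⟨L, hL, h⟩ := exists_norm_diffusion_sub_le g grad
  refine HasFDerivAt.of_isLittleO (Asymptotics.IsBigO.trans_isLittleO ?_
    (Asymptotics.isLittleO_pow_sub_sub w one_lt_two))
  refine Asymptotics.IsBigO.of_bound L (Eventually.of_forall fun v => ?_)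
  have h1 := g.inner_fluxLp_le_energy_sub (grad w) (grad v)
  have h2 := g.inner_fluxLp_le_energy_sub (grad v) (grad w)
  rw [← map_sub, ← inner_diffusion] at h1 h2
  have h3 : ⟪diffusion g grad v - diffusion g grad w, v - w⟫ ≤ L * ‖v - w‖ * ‖v - w‖ :=
    (real_inner_le_norm _ _).trans (mul_le_mul_of_nonneg_right (h v w) (norm_nonneg _))
  rw [inner_sub_left] at h3
  rw [← neg_sub v w, inner_neg_right] at h2
  rw [innerSL_apply_apply, Real.norm_of_nonneg (by linarith), norm_pow, norm_norm, sq, ← mul_assoc]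
  linarith

/-- For F ≥ 1 it suffices that λ · 2/β = 2/(1 − a) is at least 2. -/
theorem sq_le_one_add_rpow {F S : ℝ} (hF : 0 ≤ F) (h : F ^ g.lam ≤ S) :
    F ^ 2 ≤ 1 + S ^ (2 / g.β) := by
  have hS : 0 ≤ S := (Real.rpow_nonneg hF _).trans h
  have hSe := Real.rpow_nonneg hS (2 / g.β)
  rcases le_total F 1 with hF1 | hF1
  · nlinarith
  · have hβ := g.β_pos
    have ha1 := g.a_lt_one
    have ha0 := g.a_pos
    have h1 : (F ^ g.lam) ^ (2 / g.β) ≤ S ^ (2 / g.β) :=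
      Real.rpow_le_rpow (Real.rpow_nonneg hF _) h (by positivity)
    have e : g.lam * (2 / g.β) = 2 / (1 - g.a) := by
      have h1 : 1 - g.a ≠ 0 := by linarith
      have h2 : 2 - g.a ≠ 0 := by linarith
      unfold Law.lam Law.β
      field_simp
    have h2 : F ^ (2 : ℝ) ≤ F ^ (2 / (1 - g.a)) :=
      Real.rpow_le_rpow_of_exponent_le hF1 (by rw [le_div_iff₀ (by linarith)]; linarith)
    rw [← Real.rpow_mul hF, e] at h1
    rw [Real.rpow_two] at h2
    linarith

theorem holderConjugate_β_lam : g.β.HolderConjugate g.lam := by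
  rw [Real.holderConjugate_iff]
  refine ⟨g.one_lt_β, ?_⟩
  have h1 : 1 - g.a ≠ 0 := by linarith [g.a_lt_one]
  have h2 : 2 - g.a ≠ 0 := by linarith [g.a_lt_one]
  unfold Law.lam Law.β
  field_simp
  ring

/-- Young's inequality with the conjugate exponents β and λ, after scaling V by δ with δ^β = K/2.
This is the reason why the source enters 𝔤 with the power λ. -/
theorem two_mul_mul_le {F V K : ℝ} (hF : 0 ≤ F) (hV : 0 ≤ V) (hK : 0 < K) :
    2 * (F * V) ≤ K * V ^ g.β + 2 * ((K / 2) ^ (1 / g.β))⁻¹ ^ g.lam * F ^ g.lam := by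
  have hβ := g.β_pos
  set δ := (K / 2) ^ (1 / g.β) with hδ
  have hδ0 : 0 < δ := by positivity
  have hq := (holderConjugate_β_lam g).symm.lt
  have hy := Real.young_inequality_of_nonneg (mul_nonneg hδ0.le hV)
    (mul_nonneg (inv_pos.2 hδ0).le hF) (holderConjugate_β_lam g)
  have e : δ * V * (δ⁻¹ * F) = F * V := by field_simp
  have e2 : δ ^ g.β = K / 2 := by
    rw [hδ, ← Real.rpow_mul (by positivity), one_div_mul_cancel hβ.ne', Real.rpow_one]
  rw [e, Real.mul_rpow hδ0.le hV, Real.mul_rpow (inv_pos.2 hδ0).le hF, e2] at hy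
  have h1 : K / 2 * V ^ g.β / g.β ≤ K / 2 * V ^ g.β :=
    div_le_self (by positivity) g.one_lt_β.le
  have h2 : δ⁻¹ ^ g.lam * F ^ g.lam / g.lam ≤ δ⁻¹ ^ g.lam * F ^ g.lam :=
    div_le_self (by positivity) hq.le
  linarith

/-- The component of `w` orthogonal to the kernel of the gradient. -/
def oscillation (w : W) : W := w - (LinearMap.ker (grad : W →ₗ[ℝ] Lp E 2 μ)).starProjection w

/-- A solution of an abstract gradient flow, with bounds on its data. -/
structure IsFlow (Cg : ℝ) (ρ ψ ψt f ft : ℝ → W) (F Φ P Q : ℝ → ℝ) : Prop where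
  continuousOn_ρ : ContinuousOn ρ (Ici 0)
  continuousOn_ψ : ContinuousOn ψ (Ici 0)
  continuousOn_f : ContinuousOn f (Ici 0)
  hasDerivAt_ρ : ∀ t, 0 < t → HasDerivAt ρ (f t - diffusion g grad (ρ t + ψ t)) t
  hasDerivAt_ψ : ∀ t, 0 < t → HasDerivAt ψ (ψt t) t
  hasDerivAt_f : ∀ t, 0 < t → HasDerivAt f (ft t) t
  norm_f_le : ∀ t, ‖f t‖ ≤ F t
  norm_ft_sq_le : ∀ t, ‖ft t‖ ^ 2 ≤ Q t
  norm_grad_ψ_sq_le : ∀ t, ‖grad (ψ t)‖ ^ 2 ≤ Cg * Φ t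
  norm_grad_ψt_sq_le : ∀ t, ‖grad (ψt t)‖ ^ 2 ≤ Cg * P t

variable {grad} {g}

namespace IsFlow

variable {Cg : ℝ} {ρ ψ ψt f ft : ℝ → W} {F Φ P Q : ℝ → ℝ}

theorem continuousOn_velocity (h : IsFlow g grad Cg ρ ψ ψt f ft F Φ P Q) :
    ContinuousOn (fun t => f t - diffusion g grad (ρ t + ψ t)) (Ici 0) :=
  h.continuousOn_f.sub ((continuous_diffusion g grad).comp_continuousOn
    (h.continuousOn_ρ.add h.continuousOn_ψ))

/-- Formally, with velocity u = ρ', half the derivative of ‖u‖² is ⟨f', u⟩ − ⟨(A(ρ + ψ))', ρ'⟩, and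
perturbed monotonicity with η = ∇ψ' bounds the last term by a multiple of ‖∇ψ'‖². Since A is only
known to be Lipschitz, the computation is made on difference quotients and yields an upper right
derivative. -/
theorem slope_velocity_lt (h : IsFlow g grad Cg ρ ψ ψt f ft F Φ P Q) {t : ℝ} (ht : 0 < t) {r : ℝ}
    (hr : 1 / 2 * ‖f t - diffusion g grad (ρ t + ψ t)‖ ^ 2 + 2 * Q t
      + 2 * (2 * (1 + g.deg) ^ 2 / g.coeff 0) * (Cg * P t) < r) :
    ∀ᶠ z in 𝓝[>] t, slope (fun s => ‖f s - diffusion g grad (ρ s + ψ s)‖ ^ 2) t z < r := by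
  obtain ⟨L, hL, hLip⟩ := exists_norm_diffusion_sub_le g grad
  set u : ℝ → W := fun s => f s - diffusion g grad (ρ s + ψ s) with hu
  set M := 2 * (1 + g.deg) ^ 2 / g.coeff 0 with hM
  have hM0 : 0 ≤ M := div_nonneg (by positivity) g.coeff_zero_pos.le
  have hmono : 𝓝[>] t ≤ 𝓝[≠] t := nhdsWithin_mono _ fun x hx => ne_of_gt hx
  have tρ := (hasDerivAt_iff_tendsto_slope.1 (h.hasDerivAt_ρ t ht)).mono_left hmono
  have tψ := (hasDerivAt_iff_tendsto_slope.1 (h.hasDerivAt_ψ t ht)).mono_left hmono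
  have tf := (hasDerivAt_iff_tendsto_slope.1 (h.hasDerivAt_f t ht)).mono_left hmono
  have tu : Tendsto u (𝓝[>] t) (𝓝 (u t)) :=
    (h.continuousOn_velocity.continuousAt (Ici_mem_nhds ht)).tendsto.mono_left nhdsWithin_le_nhds
  -- An upper bound for the slope. Monotonicity requires pairing the increment of A with the slope
  -- of ρ, while ‖u‖² produces u z + u t; the last term is the cost of replacing u z + u t by twice
  -- that slope.
  set m : ℝ → ℝ := fun z => ⟪slope f t z, u z + u t⟫ + 2 * M * ‖grad (slope ψ t z)‖ ^ 2
    + L * ‖slope ρ t z + slope ψ t z‖ * ‖u z + u t - (2 : ℝ) • slope ρ t z‖ with hm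
  have tm : Tendsto m (𝓝[>] t) (𝓝 (⟪ft t, u t + u t⟫ + 2 * M * ‖grad (ψt t)‖ ^ 2
      + L * ‖u t + ψt t‖ * ‖u t + u t - (2 : ℝ) • u t‖)) := by
    refine ((tf.inner (tu.add_const _)).add (((grad.continuous.tendsto _).comp tψ).norm.pow 2
      |>.const_mul _)).add ?_
    exact ((tρ.add tψ).norm.const_mul L).mul ((tu.add_const _).sub (tρ.const_smul (2 : ℝ))).norm
  -- The slope of ρ tends to u t, so the replacement cost vanishes in the limit and L disappears.
  -- What is left is Young's inequality 2⟨f', u⟩ ≤ ½‖u‖² + 2‖f'‖².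
  have hlim : ⟪ft t, u t + u t⟫ + 2 * M * ‖grad (ψt t)‖ ^ 2
      + L * ‖u t + ψt t‖ * ‖u t + u t - (2 : ℝ) • u t‖ < r := by
    rw [two_smul, sub_self, norm_zero, mul_zero, add_zero, inner_add_right]
    refine lt_of_le_of_lt ?_ hr
    have h1 := real_inner_le_norm (ft t) (u t)
    have h2 := h.norm_ft_sq_le t
    have h3 := mul_le_mul_of_nonneg_left (h.norm_grad_ψt_sq_le t)
      (by positivity : 0 ≤ 2 * M)
    nlinarith [sq_nonneg (‖u t‖ - 2 * ‖ft t‖)]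
  filter_upwards [tm.eventually_lt_const hlim, self_mem_nhdsWithin] with z hz hzt
  refine lt_of_le_of_lt ?_ hz
  have hk : 0 < z - t := sub_pos.2 hzt
  set k := z - t with hk'
  set e := diffusion g grad (ρ z + ψ z) - diffusion g grad (ρ t + ψ t) with he
  have hdu : u z - u t = (f z - f t) - e := by simp only [hu, he]; abel
  have sf : slope f t z = k⁻¹ • (f z - f t) := slope_def_module f t z
  have sρ : slope ρ t z = k⁻¹ • (ρ z - ρ t) := slope_def_module ρ t z
  have sψ : slope ψ t z = k⁻¹ • (ψ z - ψ t) := slope_def_module ψ t z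
  have hmonoτ : -M * ‖grad (ψ z - ψ t)‖ ^ 2 ≤ ⟪e, ρ z - ρ t⟫ := by
    have := g.inner_fluxLp_sub_sub_ge (grad (ρ t + ψ t)) (grad (ρ z + ψ z)) (grad (ψ z - ψ t))
    rw [← map_sub, ← map_sub, inner_sub_left, ← inner_diffusion, ← inner_diffusion,
      ← inner_sub_left] at this
    rwa [show ρ z + ψ z - (ρ t + ψ t) - (ψ z - ψ t) = ρ z - ρ t by abel] at this
  have hmono2 : -M * ‖grad (slope ψ t z)‖ ^ 2 ≤ ⟪k⁻¹ • e, slope ρ t z⟫ := by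
    rw [sψ, sρ, map_smul, norm_smul, real_inner_smul_left, real_inner_smul_right,
      Real.norm_of_nonneg (inv_pos.2 hk).le]
    have := mul_le_mul_of_nonneg_left hmonoτ (by positivity : 0 ≤ k⁻¹ * k⁻¹)
    linarith
  have hE : ‖k⁻¹ • e‖ ≤ L * ‖slope ρ t z + slope ψ t z‖ := by
    rw [sψ, sρ, ← smul_add, norm_smul, norm_smul, mul_left_comm]
    refine mul_le_mul_of_nonneg_left ?_ (norm_nonneg _)
    refine (hLip _ _).trans_eq ?_
    congr 2
    abel
  have hcs : -⟪k⁻¹ • e, u z + u t - (2 : ℝ) • slope ρ t z⟫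
      ≤ L * ‖slope ρ t z + slope ψ t z‖ * ‖u z + u t - (2 : ℝ) • slope ρ t z‖ := by
    refine (neg_le_abs _).trans ((abs_real_inner_le_norm _ _).trans ?_)
    exact mul_le_mul_of_nonneg_right hE (norm_nonneg _)
  have hs : slope (fun s => ‖u s‖ ^ 2) t z
      = ⟪slope f t z, u z + u t⟫ - ⟪k⁻¹ • e, u z + u t⟫ := by
    rw [slope_def_field, sf, ← inner_sub_left, ← smul_sub, ← hdu, real_inner_smul_left,
      inner_sub_left, inner_add_right, inner_add_right, real_inner_self_eq_norm_sq,
      real_inner_self_eq_norm_sq, real_inner_comm (u z) (u t), div_eq_inv_mul]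
    ring
  rw [inner_sub_right, real_inner_smul_right] at hcs
  rw [hs]
  simp only [hm]
  linarith

theorem hasDerivAt_energy (h : IsFlow g grad Cg ρ ψ ψt f ft F Φ P Q) {t : ℝ} (ht : 0 < t) :
    HasDerivAt (fun t => g.energy (grad (ρ t + ψ t)))
      ⟪diffusion g grad (ρ t + ψ t), f t - diffusion g grad (ρ t + ψ t) + ψt t⟫ t :=
  (hasFDerivAt_energy g grad (ρ t + ψ t)).comp_hasDerivAt (f := fun t => ρ t + ψ t) t
    ((h.hasDerivAt_ρ t ht).add (h.hasDerivAt_ψ t ht))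

/-- The orthogonal projection commutes with the time derivative, and the oscillation is orthogonal
to the kernel, so the kernel component of the velocity drops out. -/
theorem hasDerivAt_oscillation (h : IsFlow g grad Cg ρ ψ ψt f ft F Φ P Q) {t : ℝ} (ht : 0 < t) :
    HasDerivAt (fun t => ‖oscillation grad (ρ t)‖ ^ 2)
      (2 * ⟪f t - diffusion g grad (ρ t + ψ t), oscillation grad (ρ t)⟫) t := by
  set U := LinearMap.ker (grad : W →ₗ[ℝ] Lp E 2 μ) with hU
  have h0 := h.hasDerivAt_ρ t ht
  have h1 := h0.sub ((U.starProjection.hasFDerivAt (x := ρ t)).comp_hasDerivAt t h0)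
  refine h1.norm_sq.congr_deriv ?_
  set u := f t - diffusion g grad (ρ t + ψ t)
  change 2 * ⟪ρ t - U.starProjection (ρ t), u - U.starProjection u⟫
    = 2 * ⟪u, ρ t - U.starProjection (ρ t)⟫
  rw [inner_sub_right, U.starProjection_inner_eq_zero _ _ (U.starProjection_apply_mem u), sub_zero,
    real_inner_comm]

theorem grad_oscillation (w : W) : grad (oscillation grad w) = grad w := by
  have h : grad ((LinearMap.ker (grad : W →ₗ[ℝ] Lp E 2 μ)).starProjection w) = 0 :=
    Submodule.starProjection_apply_mem (LinearMap.ker (grad : W →ₗ[ℝ] Lp E 2 μ)) w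
  rw [oscillation, map_sub, h, sub_zero]

theorem inner_diffusion_oscillation (w v : W) :
    ⟪diffusion g grad w, oscillation grad v⟫ = ⟪g.fluxLp (grad w), grad v⟫ := by
  rw [inner_diffusion, grad_oscillation]

theorem norm_oscillation_le (w v : W) (hv : grad v = 0) : ‖oscillation grad w‖ ≤ ‖w - v‖ := by
  set U := LinearMap.ker (grad : W →ₗ[ℝ] Lp E 2 μ) with hU
  have h := U.starProjection_minimal w
  have hb : BddBelow (range fun x : U => ‖w - x‖) := ⟨0, by rintro _ ⟨x, rfl⟩; exact norm_nonneg _⟩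
  exact h.trans_le (ciInf_le hb ⟨v, hv⟩)

variable (g) in
/-- The scalar inequalities satisfied by a flow. -/
theorem energySystem (μ : Measure X) [IsFiniteMeasure μ] (E : Type*) [NormedAddCommGroup E]
    [InnerProductSpace ℝ E] [CompleteSpace E] (Cp Cg : ℝ) (hCp : 0 < Cp) (hCg : 0 < Cg) :
    ∃ c C : ℝ, 0 < c ∧ 0 < C ∧ ∀ (W : Type) [NormedAddCommGroup W] [InnerProductSpace ℝ W]
      [CompleteSpace W] (grad : W →L[ℝ] Lp E 2 μ),
      (∀ w, ‖oscillation grad w‖ ^ g.β ≤ Cp * ∫ x, ‖grad w x‖ ^ g.β ∂μ) →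
      ∀ {ρ ψ ψt f ft : ℝ → W} {F Φ P Q : ℝ → ℝ}, IsFlow g grad Cg ρ ψ ψt f ft F Φ P Q →
      (∀ t, 0 ≤ F t) → (∀ t, 0 ≤ Φ t) → (∀ t, 0 ≤ P t) → (∀ t, 0 ≤ Q t) →
      EnergySystem g.β c C (fun t => ‖oscillation grad (ρ t)‖ ^ 2)
        (fun t => 2 * ⟪f t - diffusion g grad (ρ t + ψ t), oscillation grad (ρ t)⟫)
        (fun t => g.energy (grad (ρ t + ψ t)))
        (fun t => ⟪diffusion g grad (ρ t + ψ t), f t - diffusion g grad (ρ t + ψ t) + ψt t⟫)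
        (fun t => ‖f t - diffusion g grad (ρ t + ψ t)‖ ^ 2)
        (fun t => ⟪g.fluxLp (grad (ρ t + ψ t)), grad (ρ t + ψ t)⟫)
        (fun t => F t ^ g.lam + Φ t) P Q := by
  obtain ⟨C₄, hC₄, hX⟩ := g.exists_integral_rpow_β_le E μ
  have hβ := g.β_pos
  have ha := g.coeff_zero_pos
  have hd := g.deg_pos
  -- With this choice coercivity and the Poincaré inequality turn κ/2 into 2K V^β up to data: one K
  -- V^β absorbs the source through Young's inequality, the other is the damping constant c.
  set K := 1 / (4 * C₄ * Cp) with hK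
  have hK0 : 0 < K := by positivity
  set Y := 2 * ((K / 2) ^ (1 / g.β))⁻¹ ^ g.lam with hY
  have hY0 : 0 < Y := by positivity
  set M := 2 * (1 + g.deg) ^ 2 / g.coeff 0 with hM
  have hM0 : 0 < M := by positivity
  set A := 1 / g.coeff 0 with hA
  have hA0 : 0 < A := by positivity
  -- The second constant is a sum large enough for all three inequalities. Both are fixed before the
  -- space W and its gradient, which makes them uniform over meshes.
  refine ⟨K, Y + 1 + (2 * A + 1) * Cg + 2 + 2 * M * Cg, hK0, by positivity, ?_⟩
  intro W _ _ _ grad hPoin ρ ψ ψt f ft F Φ P Q h hF hΦ hP hQ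
  have hS : ∀ t, 0 ≤ F t ^ g.lam := fun t => Real.rpow_nonneg (hF t) _
  have hSΦ : ∀ t, 0 ≤ F t ^ g.lam + Φ t := fun t => add_nonneg (hS t) (hΦ t)
  refine ⟨fun t _ => sq_nonneg _, fun t _ => g.energy_nonneg _, fun t _ => sq_nonneg _,
    fun t _ => hSΦ t, fun t _ => hP t, fun t _ => hQ t, fun t _ => g.energy_le _, ?_, ?_,
    (h.continuousOn_velocity.mono Ioi_subset_Ici_self).norm.pow 2,
    fun t ht => h.hasDerivAt_oscillation ht, fun t ht => h.hasDerivAt_energy ht, ?_, ?_, ?_⟩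
  · have hc : Continuous (oscillation grad) := continuous_id.sub
      (LinearMap.ker (grad : W →ₗ[ℝ] Lp E 2 μ)).starProjection.continuous
    exact (hc.comp_continuousOn h.continuousOn_ρ).norm.pow 2
  · have hc : Continuous fun w => g.energy (grad w) :=
      continuous_iff_continuousAt.2 fun w => (hasFDerivAt_energy g grad w).continuousAt
    exact hc.comp_continuousOn (h.continuousOn_ρ.add h.continuousOn_ψ)
  -- Inequality for y. The flux contributes −2κ; the boundary extension takes back κ, and of the
  -- remaining κ one half is kept while the other becomes damping of y.
  · intro t ht
    set Z := grad (ρ t + ψ t) with hZ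
    set κ := ⟪g.fluxLp Z, Z⟫ with hκ
    set V := ‖oscillation grad (ρ t)‖ with hV
    have e1 : grad (ρ t) = Z - grad (ψ t) := by rw [hZ, map_add, add_sub_cancel_right]
    have e2 : ⟪diffusion g grad (ρ t + ψ t), oscillation grad (ρ t)⟫
        = κ - ⟪g.fluxLp Z, grad (ψ t)⟫ := by
      rw [inner_diffusion_oscillation, e1, inner_sub_right]
    have h1 := (le_abs_self _).trans (g.abs_inner_fluxLp_le Z (grad (ψ t)))
    have h2 := hPoin (ρ t)
    have h3 := hX Z (grad (ψ t))
    rw [← e1] at h3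
    have h4 := h.norm_grad_ψ_sq_le t
    have h5 : ⟪f t, oscillation grad (ρ t)⟫ ≤ F t * V :=
      (real_inner_le_norm _ _).trans (mul_le_mul_of_nonneg_right (h.norm_f_le t) (norm_nonneg _))
    have h6 := two_mul_mul_le g (hF t) (norm_nonneg _ : 0 ≤ V) hK0
    have e3 : (V ^ 2) ^ (g.β / 2) = V ^ g.β := by
      rw [← Real.rpow_natCast_mul (norm_nonneg _)]
      congr 1
      push_cast
      ring
    have h7 : 2 * K * V ^ g.β ≤ 1 / 2 * (1 + κ + ‖grad (ψ t)‖ ^ 2) := by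
      have : V ^ g.β ≤ Cp * (C₄ * (1 + κ + ‖grad (ψ t)‖ ^ 2)) :=
        h2.trans (mul_le_mul_of_nonneg_left h3 hCp.le)
      have := mul_le_mul_of_nonneg_left this (by positivity : 0 ≤ 2 * K)
      refine this.trans_eq ?_
      rw [hK]
      field_simp
      ring
    have h8 := mul_le_mul_of_nonneg_left h4 (by positivity : 0 ≤ 2 * A + 1)
    rw [inner_sub_left, e2, e3]
    have g1 : 0 ≤ (1 + (2 * A + 1) * Cg + 2 + 2 * M * Cg) * F t ^ g.lam := by
      have := hS t; positivity
    have g2 : 0 ≤ (Y + 1 + 2 + 2 * M * Cg) * Φ t := by have := hΦ t; positivity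
    have g3 : 0 ≤ Y + (2 * A + 1) * Cg + 2 * M * Cg := by positivity
    have g4 : 0 ≤ ‖grad (ψ t)‖ ^ 2 := sq_nonneg _
    linarith
  -- Inequality for H. Substituting A(ρ + ψ) = f − u into the energy derivative gives −‖u‖², of
  -- which a quarter absorbs ⟨f, u⟩; this leaves the coefficient 3/4.
  · intro t ht
    set Z := grad (ρ t + ψ t) with hZ
    set κ := ⟪g.fluxLp Z, Z⟫ with hκ
    set u := f t - diffusion g grad (ρ t + ψ t) with hu
    have hκ0 : 0 ≤ κ := g.inner_fluxLp_self_nonneg Z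
    have e1 : ⟪diffusion g grad (ρ t + ψ t), u + ψt t⟫
        = ⟪f t, u⟫ - ‖u‖ ^ 2 + ⟪g.fluxLp Z, grad (ψt t)⟫ := by
      have : diffusion g grad (ρ t + ψ t) = f t - u := by rw [hu]; abel
      rw [inner_add_right, inner_diffusion g grad _ (ψt t), this, inner_sub_left,
        real_inner_self_eq_norm_sq]
    have h1 := (le_abs_self _).trans (g.abs_inner_fluxLp_le Z (grad (ψt t)))
    have h2 := h.norm_grad_ψt_sq_le t
    have h3 : ⟪f t, u⟫ ≤ F t * ‖u‖ :=
      (real_inner_le_norm _ _).trans (mul_le_mul_of_nonneg_right (h.norm_f_le t) (norm_nonneg _))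
    have h4 := sq_le_one_add_rpow g (hF t) (by linarith [hΦ t] : F t ^ g.lam ≤ F t ^ g.lam + Φ t)
    have h5 := mul_le_mul_of_nonneg_left h2 hA0.le
    have h6 : 0 ≤ (F t ^ g.lam + Φ t) ^ (2 / g.β) := Real.rpow_nonneg (hSΦ t) _
    set B := (F t ^ g.lam + Φ t) ^ (2 / g.β)
    have h7 : F t * ‖u‖ ≤ F t ^ 2 + 1 / 4 * ‖u‖ ^ 2 := by nlinarith [sq_nonneg (F t - ‖u‖ / 2)]
    have g1 : 0 ≤ (Y + (2 * A + 1) * Cg + 2 + 2 * M * Cg) * (1 + B) := by positivity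
    have g2 : 0 ≤ (Y + 1 + (A + 1) * Cg + 2 + 2 * M * Cg) * P t := by
      have := hP t; positivity
    have g3 : 0 ≤ (Y + 1 / 2 + (2 * A + 1) * Cg + 2 + 2 * M * Cg) * κ := by positivity
    rw [e1]
    linarith
  · intro t ht r hr
    refine h.slope_velocity_lt ht (lt_of_le_of_lt ?_ hr)
    have g1 : 0 ≤ (Y + 1 + (2 * A + 1) * Cg + 2 * M * Cg) * Q t := by
      have := hQ t; positivity
    have g2 : 0 ≤ (Y + 1 + (2 * A + 1) * Cg + 2) * P t := by
      have := hP t; positivity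
    rw [← hM]
    linarith

end IsFlow

end GradientFlow

/-! ### Gradient bounds for polynomials on balls -/

section Polynomials

variable {d : ℕ}

/-- A polynomial as a function on `ℝ^d`. -/
def polyEval (p : MvPolynomial (Fin d) ℝ) (x : Space d) : ℝ := MvPolynomial.eval x.ofLp p

/-- The gradient of a polynomial as a function on `ℝ^d`. -/
def polyGradient (p : MvPolynomial (Fin d) ℝ) (x : Space d) : Space d :=
  WithLp.toLp 2 fun i => MvPolynomial.eval x.ofLp (MvPolynomial.pderiv i p)

theorem continuous_polyEval (p : MvPolynomial (Fin d) ℝ) : Continuous (polyEval p) :=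
  Triangulation.continuous_eval p

theorem continuous_polyGradient (p : MvPolynomial (Fin d) ℝ) : Continuous (polyGradient p) :=
  (PiLp.continuous_toLp 2 _).comp (continuous_pi fun _ => Triangulation.continuous_eval _)

theorem hasGradientAt_polyEval (p : MvPolynomial (Fin d) ℝ) (x : Space d) :
    HasGradientAt (polyEval p) (polyGradient p x) x := by
  induction p using MvPolynomial.induction_on with
  | C a =>
    have h1 : polyEval (d := d) (MvPolynomial.C a) = fun _ => a := by
      funext y; simp [polyEval]
    have h2 : polyGradient (d := d) (MvPolynomial.C a) x = 0 := by
      ext i; simp [polyGradient]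
    rw [h1, h2]
    exact hasGradientAt_const x a
  | add p q hp hq =>
    have h1 : polyEval (p + q) = fun y => polyEval p y + polyEval q y := by
      funext y; simp [polyEval]
    have h2 : polyGradient (p + q) x = polyGradient p x + polyGradient q x := by
      ext i; simp [polyGradient]
    rw [h1, h2, hasGradientAt_iff_hasFDerivAt, map_add]
    exact hp.hasFDerivAt.add hq.hasFDerivAt
  | mul_X p i hp =>
    have h1 : polyEval (p * MvPolynomial.X i) = fun y => polyEval p y * y i := by
      funext y; simp [polyEval]
    have h2 : polyGradient (p * MvPolynomial.X i) x
        = polyEval p x • EuclideanSpace.single i (1 : ℝ) + x i • polyGradient p x := by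
      ext j
      by_cases hij : i = j
      · subst hij
        simp [polyGradient, polyEval]
      · simp [polyGradient, polyEval, Ne.symm hij]
    rw [h1, h2, hasGradientAt_iff_hasFDerivAt, map_add, map_smul, map_smul]
    have h3 : HasFDerivAt (fun y : Space d => y i)
        (InnerProductSpace.toDual ℝ (Space d) (EuclideanSpace.single i (1 : ℝ))) x := by
      have := (InnerProductSpace.toDual ℝ (Space d)
        (EuclideanSpace.single i (1 : ℝ))).hasFDerivAt (x := x)
      refine this.congr_of_eventuallyEq (Eventually.of_forall fun y => ?_)
      simp [EuclideanSpace.inner_single_left]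
    exact hp.hasFDerivAt.mul h3

/-- Substituting affine forms for the variables does not raise the total degree, so rescaling to the
unit ball stays inside one finite-dimensional space. -/
theorem exists_poly_affine {r : ℕ} (p : MvPolynomial.restrictTotalDegree (Fin d) ℝ r)
    (c : Space d) (h : ℝ) : ∃ q : MvPolynomial.restrictTotalDegree (Fin d) ℝ r,
      ∀ y : Space d, polyEval q y = polyEval p (c + h • y) := by
  set φ : Fin d → MvPolynomial (Fin d) ℝ :=
    fun i => MvPolynomial.C (c i) + MvPolynomial.C h * MvPolynomial.X i with hφ
  have hdeg : ∀ i, (φ i).totalDegree ≤ 1 := fun i => by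
    refine (MvPolynomial.totalDegree_add _ _).trans (max_le (by simp) ?_)
    refine (MvPolynomial.totalDegree_mul _ _).trans ?_
    simp
  refine ⟨⟨MvPolynomial.aeval φ (p : MvPolynomial (Fin d) ℝ), ?_⟩, fun y => ?_⟩
  · rw [MvPolynomial.mem_restrictTotalDegree, MvPolynomial.aeval_def, MvPolynomial.eval₂_eq]
    refine MvPolynomial.totalDegree_finsetSum_le fun m hm => ?_
    refine (MvPolynomial.totalDegree_mul _ _).trans ?_
    have h1 : (algebraMap ℝ (MvPolynomial (Fin d) ℝ) (MvPolynomial.coeff m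
      (p : MvPolynomial (Fin d) ℝ))).totalDegree = 0 := MvPolynomial.totalDegree_C _
    rw [h1, zero_add]
    refine (MvPolynomial.totalDegree_finsetProd _ _).trans ?_
    have h2 : ∀ i ∈ m.support, (φ i ^ m i).totalDegree ≤ m i := fun i _ =>
      (MvPolynomial.totalDegree_pow _ _).trans (by simpa using Nat.mul_le_mul_left (m i) (hdeg i))
    refine (Finset.sum_le_sum h2).trans ?_
    exact (MvPolynomial.le_totalDegree hm).trans ((MvPolynomial.mem_restrictTotalDegree _ _ _).1 p.2)
  · simp only [polyEval]
    rw [MvPolynomial.aeval_def, MvPolynomial.eval₂_eq, map_sum, MvPolynomial.eval_eq]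
    refine Finset.sum_congr rfl fun m _ => ?_
    rw [map_mul, map_prod]
    congr 1
    · exact MvPolynomial.eval_C _
    · refine Finset.prod_congr rfl fun i _ => ?_
      simp [hφ]

/-- B factors through the range of A, and a linear map on a finite-dimensional normed space is
bounded. Injectivity of A is not required, so A may be the gradient, which kills constants. -/
theorem exists_norm_le_of_ker_le {V X Y : Type*} [AddCommGroup V] [Module ℝ V]
    [FiniteDimensional ℝ V] [NormedAddCommGroup X] [NormedSpace ℝ X] [NormedAddCommGroup Y]
    [NormedSpace ℝ Y] (A : V →ₗ[ℝ] X) (B : V →ₗ[ℝ] Y)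
    (h : LinearMap.ker A ≤ LinearMap.ker B) : ∃ C : ℝ, 0 < C ∧ ∀ v, ‖B v‖ ≤ C * ‖A v‖ := by
  let L : LinearMap.range A →ₗ[ℝ] Y :=
    (LinearMap.ker A).liftQ B h ∘ₗ (A.quotKerEquivRange.symm : LinearMap.range A →ₗ[ℝ] _)
  have hL : ∀ v, L ⟨A v, LinearMap.mem_range_self A v⟩ = B v := fun v => by
    have : A.quotKerEquivRange.symm ⟨A v, LinearMap.mem_range_self A v⟩
        = (LinearMap.ker A).mkQ v := by
      rw [LinearEquiv.symm_apply_eq]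
      rfl
    simp [L, this]
  refine ⟨‖L.toContinuousLinearMap‖ + 1, by positivity, fun v => ?_⟩
  rw [← hL v]
  refine (L.toContinuousLinearMap.le_opNorm _).trans ?_
  exact mul_le_mul_of_nonneg_right (by linarith) (norm_nonneg _)

theorem integrableOn_of_continuous {E : Type*} [NormedAddCommGroup E] {f : Space d → E}
    (hf : Continuous f) {s : Set (Space d)} (hs : Bornology.IsBounded s) : IntegrableOn f s :=
  (hf.continuousOn.integrableOn_compact hs.isCompact_closure).mono_set subset_closure

theorem poly_eq_zero_of_ball (p : MvPolynomial (Fin d) ℝ) {σ : ℝ} (hσ : 0 < σ)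
    (h : ∀ x ∈ Metric.ball (0 : Space d) σ, polyEval p x = 0) : p = 0 := by
  have hopen : IsOpen ((WithLp.toLp 2 : (Fin d → ℝ) → Space d) ⁻¹' Metric.ball 0 σ) :=
    Metric.isOpen_ball.preimage (PiLp.continuous_toLp 2 _)
  obtain ⟨ε, hε, hball⟩ := Metric.isOpen_iff.1 hopen 0 (by simpa using hσ)
  refine MvPolynomial.funext_set (fun _ => Metric.ball 0 ε) (fun i => ?_) fun x hx => ?_
  · rw [Real.ball_eq_Ioo]
    exact Ioo_infinite (by linarith)
  · have hxT : WithLp.toLp 2 x ∈ Metric.ball (0 : Space d) σ := by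
      apply hball
      have := ball_pi (0 : Fin d → ℝ) hε
      simp only [Pi.zero_apply] at this
      rw [← this] at hx
      exact hx
    simpa [polyEval] using h _ hxT

theorem eqOn_zero_of_toL1_eq_zero {E : Type*} [NormedAddCommGroup E] {f : Space d → E}
    (hf : Continuous f) {σ : ℝ} (hi : IntegrableOn f (Metric.ball 0 σ))
    (h : hi.toL1 f = 0) : ∀ x ∈ Metric.ball (0 : Space d) σ, f x = 0 := by
  refine Measure.eqOn_open_of_ae_eq (μ := volume) (g := fun _ => 0) ?_ Metric.isOpen_ball
    hf.continuousOn continuousOn_const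
  have h1 := hi.coeFn_toL1
  rw [h] at h1
  exact h1.symm.trans (Lp.coeFn_zero _ _ _)

variable (d) in
/-- Equivalence of norms on polynomials, on the unit scale. -/
theorem exists_polyGradient_le (r : ℕ) {σ : ℝ} (hσ : 0 < σ) : ∃ C : ℝ, 0 < C ∧
    ∀ p : MvPolynomial.restrictTotalDegree (Fin d) ℝ r, ∀ x ∈ Metric.closedBall (0 : Space d) 1,
      ‖polyGradient (p : MvPolynomial (Fin d) ℝ) x‖
        ≤ C * ∫ y in Metric.ball (0 : Space d) σ, ‖polyEval p y‖ ∧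
      ‖polyGradient (p : MvPolynomial (Fin d) ℝ) x‖
        ≤ C * ∫ y in Metric.ball (0 : Space d) σ, ‖polyGradient p y‖ := by
  have hi1 : ∀ p : MvPolynomial (Fin d) ℝ,
      Integrable (polyEval p) (volume.restrict (Metric.ball 0 σ)) := fun p =>
    integrableOn_of_continuous (continuous_polyEval p) Metric.isBounded_ball
  have hi2 : ∀ p : MvPolynomial (Fin d) ℝ,
      Integrable (polyGradient p) (volume.restrict (Metric.ball 0 σ)) := fun p =>
    integrableOn_of_continuous (continuous_polyGradient p) Metric.isBounded_ball
  have ea : ∀ p q : MvPolynomial (Fin d) ℝ, polyEval (p + q) = polyEval p + polyEval q :=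
    fun p q => by funext y; simp [polyEval]
  have es : ∀ (a : ℝ) (p : MvPolynomial (Fin d) ℝ), polyEval (a • p) = a • polyEval p :=
    fun a p => by funext y; simp [polyEval, MvPolynomial.smul_eval]
  have ga : ∀ p q : MvPolynomial (Fin d) ℝ,
      polyGradient (p + q) = polyGradient p + polyGradient q :=
    fun p q => by funext y; ext i; simp [polyGradient]
  have gs : ∀ (a : ℝ) (p : MvPolynomial (Fin d) ℝ), polyGradient (a • p) = a • polyGradient p :=
    fun a p => by funext y; ext i; simp [polyGradient, MvPolynomial.smul_eval]
  let V := MvPolynomial.restrictTotalDegree (Fin d) ℝ r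
  let A₁ : V →ₗ[ℝ] Lp ℝ 1 (volume.restrict (Metric.ball (0 : Space d) σ)) :=
    { toFun := fun p => (hi1 p).toL1 (polyEval p)
      map_add' := fun p q => by
        rw [← Integrable.toL1_add]
        congr 1
        exact ea _ _
      map_smul' := fun a p => by
        rw [RingHom.id_apply, ← Integrable.toL1_smul']
        congr 1
        exact es _ _ }
  let A₂ : V →ₗ[ℝ] Lp (Space d) 1 (volume.restrict (Metric.ball (0 : Space d) σ)) :=
    { toFun := fun p => (hi2 p).toL1 (polyGradient p)
      map_add' := fun p q => by
        rw [← Integrable.toL1_add]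
        congr 1
        exact ga _ _
      map_smul' := fun a p => by
        rw [RingHom.id_apply, ← Integrable.toL1_smul']
        congr 1
        exact gs _ _ }
  let B : V →ₗ[ℝ] C(Metric.closedBall (0 : Space d) 1, Space d) :=
    { toFun := fun p => ⟨fun x => polyGradient p x,
        (continuous_polyGradient _).comp continuous_subtype_val⟩
      map_add' := fun p q => by
        ext1 x
        exact congrFun (ga _ _) x
      map_smul' := fun a p => by
        ext1 x
        exact congrFun (gs _ _) x }
  have h₁ : LinearMap.ker A₁ ≤ LinearMap.ker B := fun p hp => by
    have h0 : (p : MvPolynomial (Fin d) ℝ) = 0 :=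
      poly_eq_zero_of_ball _ hσ (eqOn_zero_of_toL1_eq_zero (continuous_polyEval _) (hi1 p) hp)
    have : p = 0 := Subtype.ext h0
    rw [this]
    exact zero_mem _
  -- A gradient that vanishes on a ball has all its components, which are polynomials, identically
  -- zero.
  have h₂ : LinearMap.ker A₂ ≤ LinearMap.ker B := fun p hp => by
    have h0 := eqOn_zero_of_toL1_eq_zero (continuous_polyGradient _) (hi2 p) hp
    rw [LinearMap.mem_ker]
    ext x i
    have h1 : MvPolynomial.pderiv i (p : MvPolynomial (Fin d) ℝ) = 0 :=
      poly_eq_zero_of_ball _ hσ fun y hy => congrArg (fun v : Space d => v i) (h0 y hy)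
    change MvPolynomial.eval _ (MvPolynomial.pderiv i (p : MvPolynomial (Fin d) ℝ)) = 0
    rw [h1, map_zero]
  obtain ⟨C₁, hC₁, hb₁⟩ := exists_norm_le_of_ker_le A₁ B h₁
  obtain ⟨C₂, hC₂, hb₂⟩ := exists_norm_le_of_ker_le A₂ B h₂
  refine ⟨C₁ + C₂, by positivity, fun p x hx => ?_⟩
  have hB : ‖polyGradient (p : MvPolynomial (Fin d) ℝ) x‖ ≤ ‖B p‖ :=
    (B p).norm_coe_le_norm ⟨x, hx⟩
  have n₁ : ‖A₁ p‖ = ∫ y in Metric.ball (0 : Space d) σ, ‖polyEval p y‖ :=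
    L1.norm_of_fun_eq_integral_norm (hi1 p)
  have n₂ : ‖A₂ p‖ = ∫ y in Metric.ball (0 : Space d) σ, ‖polyGradient p y‖ :=
    L1.norm_of_fun_eq_integral_norm (hi2 p)
  rw [← n₁, ← n₂]
  have p₁ := norm_nonneg (A₁ p)
  have p₂ := norm_nonneg (A₂ p)
  constructor
  · refine (hB.trans (hb₁ p)).trans ?_
    gcongr
    linarith
  · refine (hB.trans (hb₂ p)).trans ?_
    gcongr
    linarith

theorem setIntegral_ball_comp_affine (f : Space d → ℝ) (c : Space d) {h : ℝ} (hh : 0 < h) (σ : ℝ) :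
    ∫ y in Metric.ball (0 : Space d) σ, f (c + h • y)
      = (h ^ d)⁻¹ * ∫ y in Metric.ball c (σ * h), f y := by
  have h1 : ∫ y in Metric.ball c (σ * h), f y
      = ∫ y, (Metric.ball c (σ * h)).indicator f (c + y) := by
    rw [integral_add_left_eq_self (fun y => (Metric.ball c (σ * h)).indicator f y) c,
      integral_indicator Metric.isOpen_ball.measurableSet]
  have h2 := Measure.integral_comp_smul_of_nonneg volume
    (fun y => (Metric.ball c (σ * h)).indicator f (c + y)) h (hR := hh.le)
  rw [finrank_euclideanSpace_fin, smul_eq_mul] at h2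
  rw [h1, ← h2, ← integral_indicator Metric.isOpen_ball.measurableSet]
  refine integral_congr_ae (Eventually.of_forall fun y => ?_)
  have hiff : y ∈ Metric.ball (0 : Space d) σ ↔ c + h • y ∈ Metric.ball c (σ * h) := by
    rw [mem_ball_zero_iff, mem_ball_iff_norm, add_sub_cancel_left, norm_smul,
      Real.norm_of_nonneg hh.le, mul_comm, mul_lt_mul_iff_left₀ hh]
  by_cases hy : y ∈ Metric.ball (0 : Space d) σ
  · simp only [indicator_of_mem hy, indicator_of_mem (hiff.1 hy)]
  · simp only [indicator_of_notMem hy, indicator_of_notMem fun h => hy (hiff.2 h)]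

variable (d) in
/-- The scaled gradient bounds for polynomials. -/
theorem exists_polyGradient_le_scaled (r : ℕ) {σ : ℝ} (hσ : 0 < σ) : ∃ C : ℝ, 0 < C ∧
    ∀ (p : MvPolynomial.restrictTotalDegree (Fin d) ℝ r) (c : Space d) (h : ℝ), 0 < h →
      ∀ x ∈ Metric.closedBall c h,
      h * ‖polyGradient (p : MvPolynomial (Fin d) ℝ) x‖
        ≤ C * (h ^ d)⁻¹ * ∫ y in Metric.ball c (σ * h), ‖polyEval p y‖ ∧
      ‖polyGradient (p : MvPolynomial (Fin d) ℝ) x‖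
        ≤ C * (h ^ d)⁻¹ * ∫ y in Metric.ball c (σ * h), ‖polyGradient p y‖ := by
  obtain ⟨C, hC, hb⟩ := exists_polyGradient_le d r hσ
  refine ⟨C, hC, fun p c h hh x hx => ?_⟩
  obtain ⟨q, hq⟩ := exists_poly_affine p c h
  have hg : ∀ y, polyGradient (q : MvPolynomial (Fin d) ℝ) y
      = h • polyGradient (p : MvPolynomial (Fin d) ℝ) (c + h • y) := fun y => by
    have h1 := hasGradientAt_polyEval (q : MvPolynomial (Fin d) ℝ) y
    refine h1.unique ?_
    have h2 : polyEval (q : MvPolynomial (Fin d) ℝ)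
        = fun y => polyEval (p : MvPolynomial (Fin d) ℝ) (c + h • y) := funext hq
    rw [h2, hasGradientAt_iff_hasFDerivAt]
    have h3 : HasFDerivAt (fun y : Space d => c + h • y)
        (h • ContinuousLinearMap.id ℝ (Space d)) y :=
      ((hasFDerivAt_id y).const_smul h).const_add c
    have h4 := (hasGradientAt_polyEval (p : MvPolynomial (Fin d) ℝ) (c + h • y)).hasFDerivAt.comp y
      h3
    refine h4.congr_fderiv ?_
    ext v
    simp
  set y := h⁻¹ • (x - c) with hy
  have hxy : c + h • y = x := by
    rw [hy, smul_smul, mul_inv_cancel₀ hh.ne', one_smul, add_sub_cancel]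
  have hy1 : y ∈ Metric.closedBall (0 : Space d) 1 := by
    rw [mem_closedBall_zero_iff, hy, norm_smul, norm_inv, Real.norm_of_nonneg hh.le,
      inv_mul_le_iff₀ hh, mul_one, ← dist_eq_norm]
    exact hx
  obtain ⟨b1, b2⟩ := hb q y hy1
  simp only [hg, hq, hxy, norm_smul, Real.norm_of_nonneg hh.le] at b1 b2
  rw [integral_const_mul, setIntegral_ball_comp_affine (fun y => ‖polyGradient _ y‖) c hh σ] at b2
  have hpos : (0 : ℝ) < h := hh
  constructor
  · have e := setIntegral_ball_comp_affine
      (fun y => ‖polyEval (p : MvPolynomial (Fin d) ℝ) y‖) c hh σ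
    simp only [Real.norm_eq_abs] at e b1 ⊢
    rw [e] at b1
    linarith
  · refine le_of_mul_le_mul_left (b2.trans_eq ?_) hh
    ring

end Polynomials

/-! ### Inverse and Poincaré–Sobolev inequalities on one element -/

section Elements

variable {d : ℕ}

variable (d) in
/-- The volume of the unit ball. -/
def unitVolume : ℝ := volume.real (Metric.ball (0 : Space d) 1)

variable (d) in
theorem unitVolume_pos : 0 < unitVolume d := by
  refine ENNReal.toReal_pos (Metric.measure_ball_pos _ _ one_pos).ne' ?_
  exact (Metric.isBounded_ball.measure_lt_top).ne

theorem volume_real_ball (c : Space d) {s : ℝ} (hs : 0 < s) :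
    volume.real (Metric.ball c s) = s ^ d * unitVolume d := by
  rw [measureReal_def, Measure.addHaar_ball_of_pos _ _ hs, ENNReal.toReal_mul,
    ENNReal.toReal_ofReal (by positivity), finrank_euclideanSpace_fin]
  rfl

theorem volume_real_closedBall (c : Space d) {s : ℝ} (hs : 0 < s) :
    volume.real (Metric.closedBall c s) = s ^ d * unitVolume d := by
  rw [Measure.addHaar_real_closedBall _ _ hs.le, finrank_euclideanSpace_fin]
  rfl

theorem setIntegral_rpow_le {f : Space d → ℝ} (hf : Continuous f) (hf0 : ∀ x, 0 ≤ f x)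
    {s : Set (Space d)} (hs : MeasurableSet s) (hb : Bornology.IsBounded s) {p : ℝ} (hp : 1 < p) :
    (∫ x in s, f x) ^ p ≤ volume.real s ^ (p - 1) * ∫ x in s, f x ^ p := by
  have hfin : IsFiniteMeasure (volume.restrict s) := ⟨by simpa using hb.measure_lt_top⟩
  obtain ⟨M, hM⟩ := hb.isCompact_closure.exists_bound_of_continuousOn hf.continuousOn
  have hp0 : 0 < p := by linarith
  have hpq := Real.HolderConjugate.conjExponent hp
  have hmem : MemLp f (ENNReal.ofReal p) (volume.restrict s) := by
    have h1 : MemLp f ∞ (volume.restrict s) := by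
      refine memLp_top_of_bound hf.aestronglyMeasurable M ?_
      filter_upwards [ae_restrict_mem hs] with x hx
      exact hM x (subset_closure hx)
    exact h1.mono_exponent le_top
  have h := integral_mul_le_Lp_mul_Lq_of_nonneg hpq (ae_of_all _ hf0)
    (ae_of_all _ fun _ => zero_le_one) hmem (memLp_const (1 : ℝ))
  simp only [mul_one, Real.one_rpow, integral_const, measureReal_restrict_apply_univ,
    smul_eq_mul] at h
  have hI0 : 0 ≤ ∫ x in s, f x := integral_nonneg hf0
  have hJ0 : 0 ≤ ∫ x in s, f x ^ p := integral_nonneg fun x => Real.rpow_nonneg (hf0 x) _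
  have hv : 0 ≤ volume.real s := measureReal_nonneg
  refine (Real.rpow_le_rpow hI0 h hp0.le).trans_eq ?_
  rw [Real.mul_rpow (by positivity) (by positivity), ← Real.rpow_mul hJ0, ← Real.rpow_mul hv,
    one_div_mul_cancel hp0.ne', Real.rpow_one, mul_comm]
  congr 2
  rw [Real.conjExponent]
  have : p - 1 ≠ 0 := by linarith
  field_simp

variable (d) in
/-- The inverse inequality on one element. -/
theorem exists_inverse_le (r : ℕ) {σ : ℝ} (hσ : 0 < σ) : ∃ C : ℝ, 0 < C ∧
    ∀ (p : MvPolynomial.restrictTotalDegree (Fin d) ℝ r) (c : Space d) (h : ℝ) (T : Set (Space d)),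
      0 < h → IsOpen T → Metric.ball c (σ * h) ⊆ T → T ⊆ Metric.closedBall c h →
      h ^ 2 * ∫ x in T, ‖polyGradient (p : MvPolynomial (Fin d) ℝ) x‖ ^ 2
        ≤ C * ∫ x in T, ‖polyEval p x‖ ^ 2 := by
  obtain ⟨C, hC, hb⟩ := exists_polyGradient_le_scaled d r hσ
  have hV₁ := unitVolume_pos d
  refine ⟨C ^ 2 * unitVolume d ^ 2 * σ ^ d, by positivity, fun p c h T hh hTo hBT hTB => ?_⟩
  set q := p.1
  have hσh : 0 < σ * h := by positivity
  have hTb : Bornology.IsBounded T := Metric.isBounded_closedBall.subset hTB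
  set I := ∫ y in Metric.ball c (σ * h), ‖polyEval q y‖ with hI
  have hI0 : 0 ≤ I := integral_nonneg fun _ => norm_nonneg _
  set J := ∫ x in T, ‖polyEval q x‖ ^ 2 with hJ
  -- Integrals are taken over the inscribed ball and suprema over the circumscribed one; T is merely
  -- squeezed in between, so its shape does not matter.
  have hIJ : I ^ 2 ≤ (σ * h) ^ d * unitVolume d * J := by
    have h1 := setIntegral_rpow_le (continuous_polyEval q).norm (fun _ => norm_nonneg _)
      Metric.isOpen_ball.measurableSet (Metric.isBounded_ball (x := c) (r := σ * h)) one_lt_two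
    simp only [Real.rpow_two] at h1
    rw [show (2 : ℝ) - 1 = 1 by norm_num, Real.rpow_one, volume_real_ball c hσh] at h1
    refine h1.trans (mul_le_mul_of_nonneg_left ?_ (by positivity))
    exact setIntegral_mono_set
      (integrableOn_of_continuous ((continuous_polyEval q).norm.pow 2) hTb)
      (ae_of_all _ fun _ => sq_nonneg _) hBT.eventuallyLE
  have hsup : ∀ x ∈ T, h ^ 2 * ‖polyGradient q x‖ ^ 2 ≤ (C * (h ^ d)⁻¹ * I) ^ 2 := fun x hx => by
    rw [← mul_pow]
    exact pow_le_pow_left₀ (by positivity) (hb p c h hh x (hTB hx)).1 2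
  have hvol : volume.real T ≤ h ^ d * unitVolume d := by
    rw [← volume_real_closedBall c hh]
    exact measureReal_mono hTB Metric.isBounded_closedBall.measure_lt_top.ne
  calc h ^ 2 * ∫ x in T, ‖polyGradient q x‖ ^ 2
      = ∫ x in T, h ^ 2 * ‖polyGradient q x‖ ^ 2 := (integral_const_mul _ _).symm
    _ ≤ ∫ _ in T, (C * (h ^ d)⁻¹ * I) ^ 2 :=
        setIntegral_mono_on (integrableOn_of_continuous
          (continuous_const.mul ((continuous_polyGradient q).norm.pow 2)) hTb)
          (integrableOn_const hTb.measure_lt_top.ne) hTo.measurableSet hsup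
    _ = volume.real T * (C * (h ^ d)⁻¹ * I) ^ 2 := by
        rw [setIntegral_const, smul_eq_mul]
    _ ≤ (h ^ d * unitVolume d) * (C ^ 2 * ((h ^ d)⁻¹) ^ 2
          * ((σ * h) ^ d * unitVolume d * J)) := by
        rw [mul_pow, mul_pow]
        gcongr
    _ = C ^ 2 * unitVolume d ^ 2 * σ ^ d * J := by
        rw [mul_pow]
        field_simp

variable (d) in
/-- The Poincaré-Sobolev inequality for polynomials on one element. -/
theorem exists_poincare_le (r : ℕ) {σ b D : ℝ} (hσ : 0 < σ) (hb1 : 1 < b)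
    (hbd : 0 ≤ 2 + (d : ℝ) - 2 * d / b) : ∃ C : ℝ, 0 < C ∧
    ∀ (p : MvPolynomial.restrictTotalDegree (Fin d) ℝ r) (c : Space d) (h : ℝ) (T : Set (Space d)),
      0 < h → h ≤ D → IsOpen T → Metric.ball c (σ * h) ⊆ T → T ⊆ Metric.closedBall c h →
      ∫ x in T, ‖polyEval (p : MvPolynomial (Fin d) ℝ) x - polyEval p c‖ ^ 2
        ≤ C * (∫ x in T, ‖polyGradient (p : MvPolynomial (Fin d) ℝ) x‖ ^ b) ^ (2 / b) := by
  obtain ⟨C, hC, hb⟩ := exists_polyGradient_le_scaled d r hσ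
  have hV₁ := unitVolume_pos d
  have hb0 : 0 < b := by linarith
  set V₁ := unitVolume d with hV₁'
  refine ⟨C ^ 2 * V₁ * (σ ^ d * V₁) ^ (2 - 2 / b) * (|D| ^ (2 + (d : ℝ) - 2 * d / b) + 1),
    by positivity, fun p c h T hh hhD hTo hBT hTB => ?_⟩
  set q := p.1
  have hσh : 0 < σ * h := by positivity
  have hTb : Bornology.IsBounded T := Metric.isBounded_closedBall.subset hTB
  set I := ∫ y in Metric.ball c (σ * h), ‖polyGradient q y‖ with hI
  have hI0 : 0 ≤ I := integral_nonneg fun _ => norm_nonneg _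
  set X := ∫ x in T, ‖polyGradient q x‖ ^ b with hX
  have hX0 : 0 ≤ X := integral_nonneg fun _ => Real.rpow_nonneg (norm_nonneg _) _
  have hIX : I ^ 2 ≤ ((σ * h) ^ d * V₁) ^ (2 - 2 / b) * X ^ (2 / b) := by
    have h1 := setIntegral_rpow_le (continuous_polyGradient q).norm (fun _ => norm_nonneg _)
      Metric.isOpen_ball.measurableSet (Metric.isBounded_ball (x := c) (r := σ * h)) hb1
    rw [volume_real_ball c hσh] at h1
    have h2 : ∫ x in Metric.ball c (σ * h), ‖polyGradient q x‖ ^ b ≤ X :=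
      setIntegral_mono_set (integrableOn_of_continuous
        ((Real.continuous_rpow_const hb0.le).comp (continuous_polyGradient q).norm) hTb)
        (ae_of_all _ fun _ => Real.rpow_nonneg (norm_nonneg _) _) hBT.eventuallyLE
    have h3 : I ^ b ≤ ((σ * h) ^ d * V₁) ^ (b - 1) * X :=
      h1.trans (mul_le_mul_of_nonneg_left h2 (by positivity))
    have h4 := Real.rpow_le_rpow (by positivity) h3 (by positivity : 0 ≤ 2 / b)
    rw [← Real.rpow_mul hI0, mul_div_cancel₀ _ hb0.ne', Real.rpow_two,
      Real.mul_rpow (by positivity) hX0, ← Real.rpow_mul (by positivity)] at h4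
    have e : (b - 1) * (2 / b) = 2 - 2 / b := by field_simp
    rwa [e] at h4
  have hgrad : ∀ x ∈ Metric.closedBall c h, ‖polyGradient q x‖ ≤ C * (h ^ d)⁻¹ * I :=
    fun x hx => (hb p c h hh x hx).2
  -- The mean value inequality is applied on the convex ball of radius h, where the polynomial still
  -- makes sense; T itself need not be convex.
  have hsup : ∀ x ∈ T, ‖polyEval q x - polyEval q c‖ ^ 2 ≤ (C * (h ^ d)⁻¹ * I * h) ^ 2 :=
    fun x hx => by
    refine pow_le_pow_left₀ (norm_nonneg _) ?_ 2
    have h1 := (convex_closedBall c h).norm_image_sub_le_of_norm_hasFDerivWithin_le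
      (f := polyEval q) (fun y _ => (hasGradientAt_polyEval q y).hasFDerivAt.hasFDerivWithinAt)
      (C := C * (h ^ d)⁻¹ * I) (fun y hy => by rw [LinearIsometryEquiv.norm_map]; exact hgrad y hy)
      (Metric.mem_closedBall_self hh.le) (hTB hx)
    refine h1.trans ?_
    gcongr
    rw [← dist_eq_norm]
    exact hTB hx
  have hvol : volume.real T ≤ h ^ d * V₁ := by
    rw [hV₁', ← volume_real_closedBall c hh]
    exact measureReal_mono hTB Metric.isBounded_closedBall.measure_lt_top.ne
  -- Power count: h² from the mean value inequality, h^d from the volume of T, h^(−2d) from the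
  -- scaled norm equivalence, h^(2d−2d/b) from Hölder's inequality on the small ball.
  have hpow : h ^ 2 * h ^ d * ((h ^ d)⁻¹) ^ 2 * (h ^ d) ^ (2 - 2 / b)
      = h ^ (2 + (d : ℝ) - 2 * d / b) := by
    rw [← Real.rpow_natCast h d, ← Real.rpow_mul hh.le, ← Real.rpow_neg hh.le,
      ← Real.rpow_natCast h 2, ← Real.rpow_mul_natCast hh.le, ← Real.rpow_add hh,
      ← Real.rpow_add hh, ← Real.rpow_add hh]
    congr 1
    push_cast
    ring
  have hpowD : h ^ (2 + (d : ℝ) - 2 * d / b) ≤ |D| ^ (2 + (d : ℝ) - 2 * d / b) + 1 := by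
    have := Real.rpow_le_rpow hh.le (hhD.trans (le_abs_self D)) hbd
    linarith
  calc ∫ x in T, ‖polyEval q x - polyEval q c‖ ^ 2
      ≤ ∫ _ in T, (C * (h ^ d)⁻¹ * I * h) ^ 2 :=
        setIntegral_mono_on (integrableOn_of_continuous
          (((continuous_polyEval q).sub continuous_const).norm.pow 2) hTb)
          (integrableOn_const hTb.measure_lt_top.ne) hTo.measurableSet hsup
    _ = volume.real T * (C * (h ^ d)⁻¹ * I * h) ^ 2 := by
        rw [setIntegral_const, smul_eq_mul]
    _ ≤ (h ^ d * V₁) * (C ^ 2 * ((h ^ d)⁻¹) ^ 2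
          * (((σ * h) ^ d * V₁) ^ (2 - 2 / b) * X ^ (2 / b)) * h ^ 2) := by
        rw [mul_pow, mul_pow, mul_pow]
        gcongr
    _ = C ^ 2 * V₁ * (σ ^ d * V₁) ^ (2 - 2 / b)
          * (h ^ 2 * h ^ d * ((h ^ d)⁻¹) ^ 2 * (h ^ d) ^ (2 - 2 / b)) * X ^ (2 / b) := by
        have e : (σ * h) ^ d * V₁ = σ ^ d * V₁ * h ^ d := by rw [mul_pow]; ring
        rw [e, Real.mul_rpow (by positivity) (by positivity)]
        ring
    _ ≤ _ := by
        rw [hpow]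
        gcongr

end Elements

/-! ### Inequalities on the finite element space -/

namespace Triangulation

variable {d : ℕ} {Ω : Set (Space d)} {𝒯 : Triangulation Ω} {r : ℕ}

theorem meshSize_pos (hd : 2 ≤ d) (hΩb : Bornology.IsBounded Ω) {T : Set (Space d)}
    (hT : T ∈ 𝒯.elements) : 0 < 𝒯.meshSize ∧ Metric.diam T ≤ 𝒯.meshSize ∧
      𝒯.meshSize ≤ Metric.diam Ω := by
  have hfin : (Metric.diam '' (𝒯.elements : Set (Set (Space d)))).Finite :=
    𝒯.elements.finite_toSet.image _
  have h1 : Metric.diam T ≤ 𝒯.meshSize := le_csSup hfin.bddAbove (mem_image_of_mem _ hT)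
  have : Nonempty (Fin d) := ⟨⟨0, by omega⟩⟩
  obtain ⟨x, hx⟩ := 𝒯.nonempty T hT
  have h2 : 0 < Metric.diam T :=
    Metric.diam_pos (infinite_of_mem_nhds x ((𝒯.isOpen T hT).mem_nhds hx)).nontrivial
      (𝒯.isBounded T hT)
  refine ⟨h2.trans_le h1, h1, csSup_le ⟨_, mem_image_of_mem _ hT⟩ ?_⟩
  rintro _ ⟨S, hS, rfl⟩
  exact Metric.diam_mono (𝒯.subset S hS) hΩb

theorem exists_center (hd : 2 ≤ d) (hΩb : Bornology.IsBounded Ω) {σ : ℝ} (hσ : 0 < σ)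
    (hq : 𝒯.IsQuasiUniform σ) {T : Set (Space d)} (hT : T ∈ 𝒯.elements) :
    ∃ c : Space d, Metric.ball c (σ * 𝒯.meshSize) ⊆ T ∧ T ⊆ Metric.closedBall c 𝒯.meshSize ∧
      ∀ y ∈ Metric.ball c (σ * 𝒯.meshSize), StarConvex ℝ y T := by
  obtain ⟨c, hc, hs⟩ := hq T hT
  obtain ⟨h0, h1, -⟩ := meshSize_pos hd hΩb hT
  have hcT : c ∈ T := hc (Metric.mem_ball_self (by positivity))
  exact ⟨c, hc, fun x hx => (Metric.dist_le_diam_of_mem (𝒯.isBounded T hT) hx hcT).trans h1, hs⟩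

theorem setIntegral_eq_sum_of_integrableOn {f : Space d → ℝ}
    (hf : ∀ T : 𝒯.elements, IntegrableOn f T) :
    ∫ x in Ω, f x = ∑ T : 𝒯.elements, ∫ x in (T : Set (Space d)), f x := by
  have hae : (⋃ T : 𝒯.elements, (T : Set (Space d))) =ᵐ[volume] Ω := by
    refine LE.le.eventuallyLE (iUnion_subset fun T => 𝒯.subset _ T.2) |>.antisymm ?_
    rw [ae_le_set]
    convert 𝒯.covers using 3
    simp [iUnion_subtype]
  rw [← setIntegral_congr_set hae,
    integral_iUnion_fintype (fun T => (𝒯.isOpen _ T.2).measurableSet) _ hf]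
  intro T T' hne
  exact 𝒯.disjoint T.2 T'.2 fun h => hne (Subtype.ext h)

theorem setIntegral_eq_sum {f : Space d → ℝ} {F : 𝒯.elements → Space d → ℝ}
    (hF : ∀ T, Continuous (F T)) (hf : ∀ T : 𝒯.elements, EqOn f (F T) (T : Set (Space d))) :
    ∫ x in Ω, f x = ∑ T : 𝒯.elements, ∫ x in (T : Set (Space d)), F T x := by
  have hmeas : ∀ T : 𝒯.elements, MeasurableSet (T : Set (Space d)) :=
    fun T => (𝒯.isOpen _ T.2).measurableSet
  rw [setIntegral_eq_sum_of_integrableOn fun T => (integrableOn_of_continuous (hF T)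
    (𝒯.isBounded _ T.2)).congr_fun (fun x hx => (hf T hx).symm) (hmeas T)]
  exact Finset.sum_congr rfl fun T _ => setIntegral_congr_fun (hmeas T) (hf T)

theorem polyGrad_of_mem (p : 𝒯.PolyFamily r) (T : 𝒯.elements) {x : Space d}
    (hx : x ∈ (T : Set (Space d))) :
    polyGrad p x = polyGradient (p T : MvPolynomial (Fin d) ℝ) x := by
  unfold polyGrad
  rw [Finset.sum_eq_single T, indicator_of_mem hx]
  · rfl
  · intro T' _ hne
    refine indicator_of_notMem (fun hx' => ?_) _
    exact Set.disjoint_left.1 (𝒯.disjoint T'.2 T.2 (fun h => hne (Subtype.ext h))) hx' hx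
  · simp

theorem memLp_polyGrad (p : 𝒯.PolyFamily r) : MemLp (polyGrad p) 2 (volume.restrict Ω) := by
  refine MemLp.restrict _ ?_
  refine memLp_finsetSum _ fun T _ => ?_
  rw [memLp_indicator_iff_restrict (𝒯.isOpen _ T.2).measurableSet]
  have hc : IsCompact (closure (T : Set (Space d))) := (𝒯.isBounded _ T.2).isCompact_closure
  obtain ⟨M, hM⟩ := hc.exists_bound_of_continuousOn
    (continuous_polyGradient (p T : MvPolynomial (Fin d) ℝ)).continuousOn
  have : IsFiniteMeasure (volume.restrict (T : Set (Space d))) :=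
    ⟨by simpa using (𝒯.isBounded _ T.2).measure_lt_top⟩
  refine MemLp.of_bound (continuous_polyGradient _).aestronglyMeasurable M ?_
  filter_upwards [ae_restrict_mem (𝒯.isOpen _ T.2).measurableSet] with x hx
  exact hM x (subset_closure hx)

/-- The family of polynomials defining an element of `W_h`. -/
def family : 𝒯.femSpace r ≃ₗ[ℝ] 𝒯.PolyFamily r :=
  (LinearEquiv.ofInjective (𝒯.toL2 r) (𝒯.toL2_injective r)).symm

theorem polyGrad_add (p q : 𝒯.PolyFamily r) : polyGrad (p + q) = polyGrad p + polyGrad q := by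
  funext x
  simp only [polyGrad, Pi.add_apply, ← Finset.sum_add_distrib]
  refine Finset.sum_congr rfl fun T _ => ?_
  by_cases hx : x ∈ (T : Set (Space d))
  · simp only [indicator_of_mem hx]
    ext i
    simp
  · simp only [indicator_of_notMem hx, add_zero]

theorem polyGrad_smul (a : ℝ) (p : 𝒯.PolyFamily r) : polyGrad (a • p) = a • polyGrad p := by
  funext x
  simp only [polyGrad, Pi.smul_apply, Finset.smul_sum]
  refine Finset.sum_congr rfl fun T _ => ?_
  by_cases hx : x ∈ (T : Set (Space d))
  · simp only [indicator_of_mem hx]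
    ext i
    simp [MvPolynomial.smul_eval]
  · simp only [indicator_of_notMem hx, smul_zero]

variable (𝒯 r) in
/-- The elementwise gradient as a linear map into `(L²(Ω))^d`. -/
def gradL2ₗ : 𝒯.femSpace r →ₗ[ℝ] L2Vec Ω where
  toFun w := (memLp_polyGrad (family w)).toLp (polyGrad (family w))
  map_add' v w := by
    rw [← MemLp.toLp_add]
    congr 1
    rw [map_add, polyGrad_add]
  map_smul' a w := by
    rw [RingHom.id_apply, ← MemLp.toLp_const_smul]
    congr 1
    rw [map_smul, polyGrad_smul]

variable (𝒯 r) in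
/-- The elementwise gradient as a continuous linear map. -/
def gradL2 : 𝒯.femSpace r →L[ℝ] L2Vec Ω := (𝒯.gradL2ₗ r).toContinuousLinearMap

theorem coeFn_gradL2 (w : 𝒯.femSpace r) :
    𝒯.gradL2 r w =ᵐ[volume.restrict Ω] polyGrad (family w) :=
  (memLp_polyGrad (family w)).coeFn_toLp

theorem coeFn_femSpace (w : 𝒯.femSpace r) :
    (w : L2 Ω) =ᵐ[volume.restrict Ω] polyFun (family w) := by
  have h : (w : L2 Ω) = 𝒯.toL2 r (family w) :=
    congrArg Subtype.val
      ((LinearEquiv.ofInjective (𝒯.toL2 r) (𝒯.toL2_injective r)).apply_symm_apply w).symm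
  rw [h]
  exact (memLp_polyFun (family w)).coeFn_toLp

theorem norm_sq_femSpace (w : 𝒯.femSpace r) :
    ‖w‖ ^ 2 = ∑ T : 𝒯.elements, ∫ x in (T : Set (Space d)),
      ‖polyEval (family w T : MvPolynomial (Fin d) ℝ) x‖ ^ 2 := by
  rw [Submodule.coe_norm, norm_sq_eq_integral,
    integral_congr_ae (g := fun x => ‖polyFun (family w) x‖ ^ 2)
      (by filter_upwards [coeFn_femSpace w] with x hx; rw [hx])]
  refine setIntegral_eq_sum (fun T => (continuous_polyEval _).norm.pow 2) fun T x hx => ?_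
  simp only [polyFun_of_mem _ T hx, polyEval]

theorem norm_sq_gradL2 (w : 𝒯.femSpace r) :
    ‖𝒯.gradL2 r w‖ ^ 2 = ∑ T : 𝒯.elements, ∫ x in (T : Set (Space d)),
      ‖polyGradient (family w T : MvPolynomial (Fin d) ℝ) x‖ ^ 2 := by
  rw [norm_sq_eq_integral, integral_congr_ae (g := fun x => ‖polyGrad (family w) x‖ ^ 2)
    (by filter_upwards [coeFn_gradL2 w] with x hx; rw [hx])]
  refine setIntegral_eq_sum (fun T => (continuous_polyGradient _).norm.pow 2) fun T x hx => ?_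
  simp only [polyGrad_of_mem _ T hx]

theorem integral_gradL2_rpow (w : 𝒯.femSpace r) {b : ℝ} (hb : 0 ≤ b) :
    ∫ x in Ω, ‖𝒯.gradL2 r w x‖ ^ b = ∑ T : 𝒯.elements, ∫ x in (T : Set (Space d)),
      ‖polyGradient (family w T : MvPolynomial (Fin d) ℝ) x‖ ^ b := by
  rw [integral_congr_ae (g := fun x => ‖polyGrad (family w) x‖ ^ b)
    (by filter_upwards [coeFn_gradL2 w] with x hx; rw [hx])]
  refine setIntegral_eq_sum (fun T => (Real.continuous_rpow_const hb).comp
    (continuous_polyGradient _).norm) fun T x hx => ?_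
  simp only [polyGrad_of_mem _ T hx]

/-- The piecewise constant function with given values. -/
def piecewiseConst (a : 𝒯.elements → ℝ) : 𝒯.femSpace r :=
  family.symm fun T => ⟨MvPolynomial.C (a T), by simp [MvPolynomial.mem_restrictTotalDegree]⟩

theorem family_piecewiseConst (a : 𝒯.elements → ℝ) (T : 𝒯.elements) :
    (family (piecewiseConst (r := r) a) T : MvPolynomial (Fin d) ℝ) = MvPolynomial.C (a T) := by
  rw [piecewiseConst, LinearEquiv.apply_symm_apply]

theorem gradL2_piecewiseConst (a : 𝒯.elements → ℝ) :
    𝒯.gradL2 r (piecewiseConst a) = 0 := by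
  have h : ‖𝒯.gradL2 r (piecewiseConst a)‖ ^ 2 = 0 := by
    rw [norm_sq_gradL2]
    refine Finset.sum_eq_zero fun T _ => ?_
    have h0 : ∀ x : Space d, polyGradient (MvPolynomial.C (a T)) x = 0 := fun x => by
      ext i; simp [polyGradient]
    simp [family_piecewiseConst, h0]
  simpa using h

/-- The inverse inequality on `W_h`. -/
theorem exists_inverse_le_femSpace (hd : 2 ≤ d) (hΩb : Bornology.IsBounded Ω) (r : ℕ) {σ : ℝ}
    (hσ : 0 < σ) : ∃ C : ℝ, 0 < C ∧ ∀ 𝒯 : Triangulation Ω, 𝒯.IsQuasiUniform σ →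
      ∀ w : 𝒯.femSpace r, 𝒯.meshSize ^ 2 * ‖𝒯.gradL2 r w‖ ^ 2 ≤ C * ‖w‖ ^ 2 := by
  obtain ⟨C, hC, h⟩ := exists_inverse_le d r hσ
  refine ⟨C, hC, fun 𝒯 hq w => ?_⟩
  rw [norm_sq_gradL2, norm_sq_femSpace, Finset.mul_sum, Finset.mul_sum]
  refine Finset.sum_le_sum fun T _ => ?_
  obtain ⟨c, hc1, hc2, -⟩ := exists_center hd hΩb hσ hq T.2
  exact h _ c _ T (meshSize_pos hd hΩb T.2).1 (𝒯.isOpen _ T.2) hc1 hc2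

/-- The embedding of ℓ¹ into ℓ^e: pull out X_i^(e−1) ≤ (∑ X)^(e−1). It sums the elementwise
Poincaré–Sobolev estimates, in which e = 2/b, with no loss in the number of elements. -/
theorem sum_rpow_le_rpow_sum {ι : Type*} (s : Finset ι) {X : ι → ℝ} (hX : ∀ i, 0 ≤ X i) {e : ℝ}
    (he : 1 ≤ e) : ∑ i ∈ s, X i ^ e ≤ (∑ i ∈ s, X i) ^ e := by
  have hS : 0 ≤ ∑ i ∈ s, X i := Finset.sum_nonneg fun i _ => hX i
  have h1 : ∀ i ∈ s, X i ^ e ≤ X i * (∑ i ∈ s, X i) ^ (e - 1) := fun i hi => by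
    have : X i ^ e = X i * X i ^ (e - 1) := by
      rw [mul_comm, ← Real.rpow_add_one' (hX i) (by linarith), sub_add_cancel]
    rw [this]
    exact mul_le_mul_of_nonneg_left (Real.rpow_le_rpow (hX i)
      (Finset.single_le_sum (fun i _ => hX i) hi) (by linarith)) (hX i)
  refine (Finset.sum_le_sum h1).trans_eq ?_
  rw [← Finset.sum_mul, mul_comm, ← Real.rpow_add_one' hS (by linarith), sub_add_cancel]

set_option maxHeartbeats 1000000 in
/-- The Poincaré-Sobolev inequality on `W_h`, modulo elementwise constants. -/
theorem exists_poincare_le_femSpace (hd : 2 ≤ d) (hΩb : Bornology.IsBounded Ω) (r : ℕ) {σ b : ℝ}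
    (hσ : 0 < σ) (hb1 : 1 < b) (hb2 : b ≤ 2) (hbd : 0 ≤ 2 + (d : ℝ) - 2 * d / b) :
    ∃ C : ℝ, 0 < C ∧ ∀ 𝒯 : Triangulation Ω, 𝒯.IsQuasiUniform σ → ∀ w : 𝒯.femSpace r,
      ‖oscillation (𝒯.gradL2 r) w‖ ^ b ≤ C * ∫ x in Ω, ‖𝒯.gradL2 r w x‖ ^ b := by
  obtain ⟨C, hC, h⟩ := exists_poincare_le d r (D := Metric.diam Ω) hσ hb1 hbd
  have hb0 : 0 < b := by linarith
  refine ⟨C ^ (b / 2), by positivity, fun 𝒯 hq w => ?_⟩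
  choose c hc1 hc2 hc3 using fun T : 𝒯.elements => exists_center hd hΩb hσ hq T.2
  -- The values of w at the element centres give a competitor in the kernel of the gradient; the
  -- oscillation, being minimal, is no larger than w − v.
  set v : 𝒯.femSpace r :=
    piecewiseConst fun T => polyEval (family w T : MvPolynomial (Fin d) ℝ) (c T) with hv
  have h1 : ‖oscillation (𝒯.gradL2 r) w‖ ≤ ‖w - v‖ :=
    IsFlow.norm_oscillation_le w v (gradL2_piecewiseConst _)
  set X : 𝒯.elements → ℝ := fun T => ∫ x in (T : Set (Space d)),
    ‖polyGradient (family w T : MvPolynomial (Fin d) ℝ) x‖ ^ b with hX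
  have hX0 : ∀ T, 0 ≤ X T := fun T => integral_nonneg fun _ => Real.rpow_nonneg (norm_nonneg _) _
  have h2 : ‖w - v‖ ^ 2 ≤ C * (∑ T, X T) ^ (2 / b) := by
    rw [norm_sq_femSpace]
    refine le_trans ?_ (mul_le_mul_of_nonneg_left (sum_rpow_le_rpow_sum Finset.univ hX0
      (by rw [le_div_iff₀ hb0]; linarith)) hC.le)
    rw [Finset.mul_sum]
    refine Finset.sum_le_sum fun T _ => ?_
    obtain ⟨m0, -, m2⟩ := meshSize_pos hd hΩb T.2
    refine le_trans (le_of_eq ?_) (h (family w T) (c T) _ T m0 m2 (𝒯.isOpen _ T.2) (hc1 T) (hc2 T))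
    refine integral_congr_ae (Eventually.of_forall fun x => ?_)
    simp only [map_sub, Pi.sub_apply, Submodule.coe_sub, hv, family_piecewiseConst, polyEval,
      MvPolynomial.eval_C]
  rw [integral_gradL2_rpow w hb0.le]
  have hS0 : 0 ≤ ∑ T, X T := Finset.sum_nonneg fun T _ => hX0 T
  calc ‖oscillation (𝒯.gradL2 r) w‖ ^ b ≤ ‖w - v‖ ^ b :=
        Real.rpow_le_rpow (norm_nonneg _) h1 hb0.le
    _ = (‖w - v‖ ^ 2) ^ (b / 2) := by
        rw [← Real.rpow_natCast_mul (norm_nonneg _)]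
        congr 1
        push_cast
        ring
    _ ≤ (C * (∑ T, X T) ^ (2 / b)) ^ (b / 2) := by gcongr
    _ = C ^ (b / 2) * ∑ T, X T := by
        rw [Real.mul_rpow hC.le (by positivity), ← Real.rpow_mul hS0,
          show 2 / b * (b / 2) = 1 by field_simp, Real.rpow_one]

end Triangulation

/-! ### Averages over segments -/

section Tools

theorem sq_lintegral_le {X : Type*} [MeasurableSpace X] (ν : Measure X) [IsProbabilityMeasure ν]
    {f : X → ℝ≥0∞} (hf : AEMeasurable f ν) : (∫⁻ x, f x ∂ν) ^ 2 ≤ ∫⁻ x, f x ^ 2 ∂ν := by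
  have h := ENNReal.lintegral_mul_le_Lp_mul_Lq ν Real.HolderConjugate.two_two hf
    (aemeasurable_const (b := (1 : ℝ≥0∞)))
  simp only [Pi.mul_apply, mul_one, ENNReal.one_rpow, lintegral_const, measure_univ] at h
  have h2 : (∫⁻ x, f x ∂ν) ^ (2 : ℝ) ≤ ((∫⁻ x, f x ^ (2 : ℝ) ∂ν) ^ (1 / 2 : ℝ)) ^ (2 : ℝ) :=
    ENNReal.rpow_le_rpow h zero_le_two
  rw [← ENNReal.rpow_mul] at h2
  norm_num at h2
  exact h2

variable {d : ℕ}

theorem lintegral_comp_add_smul_le {F : Space d → ℝ≥0∞} (hF : Measurable F) (a : Space d) {s : ℝ}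
    (hs : 1 / 2 ≤ s) : ∫⁻ x, F (a + s • x) ≤ 2 ^ d * ∫⁻ x, F x := by
  have hs0 : 0 < s := by linarith
  have h1 : ∫⁻ x, F (a + s • x) = ∫⁻ y, F (a + y) ∂(Measure.map (s • ·) volume) := by
    exact (lintegral_map (f := fun y => F (a + y)) (hF.comp (measurable_const_add a))
      (measurable_const_smul s)).symm
  rw [h1, Measure.map_addHaar_smul _ hs0.ne', lintegral_smul_measure,
    lintegral_add_left_eq_self (fun y => F y) a, finrank_euclideanSpace_fin, smul_eq_mul]
  gcongr
  rw [abs_of_nonneg (by positivity), ← inv_pow]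
  have : s⁻¹ ≤ 2 := by
    rw [inv_le_comm₀ hs0 two_pos]
    linarith
  calc ENNReal.ofReal (s⁻¹ ^ d) ≤ ENNReal.ofReal (2 ^ d) := by
        apply ENNReal.ofReal_le_ofReal
        gcongr
    _ = 2 ^ d := by
        rw [ENNReal.ofReal_pow zero_le_two]
        simp

/-- The average of a function over segments joining two bounded sets. -/
theorem lintegral_segments_le {F : Space d → ℝ≥0∞} (hF : Measurable F) {A B : Set (Space d)}
    {m : ℝ≥0∞} (hA : volume A ≤ m) (hB : volume B ≤ m) :
    ∫⁻ z : Space d × Space d, (∫⁻ s in Ioc (0 : ℝ) 1, F (z.2 + s • (z.1 - z.2)))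
        ∂((volume.restrict A).prod (volume.restrict B))
      ≤ m * (2 ^ d * ∫⁻ x, F x) := by
  have hmeas : Measurable fun q : (Space d × Space d) × ℝ => F (q.1.2 + q.2 • (q.1.1 - q.1.2)) :=
    hF.comp (by fun_prop)
  rw [lintegral_lintegral_swap hmeas.aemeasurable]
  have key : ∀ s ∈ Ioc (0 : ℝ) 1,
      ∫⁻ z : Space d × Space d, F (z.2 + s • (z.1 - z.2))
        ∂((volume.restrict A).prod (volume.restrict B)) ≤ m * (2 ^ d * ∫⁻ x, F x) := by
    intro s hs
    have hm : Measurable fun z : Space d × Space d => F (z.2 + s • (z.1 - z.2)) :=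
      hF.comp (by fun_prop)
    -- One of s and 1 − s is at least 1/2. Integrating first in the endpoint with that coefficient
    -- keeps the Jacobian of the dilation below 2^d.
    rcases le_total (1 / 2) s with h | h
    · rw [lintegral_prod_symm _ hm.aemeasurable]
      calc _ ≤ ∫⁻ _ in B, 2 ^ d * ∫⁻ x, F x := by
            refine lintegral_mono fun y => ?_
            refine (setLIntegral_le_lintegral _ _).trans ?_
            have e : ∀ x : Space d, y + s • (x - y) = (y - s • y) + s • x := fun x => by
              rw [smul_sub]; abel
            simp only [e]
            exact lintegral_comp_add_smul_le hF _ h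
        _ = volume B * (2 ^ d * ∫⁻ x, F x) := by
            rw [setLIntegral_const, mul_comm]
        _ ≤ _ := by gcongr
    · rw [lintegral_prod _ hm.aemeasurable]
      calc _ ≤ ∫⁻ _ in A, 2 ^ d * ∫⁻ x, F x := by
            refine lintegral_mono fun x => ?_
            refine (setLIntegral_le_lintegral _ _).trans ?_
            have e : ∀ y : Space d, y + s • (x - y) = s • x + (1 - s) • y := fun y => by
              rw [smul_sub, sub_smul, one_smul]; abel
            simp only [e]
            exact lintegral_comp_add_smul_le hF _ (by linarith)
        _ = volume A * (2 ^ d * ∫⁻ x, F x) := by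
            rw [setLIntegral_const, mul_comm]
        _ ≤ _ := by gcongr
  calc _ ≤ ∫⁻ _ in Ioc (0 : ℝ) 1, m * (2 ^ d * ∫⁻ x, F x) :=
        setLIntegral_mono measurable_const key
    _ = _ := by rw [setLIntegral_const]; simp

/-- The fundamental theorem of calculus on a segment, squared. -/
theorem enorm_sub_sq_le_lintegral {u : Space d → ℝ} {u' : Space d → Space d →L[ℝ] ℝ}
    (hu : ∀ x, HasFDerivAt u (u' x) x) (hu' : Continuous u') (x y : Space d) :
    ‖u x - u y‖ₑ ^ 2 ≤ ‖x - y‖ₑ ^ 2 * ∫⁻ s in Ioc (0 : ℝ) 1, ‖u' (y + s • (x - y))‖ₑ ^ 2 := by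
  have hline : ∀ s : ℝ, HasDerivAt (fun s : ℝ => y + s • (x - y)) (x - y) s := fun s => by
    simpa using ((hasDerivAt_id s).smul_const (x - y)).const_add y
  have hd : ∀ s : ℝ, HasDerivAt (fun s : ℝ => u (y + s • (x - y)))
      (u' (y + s • (x - y)) (x - y)) s := fun s => (hu _).comp_hasDerivAt s (hline s)
  have hc : Continuous fun s : ℝ => u' (y + s • (x - y)) := hu'.comp (by fun_prop)
  have hc2 : Continuous fun s : ℝ => u' (y + s • (x - y)) (x - y) := hc.clm_apply continuous_const
  have h1 := intervalIntegral.integral_eq_sub_of_hasDerivAt (a := 0) (b := 1)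
    (fun s _ => hd s) (hc2.intervalIntegrable _ _)
  simp only [one_smul, zero_smul, add_zero, add_sub_cancel] at h1
  rw [← h1, intervalIntegral.integral_of_le zero_le_one]
  have hprob : IsProbabilityMeasure (volume.restrict (Ioc (0 : ℝ) 1)) := ⟨by simp⟩
  calc ‖∫ s in Ioc (0 : ℝ) 1, u' (y + s • (x - y)) (x - y)‖ₑ ^ 2
      ≤ (∫⁻ s in Ioc (0 : ℝ) 1, ‖x - y‖ₑ * ‖u' (y + s • (x - y))‖ₑ) ^ 2 := by
        gcongr
        refine (enorm_integral_le_lintegral_enorm _).trans (lintegral_mono fun s => ?_)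
        rw [mul_comm]
        exact ContinuousLinearMap.le_opENorm _ _
    _ ≤ ∫⁻ s in Ioc (0 : ℝ) 1, (‖x - y‖ₑ * ‖u' (y + s • (x - y))‖ₑ) ^ 2 :=
        sq_lintegral_le _ (hc.enorm.measurable.const_mul _).aemeasurable
    _ = _ := by
        simp only [mul_pow]
        rw [lintegral_const_mul _ (hc.enorm.measurable.pow_const 2)]

end Tools

/-! ### Poincaré inequality on star-shaped sets by mollification -/

section WeakGradient

open scoped Convolution

variable {d : ℕ}

/-- Functions on the whole space, one of which is a weak gradient of the other in `T`. -/
structure IsWeakGradientOn (T : Set (Space d)) (f : Space d → ℝ) (G : Space d → Space d) :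
    Prop where
  measurable_fun : Measurable f
  measurable_grad : Measurable G
  integrable_fun : Integrable f
  integral_eq : ∀ ψ : Space d → ℝ, IsTestFunction T ψ →
    ∫ x, f x • gradient ψ x = - ∫ x, ψ x • G x

/-- The convolution of a function with a smooth bump. -/
def mollify (η : ContDiffBump (0 : Space d)) (f : Space d → ℝ) : Space d → ℝ :=
  η.normed volume ⋆[ContinuousLinearMap.lsmul ℝ ℝ, volume] f

/-- The average of a nonnegative function, weighted by a smooth bump. -/
def smear (η : ContDiffBump (0 : Space d)) (F : Space d → ℝ≥0∞) (x : Space d) : ℝ≥0∞ :=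
  ∫⁻ t, ENNReal.ofReal (η.normed volume (x - t)) * F t

variable (η : ContDiffBump (0 : Space d))

theorem measurable_smear {F : Space d → ℝ≥0∞} (hF : Measurable F) : Measurable (smear η F) := by
  refine Measurable.lintegral_prod_right'
    (f := fun q : Space d × Space d => ENNReal.ofReal (η.normed volume (q.1 - q.2)) * F q.2) ?_
  refine Measurable.mul ?_ (hF.comp measurable_snd)
  exact (η.continuous_normed.comp (by fun_prop)).measurable.ennreal_ofReal

theorem lintegral_normed_sub (x : Space d) :
    ∫⁻ t, ENNReal.ofReal (η.normed volume (x - t)) = 1 := by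
  rw [lintegral_sub_left_eq_self (fun t => ENNReal.ofReal (η.normed volume t)) x,
    ← ofReal_integral_eq_lintegral_ofReal η.integrable_normed
      (Eventually.of_forall fun t => η.nonneg_normed t), η.integral_normed, ENNReal.ofReal_one]

theorem lintegral_smear {F : Space d → ℝ≥0∞} (hF : Measurable F) :
    ∫⁻ x, smear η F x = ∫⁻ x, F x := by
  unfold smear
  rw [lintegral_lintegral_swap]
  · refine lintegral_congr fun t => ?_
    have hc : Continuous fun x : Space d => η.normed volume (x - t) :=
      η.continuous_normed.comp (by fun_prop)
    rw [lintegral_mul_const _ hc.measurable.ennreal_ofReal,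
      lintegral_sub_right_eq_self (fun x => ENNReal.ofReal (η.normed volume x)) t,
      ← ofReal_integral_eq_lintegral_ofReal η.integrable_normed
        (Eventually.of_forall fun t => η.nonneg_normed t), η.integral_normed, ENNReal.ofReal_one,
      one_mul]
  · refine (Measurable.mul ?_ (hF.comp measurable_snd)).aemeasurable
    exact (η.continuous_normed.comp (by fun_prop)).measurable.ennreal_ofReal

theorem contDiff_mollify {f : Space d → ℝ} (hf : Integrable f) : ContDiff ℝ 1 (mollify η f) :=
  η.hasCompactSupport_normed.contDiff_convolution_left (n := 1) _ η.contDiff_normed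
    hf.locallyIntegrable

theorem isTestFunction_normed_sub {T : Set (Space d)} {x : Space d}
    (hx : Metric.closedBall x η.rOut ⊆ T) :
    IsTestFunction T fun t => η.normed volume (x - t) := by
  have hs : Function.support (fun t => η.normed volume (x - t)) ⊆ Metric.closedBall x η.rOut := by
    intro t ht
    have : x - t ∈ Function.support (η.normed volume) := ht
    rw [η.support_normed_eq, mem_ball_zero_iff] at this
    rw [Metric.mem_closedBall', dist_eq_norm]
    exact this.le
  have hts : tsupport (fun t => η.normed volume (x - t)) ⊆ Metric.closedBall x η.rOut :=
    closure_minimal hs Metric.isClosed_closedBall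
  refine ⟨η.contDiff_normed.comp (contDiff_const.sub contDiff_id), ?_, hts.trans hx⟩
  exact HasCompactSupport.of_support_subset_isCompact (isCompact_closedBall _ _) hs

theorem fderiv_comp_const_sub {k : Space d → ℝ} (hk : ContDiff ℝ 1 k) (x t : Space d) :
    fderiv ℝ (fun t => k (x - t)) t = - fderiv ℝ k (x - t) := by
  have h := ((hk.differentiable one_ne_zero (x - t)).hasFDerivAt).comp t
    ((hasFDerivAt_id t).const_sub x)
  simpa using! h.fderiv

theorem gradient_comp_const_sub {k : Space d → ℝ} (hk : ContDiff ℝ 1 k) (x t : Space d) :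
    gradient (fun t => k (x - t)) t = - gradient k (x - t) := by
  unfold gradient
  rw [fderiv_comp_const_sub hk, map_neg]

/-- The gradient of a mollified function is the mollified weak gradient. -/
theorem fderiv_mollify {T : Set (Space d)} {f : Space d → ℝ} {G : Space d → Space d}
    (h : IsWeakGradientOn T f G) {x : Space d} (hx : Metric.closedBall x η.rOut ⊆ T)
    (v : Space d) :
    fderiv ℝ (mollify η f) x v = ⟪∫ t, η.normed volume (x - t) • G t, v⟫ := by
  have hk : ContDiff ℝ 1 (η.normed (volume : Measure (Space d))) := η.contDiff_normed
  have hψ := isTestFunction_normed_sub η hx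
  -- The test function is the kernel t ↦ η(x − t), admissible because its support lies in the closed
  -- ball around x, hence in T.
  have h1 := h.integral_eq _ hψ
  simp only [gradient_comp_const_sub hk, smul_neg, integral_neg, neg_inj] at h1
  rw [← h1]
  have hd := η.hasCompactSupport_normed.hasFDerivAt_convolution_left
    (ContinuousLinearMap.lsmul ℝ ℝ) hk h.integrable_fun.locallyIntegrable x
  have hcs : Continuous fun t => gradient (η.normed (volume : Measure (Space d))) (x - t) :=
    ((InnerProductSpace.toDual ℝ (Space d)).symm.continuous.comp
      (hk.continuous_fderiv one_ne_zero)).comp (by fun_prop)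
  have hint : Integrable fun t => f t • gradient (η.normed (volume : Measure (Space d))) (x - t) := by
    have hg := hψ.1.continuous_fderiv (by simp)
    have hgs := hψ.2.1.fderiv ℝ
    obtain ⟨M, hM⟩ := hgs.exists_bound_of_continuous hg
    refine h.integrable_fun.smul_bdd M hcs.aestronglyMeasurable
      (Eventually.of_forall fun t => ?_)
    have := hM t
    rw [fderiv_comp_const_sub hk, norm_neg] at this
    unfold gradient
    rwa [LinearIsometryEquiv.norm_map]
  have hcv : ConvolutionExistsAt (fderiv ℝ (η.normed (volume : Measure (Space d)))) f x
      ((ContinuousLinearMap.lsmul ℝ ℝ).precompL (Space d)) volume :=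
    (η.hasCompactSupport_normed.fderiv ℝ).convolutionExists_left _
      (hk.continuous_fderiv one_ne_zero) h.integrable_fun.locallyIntegrable x
  unfold mollify
  rw [hd.fderiv, convolution_eq_swap, real_inner_comm, ← integral_inner hint]
  refine (ContinuousLinearMap.integral_apply hcv.integrable_swap v).trans ?_
  refine integral_congr_ae (Eventually.of_forall fun t => ?_)
  simp only [ContinuousLinearMap.precompL_apply, ContinuousLinearMap.lsmul_apply, smul_eq_mul]
  rw [inner_smul_right, real_inner_comm, gradient, InnerProductSpace.toDual_symm_apply, mul_comm]

/-- Jensen's inequality for the probability density η(x − ·). -/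
theorem enorm_fderiv_mollify_sq_le {T : Set (Space d)} {f : Space d → ℝ} {G : Space d → Space d}
    (h : IsWeakGradientOn T f G) {x : Space d} (hx : Metric.closedBall x η.rOut ⊆ T) :
    ‖fderiv ℝ (mollify η f) x‖ₑ ^ 2 ≤ smear η (fun t => ‖G t‖ₑ ^ 2) x := by
  have hm : Measurable fun t => ENNReal.ofReal (η.normed volume (x - t)) :=
    (η.continuous_normed.comp (by fun_prop)).measurable.ennreal_ofReal
  have h1 : ‖fderiv ℝ (mollify η f) x‖ ≤ ‖∫ t, η.normed volume (x - t) • G t‖ := by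
    refine ContinuousLinearMap.opNorm_le_bound _ (norm_nonneg _) fun v => ?_
    rw [fderiv_mollify η h hx]
    exact norm_inner_le_norm _ _
  have hprob : IsProbabilityMeasure
      (volume.withDensity fun t => ENNReal.ofReal (η.normed volume (x - t))) :=
    ⟨by rw [withDensity_apply _ MeasurableSet.univ, Measure.restrict_univ, lintegral_normed_sub]⟩
  calc ‖fderiv ℝ (mollify η f) x‖ₑ ^ 2
      ≤ (∫⁻ t, ‖G t‖ₑ ∂(volume.withDensity
          fun t => ENNReal.ofReal (η.normed volume (x - t)))) ^ 2 := by
        gcongr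
        refine (enorm_le_iff_norm_le.2 h1).trans ?_
        refine (enorm_integral_le_lintegral_enorm _).trans ?_
        rw [lintegral_withDensity_eq_lintegral_mul _ hm h.measurable_grad.enorm]
        refine lintegral_mono fun t => ?_
        rw [enorm_smul, Pi.mul_apply, Real.enorm_of_nonneg (η.nonneg_normed _)]
    _ ≤ ∫⁻ t, ‖G t‖ₑ ^ 2 ∂(volume.withDensity
          fun t => ENNReal.ofReal (η.normed volume (x - t))) :=
        sq_lintegral_le _ h.measurable_grad.enorm.aemeasurable
    _ = _ := by
        rw [lintegral_withDensity_eq_lintegral_mul _ hm (h.measurable_grad.enorm.pow_const 2)]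
        rfl

/-- A segment joining a point whose small neighbourhood lies in a star-shaped set to a point near
the centre has a small neighbourhood in the set. -/
theorem closedBall_segment_subset {T : Set (Space d)} {c : Space d} {ε s : ℝ} (hε : ε ≤ s / 2)
    (hstar : ∀ y ∈ Metric.ball c s, StarConvex ℝ y T) {x y : Space d}
    (hx : Metric.closedBall x ε ⊆ T) (hy : y ∈ Metric.ball c (s / 2)) {θ : ℝ} (h0 : 0 ≤ θ)
    (h1 : θ ≤ 1) : Metric.closedBall (y + θ • (x - y)) ε ⊆ T := by
  intro z hz
  set w := z - (y + θ • (x - y)) with hw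
  have hwn : ‖w‖ ≤ ε := by rwa [Metric.mem_closedBall, dist_eq_norm] at hz
  -- Translating the whole segment by w leaves y + w in the ball of star centres and x + w in T.
  have e : z = (1 - θ) • (y + w) + θ • (x + w) := by
    rw [hw]
    module
  rw [e]
  refine hstar (y + w) ?_ (hx ?_) (by linarith) h0 (by ring)
  · rw [Metric.mem_ball, dist_eq_norm] at hy ⊢
    calc ‖y + w - c‖ = ‖(y - c) + w‖ := by congr 1; abel
      _ ≤ ‖y - c‖ + ‖w‖ := norm_add_le _ _
      _ < s := by linarith
  · rw [Metric.mem_closedBall, dist_eq_norm]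
    simpa using hwn

theorem enorm_mollify_sub_sq_le {T : Set (Space d)} {f : Space d → ℝ} {G : Space d → Space d}
    (h : IsWeakGradientOn T f G) {c : Space d} {s R : ℝ} (hη : η.rOut ≤ s / 2)
    (hTR : T ⊆ Metric.closedBall c R) (hsT : Metric.ball c s ⊆ T)
    (hstar : ∀ y ∈ Metric.ball c s, StarConvex ℝ y T) {x y : Space d}
    (hx : Metric.closedBall x η.rOut ⊆ T) (hy : y ∈ Metric.ball c (s / 2)) :
    ‖mollify η f x - mollify η f y‖ₑ ^ 2 ≤ ENNReal.ofReal (2 * R) ^ 2 *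
      ∫⁻ θ in Ioc (0 : ℝ) 1, smear η (fun t => ‖G t‖ₑ ^ 2) (y + θ • (x - y)) := by
  have hC := contDiff_mollify η h.integrable_fun
  refine (enorm_sub_sq_le_lintegral (u := mollify η f) (u' := fderiv ℝ (mollify η f))
    (fun x => (hC.differentiable one_ne_zero x).hasFDerivAt)
    (hC.continuous_fderiv one_ne_zero) x y).trans ?_
  refine mul_le_mul' ?_ ?_
  · have hxT : x ∈ Metric.closedBall c R :=
      hTR (hx (Metric.mem_closedBall_self η.rOut_pos.le))
    have hs : 0 < s := by linarith [η.rOut_pos]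
    have hyT : y ∈ Metric.closedBall c R :=
      hTR (hsT (Metric.ball_subset_ball (by linarith) hy))
    gcongr
    rw [← ofReal_norm]
    apply ENNReal.ofReal_le_ofReal
    rw [Metric.mem_closedBall] at hxT hyT
    rw [← dist_eq_norm]
    linarith [dist_triangle_right x y c]
  · refine setLIntegral_mono' measurableSet_Ioc fun θ hθ => ?_
    exact enorm_fderiv_mollify_sq_le η h
      (closedBall_segment_subset hη hstar hx hy hθ.1.le hθ.2)

/-- The bumps that shrink to the origin. -/
def shrinkingBump {s : ℝ} (hs : 0 < s) (n : ℕ) : ContDiffBump (0 : Space d) where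
  -- The shift by 2 ensures rOut ≤ s/2 for every n; the fixed ratio rOut/rIn = 2 is what almost
  -- everywhere convergence requires.
  rIn := s / (n + 2) / 2
  rOut := s / (n + 2)
  rIn_pos := by positivity
  rIn_lt_rOut := half_lt_self (by positivity)

theorem tendsto_rOut_shrinkingBump {s : ℝ} (hs : 0 < s) :
    Tendsto (fun n => (shrinkingBump (d := d) hs n).rOut) atTop (𝓝 0) := by
  change Tendsto (fun n : ℕ => s / ((n : ℝ) + 2)) atTop (𝓝 0)
  exact tendsto_const_nhds.div_atTop
    (tendsto_atTop_add_const_right _ _ tendsto_natCast_atTop_atTop)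

theorem ae_tendsto_mollify {s : ℝ} (hs : 0 < s) {f : Space d → ℝ} (hf : Integrable f) :
    ∀ᵐ x, Tendsto (fun n => mollify (shrinkingBump hs n) f x) atTop (𝓝 (f x)) :=
  ContDiffBump.ae_convolution_tendsto_right_of_locallyIntegrable (K := 2)
    (tendsto_rOut_shrinkingBump hs)
    (Eventually.of_forall fun n => by
      change s / ((n : ℝ) + 2) ≤ 2 * (s / ((n : ℝ) + 2) / 2)
      linarith) hf.locallyIntegrable

/-- For mollified functions the difference is integrated along the segment joining the points, and
averaging over segments together with mass preservation of `smear` bounds the double integral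
uniformly. Fatou's lemma removes the mollification. -/
theorem lintegral_enorm_sub_sq_le {T : Set (Space d)} (hT : IsOpen T) {f : Space d → ℝ}
    {G : Space d → Space d} (h : IsWeakGradientOn T f G) {c : Space d} {s R : ℝ} (hs : 0 < s)
    (hTR : T ⊆ Metric.closedBall c R) (hsT : Metric.ball c s ⊆ T)
    (hstar : ∀ y ∈ Metric.ball c s, StarConvex ℝ y T) :
    ∫⁻ z : Space d × Space d, ‖f z.1 - f z.2‖ₑ ^ 2
        ∂((volume.restrict T).prod (volume.restrict (Metric.ball c (s / 2))))
      ≤ ENNReal.ofReal (2 * R) ^ 2 *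
        (volume (Metric.closedBall c R) * (2 ^ d * ∫⁻ x, ‖G x‖ₑ ^ 2)) := by
  set ν := (volume.restrict T).prod (volume.restrict (Metric.ball c (s / 2))) with hν
  have hG2 : Measurable fun t => ‖G t‖ₑ ^ 2 := h.measurable_grad.enorm.pow_const 2
  set I : ℕ → Space d × Space d → ℝ≥0∞ := fun n z => ENNReal.ofReal (2 * R) ^ 2 *
      ∫⁻ θ in Ioc (0 : ℝ) 1,
        smear (shrinkingBump hs n) (fun t => ‖G t‖ₑ ^ 2) (z.2 + θ • (z.1 - z.2)) with hI
  set J : ℕ → Space d × Space d → ℝ≥0∞ := fun n z =>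
      ‖mollify (shrinkingBump hs n) f z.1 - mollify (shrinkingBump hs n) f z.2‖ₑ ^ 2 with hJ
  have hIm : ∀ n, Measurable (I n) := fun n => by
    refine Measurable.const_mul ?_ _
    exact Measurable.lintegral_prod_right'
      (f := fun q : (Space d × Space d) × ℝ => smear (shrinkingBump hs n) (fun t => ‖G t‖ₑ ^ 2)
        (q.1.2 + q.2 • (q.1.1 - q.1.2)))
      ((measurable_smear _ hG2).comp (by fun_prop))
  have hJm : ∀ n, Measurable (J n) := fun n => by
    have hc := (contDiff_mollify (shrinkingBump hs n) h.integrable_fun).continuous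
    exact ((hc.comp continuous_fst).sub (hc.comp continuous_snd)).enorm.measurable.pow_const 2
  have hIint : ∀ n, ∫⁻ z, I n z ∂ν ≤ ENNReal.ofReal (2 * R) ^ 2 *
      (volume (Metric.closedBall c R) * (2 ^ d * ∫⁻ x, ‖G x‖ₑ ^ 2)) := fun n => by
    have hm : Measurable fun z : Space d × Space d => ∫⁻ θ in Ioc (0 : ℝ) 1,
        smear (shrinkingBump hs n) (fun t => ‖G t‖ₑ ^ 2) (z.2 + θ • (z.1 - z.2)) :=
      Measurable.lintegral_prod_right'
        (f := fun q : (Space d × Space d) × ℝ => smear (shrinkingBump hs n) (fun t => ‖G t‖ₑ ^ 2)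
          (q.1.2 + q.2 • (q.1.1 - q.1.2)))
        ((measurable_smear _ hG2).comp (by fun_prop))
    rw [hI, lintegral_const_mul _ hm]
    gcongr
    refine (lintegral_segments_le (measurable_smear _ hG2) (measure_mono hTR)
      (measure_mono ?_)).trans_eq ?_
    · exact ((Metric.ball_subset_ball (by linarith)).trans hsT).trans hTR
    · rw [lintegral_smear _ hG2]
  -- The estimate J n ≤ I n holds only for n large depending on the distance from z.1 to the
  -- complement of T. The minimum with I n has the same limit and is bounded by I n for all n, so
  -- Fatou's lemma applies with a uniform bound.
  have hae : ∀ᵐ z ∂ν, ‖f z.1 - f z.2‖ₑ ^ 2 ≤ liminf (fun n => min (J n z) (I n z)) atTop := by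
    have hc := ae_tendsto_mollify hs h.integrable_fun
    have h1 : ∀ᵐ x ∂(volume.restrict T), x ∈ T ∧
        Tendsto (fun n => mollify (shrinkingBump hs n) f x) atTop (𝓝 (f x)) :=
      (ae_restrict_mem hT.measurableSet).and (ae_restrict_of_ae hc)
    have h2 : ∀ᵐ x ∂(volume.restrict (Metric.ball c (s / 2))), x ∈ Metric.ball c (s / 2) ∧
        Tendsto (fun n => mollify (shrinkingBump hs n) f x) atTop (𝓝 (f x)) :=
      (ae_restrict_mem measurableSet_ball).and (ae_restrict_of_ae hc)
    filter_upwards [Measure.quasiMeasurePreserving_fst.ae h1,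
      Measure.quasiMeasurePreserving_snd.ae h2] with z hz1 hz2
    have hlim : Tendsto (fun n => J n z) atTop (𝓝 (‖f z.1 - f z.2‖ₑ ^ 2)) :=
      ENNReal.Tendsto.pow (hz1.2.sub hz2.2).enorm
    have hev : (fun n => J n z) =ᶠ[atTop] fun n => min (J n z) (I n z) := by
      obtain ⟨ε, hε, hεT⟩ := Metric.isOpen_iff.1 hT _ hz1.1
      filter_upwards [(tendsto_rOut_shrinkingBump (d := d) hs).eventually (gt_mem_nhds hε)]
        with n hn
      refine (min_eq_left ?_).symm
      refine enorm_mollify_sub_sq_le _ h ?_ hTR hsT hstar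
        ((Metric.closedBall_subset_ball hn).trans hεT) hz2.1
      change s / ((n : ℝ) + 2) ≤ s / 2
      gcongr
      linarith [(Nat.cast_nonneg n : (0 : ℝ) ≤ n)]
    exact (hlim.congr' hev).liminf_eq.ge
  calc _ ≤ ∫⁻ z, liminf (fun n => min (J n z) (I n z)) atTop ∂ν := lintegral_mono_ae hae
    _ ≤ liminf (fun n => ∫⁻ z, min (J n z) (I n z) ∂ν) atTop :=
        lintegral_liminf_le fun n => (hJm n).min (hIm n)
    _ ≤ liminf (fun _ : ℕ => ENNReal.ofReal (2 * R) ^ 2 *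
          (volume (Metric.closedBall c R) * (2 ^ d * ∫⁻ x, ‖G x‖ₑ ^ 2))) atTop :=
        liminf_le_liminf (Eventually.of_forall fun n =>
          (lintegral_mono fun z => min_le_right _ _).trans (hIint n))
    _ = _ := by simp

/-- The Poincaré inequality on a star-shaped open set. -/
theorem exists_lintegral_enorm_sub_const_le {T : Set (Space d)} (hT : IsOpen T) {f : Space d → ℝ}
    {G : Space d → Space d} (h : IsWeakGradientOn T f G) {c : Space d} {s R : ℝ} (hs : 0 < s)
    (hTR : T ⊆ Metric.closedBall c R) (hsT : Metric.ball c s ⊆ T)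
    (hstar : ∀ y ∈ Metric.ball c s, StarConvex ℝ y T) :
    ∃ m : ℝ, ∫⁻ x in T, ‖f x - m‖ₑ ^ 2 ≤ (ENNReal.ofReal (2 * R) ^ 2 *
        (volume (Metric.closedBall c R) * (2 ^ d * ∫⁻ x, ‖G x‖ₑ ^ 2)))
      / volume (Metric.ball c (s / 2)) := by
  have hmeas : Measurable fun z : Space d × Space d => ‖f z.1 - f z.2‖ₑ ^ 2 :=
    (((h.measurable_fun.comp measurable_fst).sub
      (h.measurable_fun.comp measurable_snd)).enorm).pow_const 2
  have h1 := lintegral_enorm_sub_sq_le hT h hs hTR hsT hstar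
  rw [lintegral_prod_symm _ hmeas.aemeasurable] at h1
  -- Some y in the small ball does no worse than the average over it; the constant is m = f y.
  obtain ⟨y, -, hy⟩ := exists_le_setLAverage (μ := (volume : Measure (Space d)))
    (s := Metric.ball c (s / 2))
    (f := fun y => ∫⁻ x in T, ‖f x - f y‖ₑ ^ 2)
    (Metric.measure_ball_pos volume c (by linarith)).ne' measure_ball_lt_top.ne
    (Measurable.lintegral_prod_left' hmeas).aemeasurable
  rw [setLAverage_eq] at hy
  exact ⟨f y, hy.trans (ENNReal.div_le_div_right h1 _)⟩

end WeakGradient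

/-! ### Approximation by piecewise constants and H¹ stability of π -/

section SobolevApproximation

variable {d : ℕ} {Ω : Set (Space d)}

theorem ofReal_setIntegral_norm_sq {E : Type*} [NormedAddCommGroup E] {T : Set (Space d)}
    {f : Space d → E} (hf : IntegrableOn (fun x => ‖f x‖ ^ 2) T) :
    ENNReal.ofReal (∫ x in T, ‖f x‖ ^ 2) = ∫⁻ x in T, ‖f x‖ₑ ^ 2 := by
  rw [ofReal_integral_eq_lintegral_ofReal hf (Eventually.of_forall fun x => by positivity)]
  refine lintegral_congr fun x => ?_
  rw [ENNReal.ofReal_pow (norm_nonneg _), ofReal_norm]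

theorem isWeakGradientOn_indicator (hΩb : Bornology.IsBounded Ω) (φ : H1 Ω) {T : Set (Space d)}
    (hT : IsOpen T) (hTΩ : T ⊆ Ω) :
    IsWeakGradientOn T (T.indicator (incl φ))
      (T.indicator (φ : WithLp 2 (L2 Ω × L2Vec Ω)).snd) := by
  have hfin : IsFiniteMeasure (volume.restrict Ω) := ⟨by simpa using hΩb.measure_lt_top⟩
  have hmT := hT.measurableSet
  refine ⟨(Lp.stronglyMeasurable _).measurable.indicator hmT,
    (Lp.stronglyMeasurable _).measurable.indicator hmT, ?_, fun ψ hψ => ?_⟩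
  · rw [integrable_indicator_iff hmT]
    exact IntegrableOn.mono_set ((Lp.memLp (incl φ)).integrable one_le_two) hTΩ
  have hg : ∀ x, x ∉ T → gradient ψ x = 0 := fun x hx => by
    have : fderiv ℝ ψ x = 0 :=
      image_eq_zero_of_notMem_tsupport fun h => hx (hψ.2.2 (tsupport_fderiv_subset ℝ h))
    rw [gradient, this, map_zero]
  have hz : ∀ x, x ∉ T → ψ x = 0 := fun x hx =>
    image_eq_zero_of_notMem_tsupport fun h => hx (hψ.2.2 h)
  have e1 : ∀ x, T.indicator (incl φ) x • gradient ψ x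
      = T.indicator (fun x => incl φ x • gradient ψ x) x := fun x => by
    by_cases hx : x ∈ T <;> simp [hx]
  have e2 : ∀ x, ψ x • T.indicator (φ : WithLp 2 (L2 Ω × L2Vec Ω)).snd x
      = T.indicator (fun x => ψ x • (φ : WithLp 2 (L2 Ω × L2Vec Ω)).snd x) x := fun x => by
    by_cases hx : x ∈ T <;> simp [hx]
  simp only [e1, e2]
  have e3 : ∀ x, incl φ x • gradient ψ x = T.indicator (fun x => incl φ x • gradient ψ x) x :=
    fun x => by by_cases hx : x ∈ T <;> simp [hx, hg]
  have e4 : ∀ x, ψ x • (φ : WithLp 2 (L2 Ω × L2Vec Ω)).snd x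
      = T.indicator (fun x => ψ x • (φ : WithLp 2 (L2 Ω × L2Vec Ω)).snd x) x :=
    fun x => by by_cases hx : x ∈ T <;> simp [hx, hz]
  have h : ∫ x in Ω, incl φ x • gradient ψ x
      = - ∫ x in Ω, ψ x • (φ : WithLp 2 (L2 Ω × L2Vec Ω)).snd x :=
    φ.2 ψ ⟨hψ.1, hψ.2.1, hψ.2.2.trans hTΩ⟩
  rw [funext e3, funext e4, setIntegral_indicator hmT, setIntegral_indicator hmT,
    inter_eq_self_of_subset_right hTΩ] at h
  rwa [integral_indicator hmT, integral_indicator hmT]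

theorem exists_setIntegral_sub_const_le (hΩb : Bornology.IsBounded Ω) (φ : H1 Ω)
    {T : Set (Space d)} (hT : IsOpen T) (hTΩ : T ⊆ Ω) {c : Space d} {σ h : ℝ} (hσ : 0 < σ)
    (hh : 0 < h) (hcT : Metric.ball c (σ * h) ⊆ T) (hTc : T ⊆ Metric.closedBall c h)
    (hstar : ∀ y ∈ Metric.ball c (σ * h), StarConvex ℝ y T) :
    ∃ m : ℝ, ∫ x in T, ‖incl φ x - m‖ ^ 2 ≤ 4 * 2 ^ d * (2 / σ) ^ d * h ^ 2 *
      ∫ x in T, ‖(φ : WithLp 2 (L2 Ω × L2Vec Ω)).snd x‖ ^ 2 := by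
  have hfin : IsFiniteMeasure (volume.restrict Ω) := ⟨by simpa using hΩb.measure_lt_top⟩
  set G := (φ : WithLp 2 (L2 Ω × L2Vec Ω)).snd with hG
  obtain ⟨m, hm⟩ := exists_lintegral_enorm_sub_const_le hT
    (isWeakGradientOn_indicator hΩb φ hT hTΩ) (by positivity : 0 < σ * h) hTc hcT hstar
  refine ⟨m, ?_⟩
  have i1 : IntegrableOn (fun x => ‖incl φ x - m‖ ^ 2) T :=
    IntegrableOn.mono_set (((Lp.memLp (incl φ)).sub (memLp_const m)).integrable_norm_pow
      two_ne_zero) hTΩ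
  have i2 : IntegrableOn (fun x => ‖G x‖ ^ 2) T :=
    IntegrableOn.mono_set (integrable_norm_sq G) hTΩ
  have hu := unitVolume_pos (d := d)
  have e1 : ∫⁻ x in T, ‖T.indicator (incl φ) x - m‖ₑ ^ 2
      = ENNReal.ofReal (∫ x in T, ‖incl φ x - m‖ ^ 2) := by
    rw [ofReal_setIntegral_norm_sq i1]
    exact setLIntegral_congr_fun hT.measurableSet fun x hx => by simp [hx]
  have e2 : ∫⁻ x, ‖T.indicator G x‖ₑ ^ 2 = ENNReal.ofReal (∫ x in T, ‖G x‖ ^ 2) := by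
    rw [ofReal_setIntegral_norm_sq i2, ← lintegral_indicator hT.measurableSet]
    refine lintegral_congr fun x => ?_
    by_cases hx : x ∈ T <;> simp [hx]
  have hB : 0 ≤ ∫ x in T, ‖G x‖ ^ 2 := integral_nonneg fun _ => by positivity
  have v1 : volume (Metric.closedBall c h) = ENNReal.ofReal (h ^ d * unitVolume d) := by
    rw [← volume_real_closedBall c hh, Measure.real,
      ENNReal.ofReal_toReal measure_closedBall_lt_top.ne]
  have v2 : volume (Metric.ball c (σ * h / 2))
      = ENNReal.ofReal ((σ * h / 2) ^ d * unitVolume d) := by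
    rw [← volume_real_ball c (by positivity), Measure.real,
      ENNReal.ofReal_toReal measure_ball_lt_top.ne]
  have p2 : (2 : ℝ≥0∞) ^ d = ENNReal.ofReal (2 ^ d) := by
    rw [ENNReal.ofReal_pow zero_le_two]; simp
  rw [e1, e2, v1, v2, p2, ← ENNReal.ofReal_pow (by positivity), ← ENNReal.ofReal_mul (by positivity),
    ← ENNReal.ofReal_mul (by positivity), ← ENNReal.ofReal_mul (by positivity),
    ← ENNReal.ofReal_div_of_pos (by positivity),
    ENNReal.ofReal_le_ofReal_iff (by positivity)] at hm
  refine hm.trans_eq ?_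
  -- The factor (2/σ)^d is the ratio of the volumes of the balls of radii h and σh/2; 4h² is the
  -- squared diameter (2h)² of the large ball.
  have e : (2 / σ) ^ d * (σ * h / 2) ^ d = h ^ d := by
    rw [← mul_pow]
    congr 1
    field_simp
  rw [div_eq_iff (by positivity), ← e]
  ring

namespace Triangulation

variable {𝒯 : Triangulation Ω} {r : ℕ}

theorem norm_H1_sq (φ : H1 Ω) :
    ‖φ‖ ^ 2 = ‖incl φ‖ ^ 2 + ‖(φ : WithLp 2 (L2 Ω × L2Vec Ω)).snd‖ ^ 2 := by
  rw [Submodule.coe_norm, WithLp.prod_norm_sq_eq_of_L2]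
  rfl

/-- Functions in `H¹` are approximated to first order by piecewise constants. -/
theorem exists_norm_sub_piecewiseConst_le (hd : 2 ≤ d) (hΩb : Bornology.IsBounded Ω) (r : ℕ)
    {σ : ℝ} (hσ : 0 < σ) (hq : 𝒯.IsQuasiUniform σ) (φ : H1 Ω) :
    ∃ a : 𝒯.elements → ℝ, ‖incl φ - (piecewiseConst (r := r) a : L2 Ω)‖ ^ 2
      ≤ 4 * 2 ^ d * (2 / σ) ^ d * 𝒯.meshSize ^ 2 * ‖φ‖ ^ 2 := by
  have hfin : IsFiniteMeasure (volume.restrict Ω) := ⟨by simpa using hΩb.measure_lt_top⟩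
  set G := (φ : WithLp 2 (L2 Ω × L2Vec Ω)).snd with hG
  have key : ∀ T : 𝒯.elements, ∃ m : ℝ, ∫ x in (T : Set (Space d)), ‖incl φ x - m‖ ^ 2 ≤
      4 * 2 ^ d * (2 / σ) ^ d * 𝒯.meshSize ^ 2 * ∫ x in (T : Set (Space d)), ‖G x‖ ^ 2 := by
    intro T
    obtain ⟨c, hc1, hc2, hc3⟩ := exists_center hd hΩb hσ hq T.2
    exact exists_setIntegral_sub_const_le hΩb φ (𝒯.isOpen _ T.2) (𝒯.subset _ T.2) hσ
      (meshSize_pos hd hΩb T.2).1 hc1 hc2 hc3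
  choose a ha using key
  refine ⟨a, ?_⟩
  set v : 𝒯.femSpace r := piecewiseConst a with hv
  have h1 : ‖incl φ - (v : L2 Ω)‖ ^ 2
      = ∑ T : 𝒯.elements, ∫ x in (T : Set (Space d)), ‖incl φ x - a T‖ ^ 2 := by
    rw [norm_sq_eq_integral, setIntegral_eq_sum_of_integrableOn
      fun T => IntegrableOn.mono_set (integrable_norm_sq _) (𝒯.subset _ T.2)]
    refine Finset.sum_congr rfl fun T _ => integral_congr_ae ?_
    filter_upwards [ae_restrict_of_ae_restrict_of_subset (𝒯.subset _ T.2)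
        (Lp.coeFn_sub (incl φ) (v : L2 Ω)),
      ae_restrict_of_ae_restrict_of_subset (𝒯.subset _ T.2) (coeFn_femSpace v),
      ae_restrict_mem (𝒯.isOpen _ T.2).measurableSet] with x hx1 hx2 hx3
    rw [hx1, Pi.sub_apply, hx2, polyFun_of_mem _ T hx3, hv, family_piecewiseConst,
      MvPolynomial.eval_C]
  have h2 : ‖G‖ ^ 2 = ∑ T : 𝒯.elements, ∫ x in (T : Set (Space d)), ‖G x‖ ^ 2 := by
    rw [norm_sq_eq_integral, setIntegral_eq_sum_of_integrableOn
      fun T => IntegrableOn.mono_set (integrable_norm_sq _) (𝒯.subset _ T.2)]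
  have h3 : ‖G‖ ^ 2 ≤ ‖φ‖ ^ 2 := by
    rw [norm_H1_sq]
    exact le_add_of_nonneg_left (sq_nonneg _)
  calc _ = _ := h1
    _ ≤ 4 * 2 ^ d * (2 / σ) ^ d * 𝒯.meshSize ^ 2 * ‖G‖ ^ 2 := by
        rw [h2, Finset.mul_sum]
        exact Finset.sum_le_sum fun T _ => ha T
    _ ≤ _ := by gcongr

theorem norm_proj_le (u : L2 Ω) : ‖𝒯.proj r u‖ ≤ ‖u‖ :=
  Submodule.norm_orthogonalProjectionOnto_apply_le _ _

/-- The `L²`-projection is stable in `H¹`. -/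
theorem exists_norm_gradL2_proj_le (hd : 2 ≤ d) (hΩb : Bornology.IsBounded Ω) (r : ℕ) {σ : ℝ}
    (hσ : 0 < σ) : ∃ C : ℝ, 0 < C ∧ ∀ 𝒯 : Triangulation Ω, 𝒯.IsQuasiUniform σ →
      ∀ φ : H1 Ω, ‖𝒯.gradL2 r (𝒯.proj r (incl φ))‖ ^ 2 ≤ C * ‖φ‖ ^ 2 := by
  obtain ⟨C, hC, hinv⟩ := exists_inverse_le_femSpace hd hΩb r hσ
  refine ⟨C * (4 * 2 ^ d * (2 / σ) ^ d), by positivity, fun 𝒯 hq φ => ?_⟩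
  -- Without elements the mesh size is the default value 0 and could not be cancelled below; the
  -- discrete gradient is then zero.
  rcases isEmpty_or_nonempty 𝒯.elements with hE | ⟨⟨T, hT⟩⟩
  · rw [norm_sq_gradL2, Finset.univ_eq_empty, Finset.sum_empty]
    positivity
  have hh := (meshSize_pos hd hΩb hT).1
  obtain ⟨a, ha⟩ := exists_norm_sub_piecewiseConst_le hd hΩb r hσ hq φ
  set v : 𝒯.femSpace r := piecewiseConst a with hv
  -- π fixes the piecewise constant v and ∇v = 0, so only π(φ − v) contributes. The inverse
  -- inequality costs 1/h, and φ − v is of order h.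
  have h1 : 𝒯.gradL2 r (𝒯.proj r (incl φ))
      = 𝒯.gradL2 r (𝒯.proj r (incl φ - (v : L2 Ω))) := by
    have e : 𝒯.proj r (incl φ - (v : L2 Ω)) = 𝒯.proj r (incl φ) - v := by
      unfold proj
      rw [map_sub, Submodule.orthogonalProjectionOnto_mem_subspace_eq_self]
    rw [e, map_sub, hv, gradL2_piecewiseConst, sub_zero]
  have h2 := hinv 𝒯 hq (𝒯.proj r (incl φ - (v : L2 Ω)))
  rw [← h1] at h2
  have h3 : ‖𝒯.proj r (incl φ - (v : L2 Ω))‖ ^ 2 ≤ ‖incl φ - (v : L2 Ω)‖ ^ 2 := by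
    gcongr
    exact norm_proj_le _
  have h4 : 𝒯.meshSize ^ 2 * ‖𝒯.gradL2 r (𝒯.proj r (incl φ))‖ ^ 2
      ≤ 𝒯.meshSize ^ 2 * (C * (4 * 2 ^ d * (2 / σ) ^ d) * ‖φ‖ ^ 2) :=
    calc _ ≤ C * (4 * 2 ^ d * (2 / σ) ^ d * 𝒯.meshSize ^ 2 * ‖φ‖ ^ 2) :=
          h2.trans (mul_le_mul_of_nonneg_left (h3.trans ha) hC.le)
      _ = _ := by ring
  exact le_of_mul_le_mul_left h4 (by positivity)

end Triangulation

end SobolevApproximation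

/-! ### From eventual bounds to upper limits -/

section LimitSuperior

variable {p S P Q : ℝ → ℝ}

theorem eventually_le_limsup_add_one {u : ℝ → ℝ}
    (h : limsup (fun t => ENNReal.ofReal (u t)) atTop ≠ ⊤) :
    ∀ᶠ t in atTop, u t ≤ (limsup (fun t => ENNReal.ofReal (u t)) atTop).toReal + 1 := by
  set l := limsup (fun t => ENNReal.ofReal (u t)) atTop with hl
  have h1 : l < ENNReal.ofReal (l.toReal + 1) := by
    rw [ENNReal.ofReal_add ENNReal.toReal_nonneg zero_le_one, ENNReal.ofReal_toReal h,
      ENNReal.ofReal_one]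
    exact ENNReal.lt_add_right h one_ne_zero
  filter_upwards [eventually_lt_of_limsup_lt h1] with t ht
  exact (ENNReal.ofReal_lt_ofReal_iff'.1 ht).1.le

/-- An eventual bound by any eventual bounds of the data yields a bound of upper limits. -/
theorem limsup_ofReal_le {e C : ℝ} (hC : 0 < C) (he : 0 < e) (he2 : e ≤ 2)
    (h : ∀ {L LP LQ : ℝ}, 0 ≤ L → 0 ≤ LP → 0 ≤ LQ → (∀ᶠ t in atTop, S t ≤ L) →
      (∀ᶠ t in atTop, P t ≤ LP) → (∀ᶠ t in atTop, Q t ≤ LQ) →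
      ∀ᶠ t in atTop, p t ≤ C * (1 + L ^ e + LP + LQ)) :
    limsup (fun t => ENNReal.ofReal (p t)) atTop ≤ ENNReal.ofReal (7 * C) *
      (1 + limsup (fun t => ENNReal.ofReal (S t)) atTop ^ e
        + limsup (fun t => ENNReal.ofReal (P t)) atTop
        + limsup (fun t => ENNReal.ofReal (Q t)) atTop) := by
  have htop : ENNReal.ofReal (7 * C) * ⊤ = ⊤ := ENNReal.mul_top <| by
    rw [Ne, ENNReal.ofReal_eq_zero, not_le]
    positivity
  -- If one of the upper limits is infinite, so is the right-hand side.
  by_cases hS : limsup (fun t => ENNReal.ofReal (S t)) atTop = ⊤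
  · rw [hS, ENNReal.top_rpow_of_pos he, add_top, top_add, top_add, htop]
    exact le_top
  by_cases hP : limsup (fun t => ENNReal.ofReal (P t)) atTop = ⊤
  · rw [hP, add_top, top_add, htop]
    exact le_top
  by_cases hQ : limsup (fun t => ENNReal.ofReal (Q t)) atTop = ⊤
  · rw [hQ, add_top, htop]
    exact le_top
  have hS1 := eventually_le_limsup_add_one hS
  have hP1 := eventually_le_limsup_add_one hP
  have hQ1 := eventually_le_limsup_add_one hQ
  set lS := limsup (fun t => ENNReal.ofReal (S t)) atTop with hlS
  set lP := limsup (fun t => ENNReal.ofReal (P t)) atTop with hlP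
  set lQ := limsup (fun t => ENNReal.ofReal (Q t)) atTop with hlQ
  have nS : 0 ≤ lS.toReal := ENNReal.toReal_nonneg
  have nP : 0 ≤ lP.toReal := ENNReal.toReal_nonneg
  have nQ : 0 ≤ lQ.toReal := ENNReal.toReal_nonneg
  have hev := h (by positivity) (by positivity) (by positivity) hS1 hP1 hQ1
  have hpow := add_rpow_le_four_mul nS zero_le_one he.le he2
  rw [Real.one_rpow] at hpow
  have n1 := Real.rpow_nonneg nS e
  have e1 : 1 + lS ^ e + lP + lQ
      = ENNReal.ofReal (1 + lS.toReal ^ e + lP.toReal + lQ.toReal) := by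
    rw [ENNReal.ofReal_add (by positivity) nQ, ENNReal.ofReal_add (by positivity) nP,
      ENNReal.ofReal_add zero_le_one n1, ENNReal.ofReal_toReal hP, ENNReal.ofReal_toReal hQ,
      ENNReal.ofReal_one, ← ENNReal.ofReal_rpow_of_nonneg nS he.le, ENNReal.ofReal_toReal hS]
  rw [e1, ← ENNReal.ofReal_mul (by positivity)]
  refine limsup_le_of_le (h := ?_)
  filter_upwards [hev] with t ht
  apply ENNReal.ofReal_le_ofReal
  refine ht.trans ?_
  -- The eventual bounds overshoot the upper limits by 1; the constants sum to 1 + 4 + 1 + 1 = 7,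
  -- where 4 comes from (l + 1)^e ≤ 4(l^e + 1).
  rw [mul_comm 7 C, mul_assoc]
  refine mul_le_mul_of_nonneg_left ?_ hC.le
  linarith

end LimitSuperior

/-! ### The semidiscrete problem as a gradient flow -/

section SemidiscreteProblem

variable {d : ℕ} {Ω : Set (Space d)}

/-- The inclusion `H¹(Ω) → L²(Ω)` as a continuous linear map. -/
def inclL : H1 Ω →L[ℝ] L2 Ω := (WithLp.fstL 2 ℝ (L2 Ω) (L2Vec Ω)).comp (H1 Ω).subtypeL

variable {𝒯 : Triangulation Ω} {r : ℕ} {g : Law} {D : Data Ω} {ρtil : ℝ → 𝒯.femSpace r}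

namespace Data

variable (D)

theorem continuousOn_φ : ContinuousOn D.φ (Ici 0) :=
  fun t ht => (D.hasDeriv_φ t ht).continuousWithinAt

theorem continuousOn_ftil : ContinuousOn D.ftil (Ici 0) :=
  fun t ht => (D.hasDeriv_ftil t ht).continuousWithinAt

theorem size_nonneg (g : Law) (t : ℝ) : 0 ≤ D.size g t :=
  add_nonneg (Real.rpow_nonneg (norm_nonneg _) _) (sq_nonneg _)

theorem norm_ρtil₀_sq_le : ‖D.ρtil₀‖ ^ 2 ≤ 2 * (‖D.ρ₀‖ ^ 2 + ‖incl (D.φ 0)‖ ^ 2) := by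
  have h1 : ‖D.ρtil₀‖ ≤ ‖incl D.ρ₀‖ + ‖incl (D.φ 0)‖ := norm_sub_le _ _
  have h2 : ‖incl D.ρ₀‖ ^ 2 ≤ ‖D.ρ₀‖ ^ 2 := by
    rw [Triangulation.norm_H1_sq]
    exact le_add_of_nonneg_right (sq_nonneg _)
  nlinarith [sq_nonneg (‖incl D.ρ₀‖ - ‖incl (D.φ 0)‖), norm_nonneg D.ρtil₀]

end Data

namespace IsSemidiscreteSolution

/-- The weak equation holds against every w in W_h and both sides lie in W_h, so it is an ordinary
differential equation there. -/
theorem deriv_eq (h : IsSemidiscreteSolution g 𝒯 r D ρtil) {t : ℝ} (ht : 0 < t) :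
    deriv ρtil t = 𝒯.proj r (D.ftil t)
      - diffusion g (𝒯.gradL2 r) (ρtil t + 𝒯.proj r (incl (D.φ t))) := by
  refine ext_inner_right ℝ fun w => ?_
  have h1 := h.equation t ht w
  set u := ρtil t + 𝒯.proj r (incl (D.φ t)) with hu
  rw [inner_sub_left, inner_diffusion, Law.inner_fluxLp, Triangulation.proj,
    Submodule.inner_orthogonalProjectionOnto_eq_of_mem_right, ← h1]
  have h2 : ∫ x in Ω, ⟪g.flux (𝒯.gradL2 r u x), 𝒯.gradL2 r w x⟫
      = ∫ x in Ω, ⟪g.K ‖Triangulation.grad u x‖ • Triangulation.grad u x,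
          Triangulation.grad w x⟫ := by
    refine integral_congr_ae ?_
    filter_upwards [Triangulation.coeFn_gradL2 u, Triangulation.coeFn_gradL2 w] with x hx1 hx2
    rw [hx1, hx2]
    rfl
  rw [h2]
  ring

theorem isFlow (h : IsSemidiscreteSolution g 𝒯 r D ρtil) {Cg : ℝ}
    (hCg : ∀ φ : H1 Ω, ‖𝒯.gradL2 r (𝒯.proj r (incl φ))‖ ^ 2 ≤ Cg * ‖φ‖ ^ 2) :
    IsFlow g (𝒯.gradL2 r) Cg ρtil (fun t => 𝒯.proj r (incl (D.φ t)))
      (fun t => 𝒯.proj r (incl (D.φt t))) (fun t => 𝒯.proj r (D.ftil t))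
      (fun t => 𝒯.proj r (D.ftilt t)) (fun t => ‖D.ftil t‖) (fun t => ‖D.φ t‖ ^ 2)
      (fun t => ‖D.φt t‖ ^ 2) (fun t => ‖D.ftilt t‖ ^ 2) where
  continuousOn_ρ := h.continuousOn
  continuousOn_ψ := ((𝒯.femSpace r).orthogonalProjectionOnto.comp
    (inclL (Ω := Ω))).continuous.comp_continuousOn D.continuousOn_φ
  continuousOn_f :=
    (𝒯.femSpace r).orthogonalProjectionOnto.continuous.comp_continuousOn D.continuousOn_ftil
  hasDerivAt_ρ t ht := by
    rw [← h.deriv_eq ht]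
    exact (h.differentiableAt t ht).hasDerivAt
  hasDerivAt_ψ t ht := ((𝒯.femSpace r).orthogonalProjectionOnto.comp
    (inclL (Ω := Ω))).hasFDerivAt.comp_hasDerivAt t
      ((D.hasDeriv_φ t ht.le).hasDerivAt (Ici_mem_nhds ht))
  hasDerivAt_f t ht := (𝒯.femSpace r).orthogonalProjectionOnto.hasFDerivAt.comp_hasDerivAt t
    ((D.hasDeriv_ftil t ht.le).hasDerivAt (Ici_mem_nhds ht))
  norm_f_le t := Triangulation.norm_proj_le _
  norm_ft_sq_le t := by
    gcongr
    exact Triangulation.norm_proj_le _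
  norm_grad_ψ_sq_le t := hCg _
  norm_grad_ψt_sq_le t := hCg _

theorem norm_oscillation_zero_sq_le (h : IsSemidiscreteSolution g 𝒯 r D ρtil) :
    ‖oscillation (𝒯.gradL2 r) (ρtil 0)‖ ^ 2 ≤ ‖D.ρtil₀‖ ^ 2 := by
  have h1 := IsFlow.norm_oscillation_le (grad := 𝒯.gradL2 r) (ρtil 0) 0 (map_zero _)
  rw [sub_zero, h.initial] at h1
  rw [h.initial]
  gcongr
  exact h1.trans (Triangulation.norm_proj_le _)

/-- At time 0 the boundary extension cancels: ρ_h(0) = πρ⁰. Only ‖ρ⁰‖₁ is therefore needed, through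
H¹ stability of π. -/
theorem energy_zero_le (h : IsSemidiscreteSolution g 𝒯 r D ρtil) {Cg : ℝ}
    (hCg : ∀ φ : H1 Ω, ‖𝒯.gradL2 r (𝒯.proj r (incl φ))‖ ^ 2 ≤ Cg * ‖φ‖ ^ 2) :
    g.energy (𝒯.gradL2 r (ρtil 0 + 𝒯.proj r (incl (D.φ 0))))
      ≤ 1 / g.coeff 0 * Cg * ‖D.ρ₀‖ ^ 2 := by
  have e : ρtil 0 + 𝒯.proj r (incl (D.φ 0)) = 𝒯.proj r (incl D.ρ₀) := by
    rw [h.initial, Data.ρtil₀]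
    unfold Triangulation.proj
    rw [map_sub, sub_add_cancel]
  rw [e, mul_assoc]
  have ha := g.coeff_zero_pos
  exact (g.energy_le _).trans ((g.inner_fluxLp_self_le _).trans
    (mul_le_mul_of_nonneg_left (hCg _) (by positivity)))

end IsSemidiscreteSolution

theorem Data.IsEnvelope.rpow_nonneg {D : Data Ω} {g : Law} {G : ℝ → ℝ} (hG : D.IsEnvelope g G)
    (e : ℝ) {s : ℝ} (hs : 0 ≤ s) : 0 ≤ G s ^ e :=
  Real.rpow_nonneg ((D.size_nonneg g s).trans (hG.2.2 s hs)) _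

theorem Data.initial_integral_nonneg (D : Data Ω) (g : Law) {G : ℝ → ℝ} (hG : D.IsEnvelope g G)
    {t₀ : ℝ} (ht₀ : 0 ≤ t₀) : 0 ≤ ∫ s in (0 : ℝ)..t₀, (‖D.φt s‖ ^ 2 + G s ^ (2 / g.β)) :=
  intervalIntegral.integral_nonneg ht₀ fun _ hs =>
    add_nonneg (sq_nonneg _) (hG.rpow_nonneg _ hs.1)

theorem Data.weighted_integral_nonneg (D : Data Ω) (g : Law) {G : ℝ → ℝ} (hG : D.IsEnvelope g G)
    {t : ℝ} (ht : 0 ≤ t) : 0 ≤ ∫ s in (0 : ℝ)..t, Real.exp (-(1 / 4) * (t - s)) *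
      (1 + ‖D.ρtil₀‖ ^ 2 + ‖D.φt s‖ ^ 2 + ‖D.ftilt s‖ ^ 2 + G s ^ (2 / g.β)) :=
  intervalIntegral.integral_nonneg ht fun s hs => by
    have := hG.rpow_nonneg (2 / g.β) hs.1
    positivity

theorem Data.weighted_integral_mono (D : Data Ω) (g : Law) {G : ℝ → ℝ} (hG : D.IsEnvelope g G)
    {y z t : ℝ} (hyz : y ≤ z) (ht : 0 ≤ t) :
    ∫ s in (0 : ℝ)..t, Real.exp (-(1 / 4) * (t - s)) *
        (1 + y + ‖D.φt s‖ ^ 2 + ‖D.ftilt s‖ ^ 2 + G s ^ (2 / g.β))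
      ≤ ∫ s in (0 : ℝ)..t, Real.exp (-(1 / 4) * (t - s)) *
        (1 + z + ‖D.φt s‖ ^ 2 + ‖D.ftilt s‖ ^ 2 + G s ^ (2 / g.β)) := by
  have hP : ContinuousOn (fun s => ‖D.φt s‖ ^ 2) (Ici 0) := D.continuousOn_φt.norm.pow 2
  have hQ : ContinuousOn (fun s => ‖D.ftilt s‖ ^ 2) (Ici 0) := D.continuousOn_ftilt.norm.pow 2
  have hGe : ContinuousOn (fun s => G s ^ (2 / g.β)) (Ici 0) :=
    hG.1.rpow_const fun _ _ => Or.inr (div_nonneg zero_le_two g.β_pos.le)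
  have hint : ∀ z : ℝ, IntervalIntegrable (fun s => Real.exp (-(1 / 4) * (t - s)) *
      (1 + z + ‖D.φt s‖ ^ 2 + ‖D.ftilt s‖ ^ 2 + G s ^ (2 / g.β))) volume 0 t := fun z =>
    intervalIntegrable_of_continuousOn_Ici ((Continuous.continuousOn (by fun_prop)).mul
      (((continuousOn_const.add hP).add hQ).add hGe)) le_rfl ht
  exact intervalIntegral.integral_mono_on ht (hint _) (hint _) fun s _ =>
    mul_le_mul_of_nonneg_left (by linarith) (Real.exp_pos _).le

/-- The bound `𝓑` dominates a bound in terms of the initial values of the discrete solution. -/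
theorem Data.le_mul_bound (D : Data Ω) (g : Law) {G : ℝ → ℝ} (hG : D.IsEnvelope g G)
    {y H M t₀ t : ℝ} (hM : 0 ≤ M) (hy : y ≤ ‖D.ρtil₀‖ ^ 2) (hH : H ≤ M * ‖D.ρ₀‖ ^ 2)
    (ht₀ : 0 < t₀) (ht : t₀ ≤ t) :
    t₀⁻¹ * Real.exp (-(1 / 4) * (t - t₀)) *
        (1 + y + H + ∫ s in (0 : ℝ)..t₀, (‖D.φt s‖ ^ 2 + G s ^ (2 / g.β)))
      + ∫ s in (0 : ℝ)..t, Real.exp (-(1 / 4) * (t - s)) *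
        (1 + y + ‖D.φt s‖ ^ 2 + ‖D.ftilt s‖ ^ 2 + G s ^ (2 / g.β))
      ≤ (2 + M) * D.bound g G t₀ t := by
  have h1 := D.initial_integral_nonneg g hG ht₀.le
  have h2 := D.weighted_integral_mono g hG hy (ht₀.le.trans ht)
  have h3 := D.weighted_integral_nonneg g hG (ht₀.le.trans ht)
  have h4 := D.norm_ρtil₀_sq_le
  unfold Data.bound
  set I := ∫ s in (0 : ℝ)..t₀, (‖D.φt s‖ ^ 2 + G s ^ (2 / g.β)) with hI
  set J := ∫ s in (0 : ℝ)..t, Real.exp (-(1 / 4) * (t - s)) *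
        (1 + ‖D.ρtil₀‖ ^ 2 + ‖D.φt s‖ ^ 2 + ‖D.ftilt s‖ ^ 2 + G s ^ (2 / g.β)) with hJ
  clear_value I J
  -- The 2 stems from ‖ρ̃⁰‖² ≤ 2(‖ρ⁰‖₁² + ‖φ⁰‖²), the M from the initial energy.
  have h5 : 1 + y + H + I ≤ (2 + M) * (1 + ‖D.ρ₀‖ ^ 2 + ‖incl (D.φ 0)‖ ^ 2 + I) := by
    have e : (2 + M) * (1 + ‖D.ρ₀‖ ^ 2 + ‖incl (D.φ 0)‖ ^ 2 + I)
        = 1 + 2 * (‖D.ρ₀‖ ^ 2 + ‖incl (D.φ 0)‖ ^ 2) + M * ‖D.ρ₀‖ ^ 2 + I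
          + (1 + I + M * (1 + ‖incl (D.φ 0)‖ ^ 2 + I)) := by ring
    have n : 0 ≤ M * (1 + ‖incl (D.φ 0)‖ ^ 2 + I) := by positivity
    rw [e]
    linarith
  have h6 := mul_le_mul_of_nonneg_left h5
    (by positivity : 0 ≤ t₀⁻¹ * Real.exp (-(1 / 4) * (t - t₀)))
  have h7 : J ≤ (2 + M) * J := le_mul_of_one_le_left h3 (by linarith)
  rw [mul_left_comm] at h6
  rw [mul_add (2 + M)]
  exact add_le_add h6 (h2.trans h7)

theorem Data.bound_nonneg (D : Data Ω) (g : Law) {G : ℝ → ℝ} (hG : D.IsEnvelope g G)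
    {t₀ t : ℝ} (ht₀ : 0 < t₀) (ht : t₀ ≤ t) : 0 ≤ D.bound g G t₀ t := by
  have h1 := D.initial_integral_nonneg g hG ht₀.le
  have h3 := D.weighted_integral_nonneg g hG (ht₀.le.trans ht)
  unfold Data.bound
  positivity

/-- The degree condition is the embedding condition of the Poincaré inequality with exponent `β`. -/
theorem Law.embedding_exponent_nonneg (g : Law) {d : ℕ} (hdeg : g.a ≤ 4 / ((d : ℝ) + 2)) :
    0 ≤ 2 + (d : ℝ) - 2 * d / g.β := by
  have hβ := g.β_pos
  have hd : 0 < (d : ℝ) + 2 := by positivity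
  rw [le_div_iff₀ hd] at hdeg
  rw [sub_nonneg, div_le_iff₀ hβ, Law.β]
  linarith

end SemidiscreteProblem

end ForchheimerFlow
end

/-! ### Assembly of the theorem -/

open ForchheimerFlow in
theorem theorem4p4 {d : ℕ} (hd : 2 ≤ d) (g : Law) (hdeg : g.a ≤ 4 / ((d : ℝ) + 2))
    (Ω : Set (Space d)) (hΩo : IsOpen Ω) (hΩb : Bornology.IsBounded Ω)
    (r : ℕ) (σ : ℝ) (hσ : 0 < σ) :
    ∃ C : ℝ, 0 < C ∧
      ∀ (𝒯 : Triangulation Ω), 𝒯.IsQuasiUniform σ →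
      ∀ (D : Data Ω) (ρtil : ℝ → 𝒯.femSpace r), IsSemidiscreteSolution g 𝒯 r D ρtil →
        (∀ G : ℝ → ℝ, D.IsEnvelope g G → ∀ t₀ : ℝ, 0 < t₀ → t₀ < 1 → ∀ t : ℝ, t₀ ≤ t →
          ‖deriv ρtil t‖ ^ 2 ≤ C * D.bound g G t₀ t) ∧
        limsup (fun t => ENNReal.ofReal (‖deriv ρtil t‖ ^ 2)) atTop ≤
          ENNReal.ofReal C *
            (1 + (limsup (fun t => ENNReal.ofReal (D.size g t)) atTop) ^ (2 / g.β)
              + limsup (fun t => ENNReal.ofReal (‖D.φt t‖ ^ 2)) atTop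
              + limsup (fun t => ENNReal.ofReal (‖D.ftilt t‖ ^ 2)) atTop) := by
  have hβ1 := g.one_lt_β
  have hβ2 := g.β_lt_two
  have ha := g.coeff_zero_pos
  have hfin : IsFiniteMeasure (volume.restrict Ω) := ⟨by simpa using hΩb.measure_lt_top⟩
  obtain ⟨Cp, hCp, hPoin⟩ := Triangulation.exists_poincare_le_femSpace hd hΩb r hσ hβ1 hβ2.le
    (g.embedding_exponent_nonneg hdeg)
  obtain ⟨Cg, hCg, hproj⟩ := Triangulation.exists_norm_gradL2_proj_le hd hΩb r hσ
  obtain ⟨c, C, hc, hC, hsys⟩ :=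
    IsFlow.energySystem g (volume.restrict Ω) (Space d) Cp Cg hCp hCg
  obtain ⟨C₁, hC₁, hbound⟩ := EnergySystem.le_bound g.β c C hβ1 hβ2 hc hC
  obtain ⟨C₂, hC₂, hlim⟩ := EnergySystem.eventually_le g.β c C hβ1 hβ2 hc hC
  set M := 1 / g.coeff 0 * Cg with hM
  have hM0 : 0 < M := by positivity
  -- The sum serves both claims. All its ingredients were obtained before the mesh, the data and the
  -- solution were introduced.
  refine ⟨C₁ * (2 + M) + 7 * C₂, by positivity, fun 𝒯 hq D ρtil h => ?_⟩
  have hES := hsys (𝒯.femSpace r) (𝒯.gradL2 r) (hPoin 𝒯 hq) (h.isFlow (hproj 𝒯 hq))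
    (fun t => norm_nonneg _) (fun t => sq_nonneg _) (fun t => sq_nonneg _) (fun t => sq_nonneg _)
  refine ⟨fun G hG t₀ ht₀ ht₁ t ht => ?_, ?_⟩
  · have h1 := hbound hES (D.continuousOn_φt.norm.pow 2) (D.continuousOn_ftilt.norm.pow 2)
      hG.1 hG.2.1 hG.2.2 t₀ ht₀ ht₁ t ht
    have h2 := D.le_mul_bound g hG hM0.le h.norm_oscillation_zero_sq_le
      (h.energy_zero_le (hproj 𝒯 hq)) ht₀ ht
    rw [h.deriv_eq (ht₀.trans_le ht)]
    calc _ ≤ C₁ * ((2 + M) * D.bound g G t₀ t) :=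
          h1.trans (mul_le_mul_of_nonneg_left h2 hC₁.le)
      _ = C₁ * (2 + M) * D.bound g G t₀ t := by ring
      _ ≤ _ := mul_le_mul_of_nonneg_right (le_add_of_nonneg_right (by positivity))
          (D.bound_nonneg g hG ht₀ ht)
  · have h1 : limsup (fun t => ENNReal.ofReal (‖deriv ρtil t‖ ^ 2)) atTop ≤
          ENNReal.ofReal (7 * C₂) *
            (1 + (limsup (fun t => ENNReal.ofReal (D.size g t)) atTop) ^ (2 / g.β)
              + limsup (fun t => ENNReal.ofReal (‖D.φt t‖ ^ 2)) atTop
              + limsup (fun t => ENNReal.ofReal (‖D.ftilt t‖ ^ 2)) atTop) := by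
      refine limsup_ofReal_le hC₂ (by positivity) ?_ fun hL hLP hLQ hS hP hQ => ?_
      · rw [div_le_iff₀ (by linarith)]
        linarith
      -- The velocity formula holds only for t > 0, which suffices at infinity.
      · filter_upwards [hlim hES hL hLP hLQ hS hP hQ, eventually_gt_atTop 0] with t ht ht0
        rw [h.deriv_eq ht0]
        exact ht
    refine h1.trans ?_
    gcongr
    exact le_add_of_nonneg_left (by positivity)
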